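/- **Setting.** Let $(M,g)$ be a connected, globally hyperbolic, oriented and time-oriented four-dimensional spacetime of signature $(+,-,-,-)$, with a spin structure and a global section $E$ of its (trivial) spin bundle lying over an oriented, time-oriented orthonormal frame $e_0,\dots,e_3$. Let $\xi=(\xi_1,\xi_2)$ be a Killing pair: two pointwise linearly independent, spacelike, complete, commuting Killing fields, with joint flow $\varphi_{\xi,s}$, $s\in\mathbb R^2$, lifted continuously to the spin bundle with the identity at $s=0$. Let $m\ge 0$. *One-particle space.* With the gamma matrices $\gamma_0=\begin{pmatrix}1&0\\0&-1\end{pmatrix}$, $\gamma_a=\begin{pmatrix}0&\sigma_a\\-\sigma_a&0\end{pmatrix}$ ($a=1,2,3$), let $S$ and $S_*$ be the causal propagators (advanced minus retarded in the sense $S=S^+-S^-$, where $S^\pm f$ is supported in $J^\pm(\operatorname{supp}f)$) of the Dirac operators $D=-i\gamma^\mu\nabla_\mu+m$ on spinors and $D'=+i\gamma^\mu\nabla_\mu+m$ on cospinors. Let $\beta=\gamma_0$, and let $\mathcal D$ be the space of smooth compactly supported sections $f_1\oplus f_2$ of $DM\oplus D^*M$, with the conjugation $\Gamma$ sending a spinor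 $f_1$ to the cospinor $f_1^*\beta$ and a cospinor $f_2$ to the spinor $\beta^{-1}f_2^*$, and with the form $$\langle f_1\oplus f_2,h_1\oplus h_2\rangle_S=-i\int_M f_1^*\beta\,Sh_1+i\int_M (S_*h_2)\,\beta^{-1}f_2^* .$$ Put $\mathcal K=\mathcal D/(\ker S\oplus\ker S_*)$. Isometries, lifted to the spin bundle, act on $\mathcal D$ by $u$; let $u_\xi(s)=u(\varphi_{\xi,s})$. *Fields and state.* Let $\mathfrak F=\mathrm{CAR}(\mathcal K,\Gamma)$ be the unital $C^*$-algebra generated by elements $B(f)$, $f\in\mathcal K$, linear in $f$, with $B(f)^*=B(\Gamma f)$ and $\{B(f),B(h)\}=\langle\Gamma f,h\rangle_S\cdot 1$. Let $\omega$ be a state on $\mathfrak F$ which is invariant under the isometries, that is, all $\omega_n(f_1,\dots,f_n):=\omega(B(f_1)\cdots B(f_n))$ are invariant under $f_i\mapsto u(h)f_i$, and quasifree, that is, $\omega_n$ is the signed sum over all pairings of products of $\omega_2$ (so $\omega_n=0$ for odd $n$). Let $(\mathcal H,\pi,\Omega)$ be its GNS triple, $U$ the unitaries on $\mathcal H$ which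 leave $\Omega$ invariant and implement the isometries, and $U_\xi(s)=U(\varphi_{\xi,s})$; identify $B(f)$ with $\pi(B(f))$. *Deformation.* Let $\lambda\in\mathbb R$ and $Q=\begin{pmatrix}0&1\\-1&0\end{pmatrix}$. Let $\chi\in C_0^\infty(\mathbb R^2\times\mathbb R^2)$ with $\chi(0,0)=1$ be a cutoff function. The warped field $B(f)_{\xi,\lambda}$ is given on smooth vectors $\Psi$ of $U_\xi$ by the limit in $\mathcal H$ $$B(f)_{\xi,\lambda}\Psi=\frac1{4\pi^2}\lim_{\varepsilon\to0^+}\int ds\,ds'\,e^{-is\cdot s'}\chi(\varepsilon s,\varepsilon s')\,U_\xi(\lambda Qs)B(f)U_\xi(s'-\lambda Qs)\Psi ,$$ which is independent of $\chi$, and the deformed $n$-point functions are $\omega_n^{\xi,\lambda}(f_1,\dots,f_n)=\langle\Omega,B(f_1)_{\xi,\lambda}\cdots B(f_n)_{\xi,\lambda}\Omega\rangle$. **Proposition.** All vectors $B(f_1)_{\xi,\lambda}\cdots B(f_n)_{\xi,\lambda}\Omega$ are well defined: they are smooth vectors of $U_\xi$, and the limits defining them exist and do not depend on $\chi$. Moreover: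 1. $\omega_n^{\xi,\lambda}=0$ for all odd $n$. 2. $\omega_2^{\xi,\lambda}(f_1,f_2)=\omega_2(f_1,f_2)$ for all $f_1,f_2\in\mathcal K$. 3. For all $f_1,\dots,f_4\in\mathcal K$, $$\omega_4^{\xi,\lambda}(f_1,f_2,f_3,f_4)=\omega_2(f_1,f_2)\,\omega_2(f_3,f_4)+\omega_2(f_1,f_4)\,\omega_2(f_2,f_3)$$ $$\qquad-\frac1{4\pi^2}\lim_{\varepsilon\to0^+}\int ds\,ds'\,e^{-is\cdot s'}\chi(\varepsilon s,\varepsilon s')\,\omega_2(f_1,u_\xi(s)f_3)\;\omega_2(f_2,u_\xi(-2\lambda Qs')f_4),$$ where the limit exists and does not depend on the cutoff function $\chi$. -/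

import Mathlib

open Set Filter Topology MeasureTheory
open scoped Manifold ContDiff Matrix

set_option linter.unusedSectionVars false

noncomputable section

namespace WarpedDirac

/-! ## Matrices -/

/-- The diagonal entries of the flat Minkowski metric with signature `(+,-,-,-)`. -/
def eta (a : Fin 4) : ℝ := if a = 0 then 1 else -1

/-- `σ_0 = 1` and the three Pauli matrices. -/
def pauli : Fin 4 → Matrix (Fin 2) (Fin 2) ℂ
  | 0 => 1
  | 1 => !![0, 1; 1, 0]
  | 2 => !![0, -Complex.I; Complex.I, 0]
  | 3 => !![1, 0; 0, -1]

/-- A `4 × 4` matrix assembled from four `2 × 2` blocks. -/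
def blocks (P Q R S : Matrix (Fin 2) (Fin 2) ℂ) : Matrix (Fin 4) (Fin 4) ℂ :=
  (Matrix.fromBlocks P Q R S).reindex finSumFinEquiv finSumFinEquiv

/-- The gamma matrices `γ_a` (lower index): `γ_0 = diag(1, -1)`, `γ_a = (0, σ_a; -σ_a, 0)`. -/
def gammaLow (a : Fin 4) : Matrix (Fin 4) (Fin 4) ℂ :=
  if a = 0 then blocks 1 0 0 (-1) else blocks 0 (pauli a) (-pauli a) 0

/-- The gamma matrices `γ^a = η^{aa} γ_a` (upper index). -/
def gammaUp (a : Fin 4) : Matrix (Fin 4) (Fin 4) ℂ := ((eta a : ℝ) : ℂ) • gammaLow a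

/-- The Dirac conjugation matrix `β`: the selfadjoint matrix of determinant one with
`γ_a^* = β γ_a β⁻¹` and `β n^a γ_a` positive definite for every future directed timelike `n`. -/
def beta : Matrix (Fin 4) (Fin 4) ℂ := gammaLow 0

/-- The special linear group `SL(2, ℂ)`. -/
abbrev SL2C : Type := Matrix.SpecialLinearGroup (Fin 2) ℂ

/-- The representation `T = D^{(1/2,0)} ⊕ D^{(0,1/2)}` of `SL(2, ℂ)` on `ℂ⁴`, that is
`L ↦ diag(L, (L⁻¹)^*)`, written in the basis of `ℂ⁴` in which the gamma matrices are `gammaLow`. -/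
def spinRep (L : SL2C) : Matrix (Fin 4) (Fin 4) ℂ :=
  let P : Matrix (Fin 2) (Fin 2) ℂ := (L : Matrix (Fin 2) (Fin 2) ℂ)
  let R : Matrix (Fin 2) (Fin 2) ℂ := ((L⁻¹ : SL2C) : Matrix (Fin 2) (Fin 2) ℂ)ᴴ
  (2⁻¹ : ℂ) • blocks (R + P) (R - P) (R - P) (R + P)

/-- The covering homomorphism from `SL(2, ℂ)` to the proper orthochronous Lorentz group:
`L σ_a L^* = ∑_b Λ(L)^b_a σ_b`. -/
def lorentz (L : SL2C) (b a : Fin 4) : ℝ :=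
  ((2⁻¹ : ℂ) * (pauli b * (L : Matrix (Fin 2) (Fin 2) ℂ) * pauli a *
    (L : Matrix (Fin 2) (Fin 2) ℂ)ᴴ).trace).re

/-! ## Spacetimes with a spin frame -/

/-- The model space of four-dimensional manifolds. -/
abbrev R4 : Type := EuclideanSpace ℝ (Fin 4)

/-- The plane `ℝ²` of flow parameters. -/
abbrev Plane : Type := EuclideanSpace ℝ (Fin 2)

/-- An oriented, time-oriented Lorentzian four-manifold together with a spin structure.
The spin bundle `SM` of such a (globally hyperbolic) spacetime is trivial, and a spin structure
together with a global section `E` of `SM` is recorded through the smooth, global, orthonormal,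
oriented and time-oriented frame `e = ρ ∘ E`: then `SM = M × SL(2, ℂ)` and
`ρ(p, L) = e(p) Λ(L)`.  The metric is smooth because the orthonormal frame is.
The orientation is the one of the frame, and `e 0` is future directed. -/
structure SpinSpacetime (M : Type*) [TopologicalSpace M] [ChartedSpace R4 M]
    [IsManifold (𝓡 4) ∞ M] where
  /-- the Lorentzian metric -/
  g : (p : M) → TangentSpace (𝓡 4) p →ₗ[ℝ] TangentSpace (𝓡 4) p →ₗ[ℝ] ℝ
  /-- the frame underlying the spin frame -/
  e : Fin 4 → (p : M) → TangentSpace (𝓡 4) p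
  symm : ∀ p v w, g p v w = g p w v
  smooth : ∀ a, ContMDiff (𝓡 4) (𝓡 4).tangent ∞
    (fun p => (⟨p, e a p⟩ : TangentBundle (𝓡 4) M))
  orthonormal : ∀ p a b, g p (e a p) (e b p) = if a = b then eta a else 0

section Geometry

variable {M : Type*} [TopologicalSpace M] [ChartedSpace R4 M] [IsManifold (𝓡 4) ∞ M]

/-- `v` is causal and future directed (in particular nonzero). -/
def SpinSpacetime.FutureCausal (X : SpinSpacetime M) (p : M) (v : TangentSpace (𝓡 4) p) : Prop :=
  0 ≤ X.g p v v ∧ 0 < X.g p (X.e 0 p) v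

/-- There is a future directed causal `C¹` curve from `p` to `q`. -/
def SpinSpacetime.CausalStep (X : SpinSpacetime M) (p q : M) : Prop :=
  ∃ c : ℝ → M, ContMDiffOn 𝓘(ℝ, ℝ) (𝓡 4) 1 c (Icc 0 1) ∧ c 0 = p ∧ c 1 = q ∧
    ∀ t ∈ Icc (0 : ℝ) 1,
      X.FutureCausal (c t) (mfderivWithin 𝓘(ℝ, ℝ) (𝓡 4) c (Icc 0 1) t (1 : ℝ))

/-- `q ∈ J⁺(p)`: there is a piecewise `C¹` future directed causal curve from `p` to `q`,
or `p = q`. -/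
def SpinSpacetime.Precedes (X : SpinSpacetime M) (p q : M) : Prop :=
  Relation.ReflTransGen X.CausalStep p q

/-- The causal future `J⁺(O)`. -/
def SpinSpacetime.causalFuture (X : SpinSpacetime M) (O : Set M) : Set M :=
  {q | ∃ p ∈ O, X.Precedes p q}

/-- The causal past `J⁻(O)`. -/
def SpinSpacetime.causalPast (X : SpinSpacetime M) (O : Set M) : Set M :=
  {q | ∃ p ∈ O, X.Precedes q p}

/-- Global hyperbolicity: there are no closed causal curves, and the sets `J⁺(p) ∩ J⁻(q)` are
compact. -/
def SpinSpacetime.GloballyHyperbolic (X : SpinSpacetime M) : Prop :=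
  (∀ p, ¬ Relation.TransGen X.CausalStep p p) ∧
    ∀ p q, IsCompact {r | X.Precedes p r ∧ X.Precedes r q}

/-- The coordinates of the frame vector `e_a` at `p` in the preferred chart at `x`. -/
def SpinSpacetime.frameCoord (X : SpinSpacetime M) (x : M) (a : Fin 4) (p : M) : R4 :=
  mfderiv (𝓡 4) 𝓘(ℝ, R4) (chartAt R4 x) p (X.e a p)

/-- `μ` is the volume measure of the metric: in every preferred chart it has the density
`√|det g| = |det (e_a^i)|⁻¹` with respect to Lebesgue measure, `e_a^i` being the `i`-th coordinate
of the frame vector `e_a`. -/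
def SpinSpacetime.IsVolume (X : SpinSpacetime M) [MeasurableSpace M] (μ : Measure M) : Prop :=
  ∀ (x : M) (s : Set M), MeasurableSet s → s ⊆ (chartAt R4 x).source →
    μ s = ∫⁻ y in (chartAt R4 x) '' s, ENNReal.ofReal
      |(Matrix.of fun i a : Fin 4 => X.frameCoord x a ((chartAt R4 x).symm y) i).det|⁻¹

/-! ## The Dirac equation -/

/-- The connection coefficients `Γ^b_{ad}` of the Levi-Civita connection in the frame,
`∇_{e_a} e_d = ∑_b Γ^b_{ad} e_b`, computed by the Koszul formula
`2 g(∇_X Y, Z) = g([X,Y],Z) - g([Y,Z],X) - g([X,Z],Y)` for vector fields with constant mutual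
inner products. -/
def SpinSpacetime.Gam (X : SpinSpacetime M) (p : M) (b a d : Fin 4) : ℝ :=
  eta b * 2⁻¹ *
    (X.g p (VectorField.mlieBracket (𝓡 4) (X.e a) (X.e d) p) (X.e b p)
      - X.g p (VectorField.mlieBracket (𝓡 4) (X.e d) (X.e b) p) (X.e a p)
      - X.g p (VectorField.mlieBracket (𝓡 4) (X.e a) (X.e b) p) (X.e d p))

/-- The spin connection matrices `σ_a = ¼ ∑_{b,d} Γ^b_{ad} γ_b γ^d`. -/
def SpinSpacetime.spinConn (X : SpinSpacetime M) (p : M) (a : Fin 4) :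
    Matrix (Fin 4) (Fin 4) ℂ :=
  (4⁻¹ : ℂ) • ∑ b, ∑ d, ((X.Gam p b a d : ℝ) : ℂ) • (gammaLow b * gammaUp d)

/-- The derivative of the components of a (co)spinor along the frame vector `e_a`. -/
def SpinSpacetime.dir (X : SpinSpacetime M) (a : Fin 4) (f : M → Fin 4 → ℂ) (p : M) :
    Fin 4 → ℂ :=
  mfderiv (𝓡 4) 𝓘(ℝ, Fin 4 → ℂ) f p (X.e a p)

/-- The covariant derivative `∇_{e_a} ψ` of a Dirac spinor with components `ψ` in the
spin frame `E_A`. -/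
def SpinSpacetime.nabla (X : SpinSpacetime M) (a : Fin 4) (f : M → Fin 4 → ℂ) (p : M) :
    Fin 4 → ℂ :=
  X.dir a f p + X.spinConn p a *ᵥ f p

/-- The covariant derivative `∇_{e_a} ψ'` of a Dirac cospinor with components `ψ'` in the
dual frame `E^A` (row vectors). -/
def SpinSpacetime.conabla (X : SpinSpacetime M) (a : Fin 4) (f : M → Fin 4 → ℂ) (p : M) :
    Fin 4 → ℂ :=
  X.dir a f p - f p ᵥ* X.spinConn p a

/-- The Dirac operator `D = -i γ^μ ∇_μ + m` on spinors. -/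
def SpinSpacetime.dirac (X : SpinSpacetime M) (m : ℝ) (f : M → Fin 4 → ℂ) (p : M) :
    Fin 4 → ℂ :=
  (-Complex.I) • (∑ a, gammaUp a *ᵥ X.nabla a f p) + (m : ℂ) • f p

/-- The Dirac operator `D' = +i γ^μ ∇_μ + m` on cospinors. -/
def SpinSpacetime.codirac (X : SpinSpacetime M) (m : ℝ) (f : M → Fin 4 → ℂ) (p : M) :
    Fin 4 → ℂ :=
  Complex.I • (∑ a, X.conabla a f p ᵥ* gammaUp a) + (m : ℂ) • f p

variable (M) in
/-- Smooth (co)spinor fields, through their four components in the spin frame. -/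
def smoothSections : Submodule ℂ (M → Fin 4 → ℂ) where
  carrier := {f | ContMDiff (𝓡 4) 𝓘(ℝ, Fin 4 → ℂ) ∞ f}
  add_mem' := fun hf hg => ContMDiff.add hf hg
  zero_mem' := contMDiff_const
  smul_mem' := fun c _ hf => by
    have h : ContDiff ℝ ∞ (fun v : Fin 4 → ℂ => c • v) := contDiff_const_smul c
    exact h.contMDiff.comp hf

variable (M) in
/-- Smooth compactly supported (co)spinor fields. -/
def testSections : Submodule ℂ (M → Fin 4 → ℂ) where
  carrier := {f | ContMDiff (𝓡 4) 𝓘(ℝ, Fin 4 → ℂ) ∞ f ∧ HasCompactSupport f}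
  add_mem' := fun hf hg => ⟨ContMDiff.add hf.1 hg.1, hf.2.add hg.2⟩
  zero_mem' := ⟨contMDiff_const, HasCompactSupport.zero⟩
  smul_mem' := fun c _ hf =>
    ⟨(smoothSections M).smul_mem c hf.1, hf.2.comp_left (g := fun v => c • v) (smul_zero c)⟩

/-- Advanced and retarded fundamental solutions `S^±` of the Dirac operator on spinors and `S_*^±`
of the Dirac operator on cospinors. -/
structure FundamentalSolutions (X : SpinSpacetime M) (m : ℝ) where
  Sp : testSections M →ₗ[ℂ] smoothSections M
  Sm : testSections M →ₗ[ℂ] smoothSections M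
  coSp : testSections M →ₗ[ℂ] smoothSections M
  coSm : testSections M →ₗ[ℂ] smoothSections M
  D_Sp : ∀ f, X.dirac m (Sp f : M → Fin 4 → ℂ) = f
  D_Sm : ∀ f, X.dirac m (Sm f : M → Fin 4 → ℂ) = f
  D_coSp : ∀ f, X.codirac m (coSp f : M → Fin 4 → ℂ) = f
  D_coSm : ∀ f, X.codirac m (coSm f : M → Fin 4 → ℂ) = f
  Sp_D : ∀ f h : testSections M, X.dirac m (f : M → Fin 4 → ℂ) = h →
    (Sp h : M → Fin 4 → ℂ) = f
  Sm_D : ∀ f h : testSections M, X.dirac m (f : M → Fin 4 → ℂ) = h →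
    (Sm h : M → Fin 4 → ℂ) = f
  coSp_D : ∀ f h : testSections M, X.codirac m (f : M → Fin 4 → ℂ) = h →
    (coSp h : M → Fin 4 → ℂ) = f
  coSm_D : ∀ f h : testSections M, X.codirac m (f : M → Fin 4 → ℂ) = h →
    (coSm h : M → Fin 4 → ℂ) = f
  supp_Sp : ∀ f, tsupport (Sp f : M → Fin 4 → ℂ) ⊆
    X.causalFuture (tsupport (f : M → Fin 4 → ℂ))
  supp_Sm : ∀ f, tsupport (Sm f : M → Fin 4 → ℂ) ⊆
    X.causalPast (tsupport (f : M → Fin 4 → ℂ))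
  supp_coSp : ∀ f, tsupport (coSp f : M → Fin 4 → ℂ) ⊆
    X.causalFuture (tsupport (f : M → Fin 4 → ℂ))
  supp_coSm : ∀ f, tsupport (coSm f : M → Fin 4 → ℂ) ⊆
    X.causalPast (tsupport (f : M → Fin 4 → ℂ))

/-- The causal propagator `S = S⁺ - S⁻` on spinors. -/
def FundamentalSolutions.S {X : SpinSpacetime M} {m : ℝ} (G : FundamentalSolutions X m) :
    testSections M →ₗ[ℂ] smoothSections M := G.Sp - G.Sm

/-- The causal propagator `S_* = S_*⁺ - S_*⁻` on cospinors. -/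
def FundamentalSolutions.coS {X : SpinSpacetime M} {m : ℝ} (G : FundamentalSolutions X m) :
    testSections M →ₗ[ℂ] smoothSections M := G.coSp - G.coSm

/-! ## The one-particle space -/

variable (M) in
/-- `𝒟`, the smooth compactly supported sections `f₁ ⊕ f₂` of `DM ⊕ D^*M`. -/
abbrev Test : Type _ := testSections M × testSections M

theorem smooth_mul {f k : M → ℂ} (hf : ContMDiff (𝓡 4) 𝓘(ℝ, ℂ) ∞ f)
    (hk : ContMDiff (𝓡 4) 𝓘(ℝ, ℂ) ∞ k) :
    ContMDiff (𝓡 4) 𝓘(ℝ, ℂ) ∞ (fun p => f p * k p) := by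
  have h : ContDiff ℝ ∞ (fun v : ℂ × ℂ => v.1 * v.2) := contDiff_fst.mul contDiff_snd
  exact h.contMDiff.comp (hf.prodMk_space hk)

theorem smooth_add {f k : M → ℂ} (hf : ContMDiff (𝓡 4) 𝓘(ℝ, ℂ) ∞ f)
    (hk : ContMDiff (𝓡 4) 𝓘(ℝ, ℂ) ∞ k) :
    ContMDiff (𝓡 4) 𝓘(ℝ, ℂ) ∞ (fun p => f p + k p) := hf.add hk

theorem smooth_neg {f : M → ℂ} (hf : ContMDiff (𝓡 4) 𝓘(ℝ, ℂ) ∞ f) :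
    ContMDiff (𝓡 4) 𝓘(ℝ, ℂ) ∞ (fun p => -f p) := by
  have h : ContDiff ℝ ∞ (fun v : ℂ => -v) := contDiff_neg
  exact h.contMDiff.comp hf

theorem smooth_conj {f : M → ℂ} (hf : ContMDiff (𝓡 4) 𝓘(ℝ, ℂ) ∞ f) :
    ContMDiff (𝓡 4) 𝓘(ℝ, ℂ) ∞ (fun p => star (f p)) := by
  have h : ContDiff ℝ ∞ (fun v : ℂ => star v) := Complex.conjCLE.contDiff
  exact h.contMDiff.comp hf

theorem smooth_matrix_mulVec {A : M → Matrix (Fin 4) (Fin 4) ℂ} {f : M → Fin 4 → ℂ}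
    (hA : ∀ i j, ContMDiff (𝓡 4) 𝓘(ℝ, ℂ) ∞ (fun p => A p i j))
    (hf : ContMDiff (𝓡 4) 𝓘(ℝ, Fin 4 → ℂ) ∞ f) :
    ContMDiff (𝓡 4) 𝓘(ℝ, Fin 4 → ℂ) ∞ (fun p => A p *ᵥ f p) := by
  rw [contMDiff_pi_space] at hf ⊢
  intro i
  simp only [Matrix.mulVec, dotProduct, Fin.sum_univ_four]
  exact smooth_add (smooth_add (smooth_add (smooth_mul (hA i 0) (hf 0))
    (smooth_mul (hA i 1) (hf 1))) (smooth_mul (hA i 2) (hf 2))) (smooth_mul (hA i 3) (hf 3))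

theorem smooth_star {f : M → Fin 4 → ℂ}
    (hf : ContMDiff (𝓡 4) 𝓘(ℝ, Fin 4 → ℂ) ∞ f) :
    ContMDiff (𝓡 4) 𝓘(ℝ, Fin 4 → ℂ) ∞ (fun p => star (f p)) := by
  rw [contMDiff_pi_space] at hf ⊢
  exact fun i => smooth_conj (hf i)

/-- The cospinor `f^* β` of a spinor `f`. -/
def adjSpinor (f : testSections M) : testSections M :=
  ⟨fun p => star ((f : M → Fin 4 → ℂ) p) ᵥ* beta, by
    refine ⟨?_, f.2.2.comp_left (g := fun v : Fin 4 → ℂ => star v ᵥ* beta) (by simp)⟩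
    have := smooth_matrix_mulVec (A := fun _ : M => betaᵀ) (fun i j => contMDiff_const)
      (smooth_star f.2.1)
    simpa only [Matrix.mulVec_transpose] using this⟩

/-- The spinor `β⁻¹ f^*` of a cospinor `f`. -/
def adjCospinor (f : testSections M) : testSections M :=
  ⟨fun p => beta⁻¹ *ᵥ star ((f : M → Fin 4 → ℂ) p), by
    refine ⟨?_, f.2.2.comp_left (g := fun v : Fin 4 → ℂ => beta⁻¹ *ᵥ star v) (by simp)⟩
    exact smooth_matrix_mulVec (A := fun _ : M => beta⁻¹) (fun i j => contMDiff_const)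
      (smooth_star f.2.1)⟩

/-- The conjugation `Γ` on `𝒟`: a spinor `f₁` gives the cospinor `f₁^* β`, a cospinor `f₂` gives
the spinor `β⁻¹ f₂^*`. -/
def conj (f : Test M) : Test M := (adjCospinor f.2, adjSpinor f.1)

variable {X : SpinSpacetime M} {m : ℝ}

/-- The sesquilinear form
`(f₁ ⊕ f₂, h₁ ⊕ h₂) = -i ⟨f₁^* β, S h₁⟩ + i ⟨S_* h₂, β⁻¹ f₂^*⟩` on `𝒟`, where `⟨ , ⟩` integrates
the pairing of a cospinor with a spinor over the spacetime. -/
def FundamentalSolutions.form (G : FundamentalSolutions X m) [MeasurableSpace M] (μ : Measure M)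
    (f h : Test M) : ℂ :=
  -Complex.I * (∫ p, (adjSpinor f.1 : M → Fin 4 → ℂ) p ⬝ᵥ (G.S h.1 : M → Fin 4 → ℂ) p ∂μ)
    + Complex.I *
      (∫ p, (G.coS h.2 : M → Fin 4 → ℂ) p ⬝ᵥ (adjCospinor f.2 : M → Fin 4 → ℂ) p ∂μ)

/-- The one-particle space `𝒦 = 𝒟 / (ker S ⊕ ker S_*)`. -/
abbrev FundamentalSolutions.K (G : FundamentalSolutions X m) : Type _ :=
  Test M ⧸ (LinearMap.ker G.S).prod (LinearMap.ker G.coS)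

/-- The class of `f ∈ 𝒟` in `𝒦`. -/
def FundamentalSolutions.cls (G : FundamentalSolutions X m) (f : Test M) : G.K :=
  Submodule.Quotient.mk f

/-! ## Isometries and Killing pairs -/

/-- An (orientation and time orientation preserving) isometry `h` of the spacetime together with
a lift to the spin bundle.  The lift is given by the smooth function `L : M → SL(2, ℂ)` which maps
the spin frame `E(p)` to `E(h p) L(h p)`; the equation `frame` says that it covers the action of
the differential of `h` on the frame, and contains the isometry property of `h`. -/
structure SpinIsometry (X : SpinSpacetime M) where
  h : M ≃ M
  L : M → SL2C
  smooth : ContMDiff (𝓡 4) (𝓡 4) ∞ h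
  smooth_symm : ContMDiff (𝓡 4) (𝓡 4) ∞ h.symm
  smooth_L : ∀ i j, ContMDiff (𝓡 4) 𝓘(ℝ, ℂ) ∞ (fun p => (L p : Matrix (Fin 2) (Fin 2) ℂ) i j)
  frame : ∀ p a, mfderiv (𝓡 4) (𝓡 4) h p (X.e a p) =
    ∑ b, lorentz (L (h p)) b a • X.e b (h p)

theorem smooth_inv_entry {L : M → SL2C}
    (hL : ∀ i j, ContMDiff (𝓡 4) 𝓘(ℝ, ℂ) ∞
      (fun p => (L p : Matrix (Fin 2) (Fin 2) ℂ) i j)) (i j : Fin 2) :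
    ContMDiff (𝓡 4) 𝓘(ℝ, ℂ) ∞
      (fun p => (((L p)⁻¹ : SL2C) : Matrix (Fin 2) (Fin 2) ℂ) i j) := by
  simp only [Matrix.SpecialLinearGroup.coe_inv, Matrix.adjugate_fin_two]
  fin_cases i <;> fin_cases j <;> simp <;> first | exact hL _ _ | exact smooth_neg (hL _ _)

theorem smooth_spinRep {L : M → SL2C}
    (hL : ∀ i j, ContMDiff (𝓡 4) 𝓘(ℝ, ℂ) ∞
      (fun p => (L p : Matrix (Fin 2) (Fin 2) ℂ) i j)) (i j : Fin 4) :
    ContMDiff (𝓡 4) 𝓘(ℝ, ℂ) ∞ (fun p => spinRep (L p) i j) := by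
  have hinv : ∀ i j, ContMDiff (𝓡 4) 𝓘(ℝ, ℂ) ∞
      (fun p => (((L p)⁻¹ : SL2C) : Matrix (Fin 2) (Fin 2) ℂ)ᴴ i j) := fun i j =>
    smooth_conj (smooth_inv_entry hL j i)
  have hsub : ∀ {f k : M → ℂ}, ContMDiff (𝓡 4) 𝓘(ℝ, ℂ) ∞ f → ContMDiff (𝓡 4) 𝓘(ℝ, ℂ) ∞ k →
      ContMDiff (𝓡 4) 𝓘(ℝ, ℂ) ∞ (fun p => f p - k p) := fun {f k} hf hk => by
    simpa only [sub_eq_add_neg] using smooth_add hf (smooth_neg hk)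
  simp only [spinRep, blocks, Matrix.smul_apply, Matrix.reindex_apply, Matrix.submatrix_apply,
    smul_eq_mul]
  refine smooth_mul contMDiff_const ?_
  generalize (finSumFinEquiv (m := 2) (n := 2)).symm i = i₀
  generalize (finSumFinEquiv (m := 2) (n := 2)).symm j = j₀
  rcases i₀ with i₀ | i₀ <;> rcases j₀ with j₀ | j₀ <;>
    simp only [Matrix.fromBlocks_apply₁₁, Matrix.fromBlocks_apply₁₂, Matrix.fromBlocks_apply₂₁,
      Matrix.fromBlocks_apply₂₂, Matrix.add_apply, Matrix.sub_apply] <;>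
    first
      | exact smooth_add (hinv _ _) (hL _ _)
      | exact hsub (hinv _ _) (hL _ _)

/-- The homeomorphism underlying a spin isometry. -/
def SpinIsometry.homeo (k : SpinIsometry X) : M ≃ₜ M where
  toEquiv := k.h
  continuous_toFun := k.smooth.continuous
  continuous_invFun := k.smooth_symm.continuous

/-- The action of a spin isometry on test spinors, `(k f)(q) = T(L(q)) f(h⁻¹ q)`. -/
def SpinIsometry.actSpinor (k : SpinIsometry X) (f : testSections M) : testSections M :=
  ⟨fun q => spinRep (k.L q) *ᵥ (f : M → Fin 4 → ℂ) (k.h.symm q), by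
    refine ⟨smooth_matrix_mulVec (smooth_spinRep k.smooth_L) (f.2.1.comp k.smooth_symm), ?_⟩
    refine (f.2.2.comp_homeomorph k.homeo.symm).mono ?_
    intro q hq h0
    apply hq
    have h1 : (f : M → Fin 4 → ℂ) (k.h.symm q) = 0 := h0
    simp [h1]⟩

/-- The action of a spin isometry on test cospinors, `(k f)(q) = f(h⁻¹ q) T(L(q))⁻¹`. -/
def SpinIsometry.actCospinor (k : SpinIsometry X) (f : testSections M) : testSections M :=
  ⟨fun q => (f : M → Fin 4 → ℂ) (k.h.symm q) ᵥ* spinRep (k.L q)⁻¹, by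
    refine ⟨?_, ?_⟩
    · have := smooth_matrix_mulVec (A := fun q => (spinRep (k.L q)⁻¹)ᵀ)
        (fun i j => smooth_spinRep (L := fun q => (k.L q)⁻¹) (smooth_inv_entry k.smooth_L) j i)
        (f.2.1.comp k.smooth_symm)
      simpa only [Matrix.mulVec_transpose, Function.comp_apply] using this
    · refine (f.2.2.comp_homeomorph k.homeo.symm).mono ?_
      intro q hq h0
      apply hq
      have h1 : (f : M → Fin 4 → ℂ) (k.h.symm q) = 0 := h0
      simp [h1]⟩

/-- The action `u(k)` of a spin isometry `k` on `𝒟`. -/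
def SpinIsometry.u (k : SpinIsometry X) (f : Test M) : Test M :=
  (k.actSpinor f.1, k.actCospinor f.2)

/-- A Killing pair `ξ = (ξ₁, ξ₂)`: two pointwise linearly independent, spacelike, complete,
commuting Killing fields, together with their joint smooth isometric flow
`φ_{ξ,s} = φ_{ξ₁,s₁} ∘ φ_{ξ₂,s₂}`, `s ∈ ℝ²`. -/
structure KillingPair (X : SpinSpacetime M) where
  xi : Fin 2 → (p : M) → TangentSpace (𝓡 4) p
  spacelike : ∀ i p, X.g p (xi i p) (xi i p) < 0
  linInd : ∀ p, LinearIndependent ℝ (fun i => xi i p)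
  flow : Plane → M → M
  smooth : ContMDiff (𝓘(ℝ, Plane).prod (𝓡 4)) (𝓡 4) ∞ (fun z : Plane × M => flow z.1 z.2)
  flow_zero : ∀ p, flow 0 p = p
  flow_add : ∀ s t p, flow (s + t) p = flow s (flow t p)
  isometric : ∀ s p v w,
    X.g (flow s p) (mfderiv (𝓡 4) (𝓡 4) (flow s) p v) (mfderiv (𝓡 4) (𝓡 4) (flow s) p w) =
      X.g p v w
  integral : ∀ i p,
    IsMIntegralCurve (fun t : ℝ => flow (t • EuclideanSpace.single i (1 : ℝ)) p) (xi i)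

/-- The lift of the flow `φ_ξ` to the spin bundle: the smooth family `s ↦ φ̃_{ξ,s}` of
spin isometries over `φ_{ξ,s}` which starts at the identity and is a homomorphism. -/
structure SpinFlow {X : SpinSpacetime M} (ξ : KillingPair X) where
  lift : Plane → SpinIsometry X
  lift_h : ∀ s p, (lift s).h p = ξ.flow s p
  lift_zero : ∀ p, (lift 0).L p = 1
  lift_add : ∀ s t p, (lift (s + t)).L p = (lift s).L p * (lift t).L (ξ.flow (-s) p)
  smooth : ∀ i j, ContMDiff (𝓘(ℝ, Plane).prod (𝓡 4)) 𝓘(ℝ, ℂ) ∞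
    (fun z : Plane × M => ((lift z.1).L z.2 : Matrix (Fin 2) (Fin 2) ℂ) i j)

end Geometry

/-! ## The CAR algebra, states and their GNS representations -/

section Fields

variable {M : Type*} [TopologicalSpace M] [ChartedSpace R4 M] [IsManifold (𝓡 4) ∞ M]
variable {X : SpinSpacetime M} {m : ℝ} [MeasurableSpace M]
variable {A : Type*} [CStarAlgebra A]

/-- `A`, with the field `B`, is the algebra `CAR(𝒦, Γ)`: the unital `C^*`-algebra generated by
elements `B(f)`, `f ∈ 𝒦`, which depend linearly on `f` and satisfy `B(f)^* = B(Γ f)` and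
`{B(f), B(h)} = ⟨Γ f, h⟩_S · 1`. -/
structure IsCAR (G : FundamentalSolutions X m) (μ : Measure M) (B : G.K →ₗ[ℂ] A) : Prop where
  star_field : ∀ f : Test M, star (B (G.cls f)) = B (G.cls (conj f))
  anticomm : ∀ f h : Test M,
    B (G.cls f) * B (G.cls h) + B (G.cls h) * B (G.cls f) =
      algebraMap ℂ A (G.form μ (conj f) h)
  generates : closure (StarAlgebra.adjoin ℂ (Set.range B) : Set A) = Set.univ

/-- The monomial `B(f₁) ⋯ B(f_n)`. -/
def monomial (G : FundamentalSolutions X m) (B : G.K →ₗ[ℂ] A) (l : List (Test M)) : A :=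
  (l.map fun f => B (G.cls f)).prod

/-- A state on a unital `C^*`-algebra: a positive normalized linear functional. -/
def IsState (w : A →ₗ[ℂ] ℂ) : Prop :=
  w 1 = 1 ∧ ∀ a, 0 ≤ (w (star a * a)).re ∧ (w (star a * a)).im = 0

/-- The `n`-point function `w_n(f₁, …, f_n) = w(B(f₁) ⋯ B(f_n))`. -/
def npt (G : FundamentalSolutions X m) (B : G.K →ₗ[ℂ] A) (w : A →ₗ[ℂ] ℂ) (l : List (Test M)) : ℂ :=
  w (monomial G B l)

/-- The state is invariant under the Bogoliubov automorphisms `α_k`, `α_k(B(f)) = B(u(k) f)`, of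
all (spin) isometries `k`.  Since linear combinations of monomials in the `B(f)` are dense, this is
the invariance of all `n`-point functions. -/
def IsoInvariant (G : FundamentalSolutions X m) (B : G.K →ₗ[ℂ] A) (w : A →ₗ[ℂ] ℂ) : Prop :=
  ∀ (k : SpinIsometry X) (l : List (Test M)), npt G B w (l.map k.u) = npt G B w l

/-- The fermionic Wick expansion with two-point function `w₂`: the sum over all pairings of the
arguments, each taken with the sign of the corresponding permutation, of the products of the
two-point functions of the pairs.  It is expanded along the partner of the first argument, and it
vanishes for an odd number of arguments. -/
def wick {V : Type*} (w₂ : V → V → ℂ) : List V → ℂ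
  | [] => 1
  | f :: l => ∑ j : Fin l.length, (-1) ^ (j : ℕ) * w₂ f l[j] * wick w₂ (l.eraseIdx j)
termination_by l => l.length
decreasing_by
  have := List.length_eraseIdx_of_lt j.2
  simp only [List.length_cons]
  omega

/-- The state is quasifree: `w_n` is given by its two-point function through the Wick expansion;
in particular `w_n` vanishes for odd `n`. -/
def Quasifree (G : FundamentalSolutions X m) (B : G.K →ₗ[ℂ] A) (w : A →ₗ[ℂ] ℂ) : Prop :=
  ∀ l : List (Test M), npt G B w l = wick (fun f h => npt G B w [f, h]) l

variable {H : Type*} [NormedAddCommGroup H] [InnerProductSpace ℂ H] [CompleteSpace H]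

/-- `(H, π, Ω)` is the GNS triple of the state `w`. -/
structure IsGNS (w : A →ₗ[ℂ] ℂ) (π : A →⋆ₐ[ℂ] (H →L[ℂ] H)) (Ω : H) : Prop where
  vacuum : ∀ a, inner ℂ Ω (π a Ω) = w a
  cyclic : DenseRange fun a => π a Ω

/-- `U` is the unitary representation on the GNS space which implements the isometries and leaves
`Ω` invariant, `U(k) π(a) Ω = π(α_k(a)) Ω`; since the monomials in the fields span a dense subspace
it suffices to take these for `a`. -/
def IsImplementation (G : FundamentalSolutions X m) (B : G.K →ₗ[ℂ] A)
    (π : A →⋆ₐ[ℂ] (H →L[ℂ] H)) (Ω : H) (U : SpinIsometry X → H ≃ₗᵢ[ℂ] H) : Prop :=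
  ∀ (k : SpinIsometry X) (l : List (Test M)),
    U k (π (monomial G B l) Ω) = π (monomial G B (l.map k.u)) Ω

/-! ## Warped convolution -/

/-- The antisymmetric matrix `Q = (0, 1; -1, 0)` acting on `ℝ²`. -/
def Q (s : Plane) : Plane := WithLp.toLp 2 (!![0, 1; -1, 0] *ᵥ (s : Fin 2 → ℝ))

/-- Smooth, compactly supported cutoff functions on `ℝ² × ℝ²` with value `1` at the origin. -/
def IsCutoff (χ : Plane × Plane → ℂ) : Prop :=
  ContDiff ℝ ∞ χ ∧ HasCompactSupport χ ∧ χ (0, 0) = 1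

/-- The regularized integral
`(4π²)⁻¹ ∫ ds ds' e^{-i s s'} χ(ε s, ε s') F(s, s')`. -/
def oscInt {E : Type*} [NormedAddCommGroup E] [NormedSpace ℂ E] (χ : Plane × Plane → ℂ)
    (F : Plane → Plane → E) (ε : ℝ) : E :=
  ((1 / (4 * Real.pi ^ 2) : ℝ) : ℂ) •
    ∫ z : Plane × Plane,
      (Complex.exp (-Complex.I * ((inner ℝ z.1 z.2 : ℝ) : ℂ)) * χ (ε • z.1, ε • z.2)) • F z.1 z.2

/-- The oscillatory integral `(4π²)⁻¹ lim_{ε → 0} ∫ ds ds' e^{-i s s'} χ(ε s, ε s') F(s, s')` exists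
and has the value `a`, for every cutoff function `χ`. -/
def HasOscInt {E : Type*} [NormedAddCommGroup E] [NormedSpace ℂ E]
    (F : Plane → Plane → E) (a : E) : Prop :=
  ∀ χ, IsCutoff χ → Tendsto (oscInt χ F) (𝓝[>] 0) (𝓝 a)

/-- The integrand `U_ξ(λ Q s) F U_ξ(s' - λ Q s) Ψ` of the warped convolution. -/
def warpIntegrand (U : Plane → H ≃ₗᵢ[ℂ] H) (lam : ℝ) (F : H →L[ℂ] H) (Ψ : H)
    (s s' : Plane) : H :=
  U (lam • Q s) (F (U (s' - lam • Q s) Ψ))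

/-- `Ψ` is a smooth vector for the representation `U` of `ℝ²`. -/
def SmoothVector (U : Plane → H ≃ₗᵢ[ℂ] H) (Ψ : H) : Prop :=
  ContDiff ℝ ∞ fun s => U s Ψ

open Classical in
/-- The warped convolution `F_{ξ,λ}`, as the operator on the dense domain of smooth vectors `Ψ` on
which it is given by the strong limit
`(4π²)⁻¹ lim_{ε → 0} ∫ ds ds' e^{-i s s'} χ(ε s, ε s') U_ξ(λ Q s) F U_ξ(s' - λ Q s) Ψ`
(with the value `0` where this limit does not exist). -/
def warp (U : Plane → H ≃ₗᵢ[ℂ] H) (lam : ℝ) (F : H →L[ℂ] H) (Ψ : H) : H :=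
  if h : ∃ Φ, HasOscInt (warpIntegrand U lam F Ψ) Φ then h.choose else 0

/-- The vector `B(f₁)_{ξ,λ} ⋯ B(f_n)_{ξ,λ} Ω`. -/
def deformedVector (G : FundamentalSolutions X m) (B : G.K →ₗ[ℂ] A)
    (π : A →⋆ₐ[ℂ] (H →L[ℂ] H)) (Ω : H) (U : Plane → H ≃ₗᵢ[ℂ] H) (lam : ℝ) : List (Test M) → H
  | [] => Ω
  | f :: l => warp U lam (π (B (G.cls f))) (deformedVector G B π Ω U lam l)

/-- The deformed `n`-point function
`w_n^{ξ,λ}(f₁, …, f_n) = ⟨Ω, B(f₁)_{ξ,λ} ⋯ B(f_n)_{ξ,λ} Ω⟩`. -/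
def deformedNpt (G : FundamentalSolutions X m) (B : G.K →ₗ[ℂ] A)
    (π : A →⋆ₐ[ℂ] (H →L[ℂ] H)) (Ω : H) (U : Plane → H ≃ₗᵢ[ℂ] H) (lam : ℝ)
    (l : List (Test M)) : ℂ :=
  inner ℂ Ω (deformedVector G B π Ω U lam l)

end Fields

end WarpedDirac

end

/-! Everything rests on one functional. If `G` on `ℝ² × ℝ²` is smooth with bounded derivatives
(`Cb`), repeated integration by parts against the phase turns its oscillatory integral into the
absolutely convergent `J G`. The regularized integrals therefore converge, for every cutoff, to the
same value (`hasOscInt_J`). `J` is continuous for convergence with uniformly bounded derivatives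
(`tendsto_J`), commutes with continuous linear maps, depends smoothly on parameters (`Cb.J`), and is
invariant under the shear `(s, s') ↦ (s, s' + λQs)`. By Fourier inversion, `J` of `exp(i a·s) K(s')`
is `K a` (`J_pw_smul`).

To apply this, the orbits `s ↦ B(u_ξ(s) f)` must be smooth in norm with bounded derivatives. The
geometry only gives weak differentiability: `⟨u_ξ(s) f, h⟩_S` is differentiable along each
coordinate axis, the derivative being the same expression with a Lie derivative of `f`. The
anticommutation relations close the gap. They bound `‖B(f)‖²` by `|⟨f, f⟩_S|`, and `|⟨f, h⟩_S|` by
`2‖B(f)‖‖B(h)‖`, so the mean value inequality for the form becomes a Taylor estimate in norm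
(`norm_path_le`, `cb_orbit`). The derivatives are bounded because translates are unitarily
conjugate.

By covariance the warped integrand is `B(u_ξ(λQs) f) U_ξ(s') Ψ`. For `Ψ = Ω` it depends on `s` only,
so warping has no effect (`warp_vacuum`). Paired with `Ω` it depends on `s' - λQs` only, so again
warping has no effect (`inner_warp`). This settles the two-point function. The odd functions vanish
because warping maps the closed span of the words of one parity in the fields into that of the
other.

In the four-point function the outer two warpings disappear, and the inner two give an iterated
oscillatory integral to which Wick's formula applies. The pairing (12)(34) is evaluated at the
origin. The other two are twisted products of two-point functions. If the second factor is a plane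
wave `exp(i a·y)`, they are computed exactly, using `a·Qa = 0`: the nested pairing (14)(23) returns
its undeformed value (`J_twist_nested`), and the crossed pairing (13)(24) becomes the stated
integral (`J_twist_crossed`). Superposition (`J_superposition`) extends this to compactly supported
factors, and cutting off with continuity of `J` to all `Cb` factors. -/

namespace WarpedDirac

/-! ## Jets and functions with bounded derivatives -/

section Jets

variable {V W : Type*} [NormedAddCommGroup V] [NormedSpace ℝ V]
  [NormedAddCommGroup W] [NormedSpace ℝ W]
  {F F₁ F₂ : Type*} [NormedAddCommGroup F] [NormedSpace ℝ F]
  [NormedAddCommGroup F₁] [NormedSpace ℝ F₁] [NormedAddCommGroup F₂] [NormedSpace ℝ F₂]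

/-- The sum of the norms of the derivatives up to order `n` of `G` at `z`. -/
noncomputable def jet (n : ℕ) (G : V → F) (z : V) : ℝ :=
  ∑ m ∈ Finset.range (n + 1), ‖iteratedFDeriv ℝ m G z‖

theorem jet_nonneg (n : ℕ) (G : V → F) (z : V) : 0 ≤ jet n G z :=
  Finset.sum_nonneg fun _ _ => norm_nonneg _

theorem jet_mono {n m : ℕ} (h : n ≤ m) (G : V → F) (z : V) : jet n G z ≤ jet m G z :=
  Finset.sum_le_sum_of_subset_of_nonneg (Finset.range_mono (by omega))
    fun _ _ _ => norm_nonneg _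

theorem norm_iteratedFDeriv_le_jet {m n : ℕ} (h : m ≤ n) (G : V → F) (z : V) :
    ‖iteratedFDeriv ℝ m G z‖ ≤ jet n G z :=
  Finset.single_le_sum (f := fun m => ‖iteratedFDeriv ℝ m G z‖) (fun _ _ => norm_nonneg _)
    (Finset.mem_range.2 (by omega))

theorem jet_zero (G : V → F) (z : V) : jet 0 G z = ‖G z‖ := by simp [jet]

theorem norm_le_jet (n : ℕ) (G : V → F) (z : V) : ‖G z‖ ≤ jet n G z := by
  simpa using norm_iteratedFDeriv_le_jet (Nat.zero_le n) G z

theorem jet_succ (n : ℕ) (G : V → F) (z : V) :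
    jet (n + 1) G z = ‖G z‖ + jet n (fderiv ℝ G) z := by
  simp only [jet, norm_iteratedFDeriv_fderiv]
  rw [Finset.sum_range_succ', add_comm]
  simp

theorem jet_fderiv_le (n : ℕ) (G : V → F) (z : V) :
    jet n (fderiv ℝ G) z ≤ jet (n + 1) G z := by
  rw [jet_succ]; linarith [norm_nonneg (G z)]

theorem jet_add_le (n : ℕ) {G K : V → F} (hG : ContDiff ℝ ∞ G) (hK : ContDiff ℝ ∞ K) (z : V) :
    jet n (fun z => G z + K z) z ≤ jet n G z + jet n K z := by
  simp only [jet, ← Finset.sum_add_distrib]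
  refine Finset.sum_le_sum fun m _ => ?_
  have h : iteratedFDeriv ℝ m (fun z => G z + K z) z
      = iteratedFDeriv ℝ m G z + iteratedFDeriv ℝ m K z :=
    iteratedFDeriv_add_apply (hG.of_le (mod_cast le_top)).contDiffAt
      (hK.of_le (mod_cast le_top)).contDiffAt
  rw [h]
  exact norm_add_le _ _

theorem jet_clm_le (n : ℕ) (L : F₁ →L[ℝ] F₂) {G : V → F₁} (hG : ContDiff ℝ ∞ G) (z : V) :
    jet n (fun z => L (G z)) z ≤ ‖L‖ * jet n G z := by
  simp only [jet, Finset.mul_sum]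
  refine Finset.sum_le_sum fun m _ => ?_
  exact L.norm_iteratedFDeriv_comp_left (N := (m : ℕ∞ω)) (hG.of_le (mod_cast le_top)).contDiffAt
    le_rfl

theorem jet_neg (n : ℕ) (G : V → F) (z : V) : jet n (fun z => -G z) z = jet n G z := by
  simp only [jet]
  refine Finset.sum_congr rfl fun m _ => ?_
  have h : iteratedFDeriv ℝ m (fun z => -G z) z = -iteratedFDeriv ℝ m G z :=
    iteratedFDeriv_neg_apply
  rw [h, norm_neg]

theorem jet_sub_le (n : ℕ) {G K : V → F} (hG : ContDiff ℝ ∞ G) (hK : ContDiff ℝ ∞ K) (z : V) :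
    jet n (fun z => G z - K z) z ≤ jet n G z + jet n K z := by
  have := jet_add_le n hG hK.neg z
  simpa only [sub_eq_add_neg, jet_neg] using this

/-- Leibniz rule: at each order `m ≤ n` the binomial coefficients add up to `2 ^ m ≤ 2 ^ n`, and
there are `n + 1` orders. -/
theorem jet_bilin_le (n : ℕ) (B : F₁ →L[ℝ] F₂ →L[ℝ] F) {G : V → F₁} {K : V → F₂}
    (hG : ContDiff ℝ ∞ G) (hK : ContDiff ℝ ∞ K) (z : V) :
    jet n (fun z => B (G z) (K z)) z ≤ ((n + 1) * 2 ^ n * ‖B‖) * jet n G z * jet n K z := by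
  have h : ∀ m ∈ Finset.range (n + 1), ‖iteratedFDeriv ℝ m (fun z => B (G z) (K z)) z‖ ≤
      2 ^ n * ‖B‖ * jet n G z * jet n K z := by
    intro m hm
    have hm' : m ≤ n := by simpa [Nat.lt_succ_iff] using hm
    have h0 := B.norm_iteratedFDeriv_le_of_bilinear (N := (∞ : ℕ∞ω)) hG hK z (n := m)
      (mod_cast le_top)
    refine h0.trans ?_
    have h1 : ∑ i ∈ Finset.range (m + 1), (m.choose i : ℝ) * ‖iteratedFDeriv ℝ i G z‖ *
        ‖iteratedFDeriv ℝ (m - i) K z‖ ≤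
        ∑ i ∈ Finset.range (m + 1), (m.choose i : ℝ) * (jet n G z * jet n K z) := by
      refine Finset.sum_le_sum fun i hi => ?_
      have hi' : i ≤ m := by simpa [Nat.lt_succ_iff] using hi
      rw [mul_assoc]
      refine mul_le_mul_of_nonneg_left ?_ (by positivity)
      exact mul_le_mul (norm_iteratedFDeriv_le_jet (by omega) G z)
        (norm_iteratedFDeriv_le_jet (by omega) K z) (norm_nonneg _) (jet_nonneg _ _ _)
    rw [← Finset.sum_mul] at h1
    have h2 : (∑ i ∈ Finset.range (m + 1), (m.choose i : ℝ)) = 2 ^ m := by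
      exact_mod_cast Nat.sum_range_choose m
    rw [h2] at h1
    have h3 : (2 : ℝ) ^ m ≤ 2 ^ n := pow_le_pow_right₀ (by norm_num) hm'
    have h4 : 0 ≤ jet n G z * jet n K z := mul_nonneg (jet_nonneg _ _ _) (jet_nonneg _ _ _)
    calc _ ≤ ‖B‖ * (2 ^ m * (jet n G z * jet n K z)) :=
          mul_le_mul_of_nonneg_left h1 (by positivity)
      _ ≤ ‖B‖ * (2 ^ n * (jet n G z * jet n K z)) := by gcongr
      _ = _ := by ring
  refine (Finset.sum_le_sum h).trans (le_of_eq ?_)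
  simp only [Finset.sum_const, Finset.card_range, nsmul_eq_mul]
  push_cast
  ring

theorem exists_jet_bilin_le (n : ℕ) (B : F₁ →L[ℝ] F₂ →L[ℝ] F) :
    ∃ D, 0 ≤ D ∧ ∀ {G : V → F₁} {K : V → F₂}, ContDiff ℝ ∞ G → ContDiff ℝ ∞ K → ∀ z,
      jet n (fun z => B (G z) (K z)) z ≤ D * jet n G z * jet n K z :=
  ⟨(n + 1) * 2 ^ n * ‖B‖, by positivity, fun hG hK z => jet_bilin_le n B hG hK z⟩

/-- The derivative of order `m` picks up `‖L‖ ^ m`; the maximum with `1` makes the factor uniform in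
`m ≤ n`, and equal to `1` for contractions. -/
theorem jet_comp_le (n : ℕ) (L : W →L[ℝ] V) (c : V) {G : V → F} (hG : ContDiff ℝ ∞ G) (z : W) :
    jet n (fun z => G (L z + c)) z ≤ max 1 ‖L‖ ^ n * jet n G (L z + c) := by
  simp only [jet, Finset.mul_sum]
  refine Finset.sum_le_sum fun m hm => ?_
  have hm' : m ≤ n := by simpa [Nat.lt_succ_iff] using hm
  have hG' : ContDiff ℝ ∞ (fun v => G (v + c)) := hG.comp (contDiff_id.add contDiff_const)
  have h := L.iteratedFDeriv_comp_right (n := (∞ : ℕ∞ω)) hG' z (i := m) (mod_cast le_top)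
  have h2 : iteratedFDeriv ℝ m (fun v => G (v + c)) (L z) = iteratedFDeriv ℝ m G (L z + c) := by
    rw [iteratedFDeriv_comp_add_right]
  rw [h2] at h
  have h3 : iteratedFDeriv ℝ m (fun z => G (L z + c)) z =
    (iteratedFDeriv ℝ m G (L z + c)).compContinuousLinearMap fun _ => L := h
  rw [h3]
  refine (ContinuousMultilinearMap.norm_compContinuousLinearMap_le _ _).trans ?_
  rw [Finset.prod_const, Finset.card_univ, Fintype.card_fin, mul_comm]
  refine mul_le_mul_of_nonneg_right ?_ (norm_nonneg _)
  calc ‖L‖ ^ m ≤ max 1 ‖L‖ ^ m := pow_le_pow_left₀ (norm_nonneg _) (le_max_right _ _) _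
    _ ≤ _ := pow_le_pow_right₀ (le_max_left _ _) hm'

theorem jet_slice_left_le (n : ℕ) {G : V × W → F} (hG : ContDiff ℝ ∞ G) (x : V) (z : W) :
    jet n (fun x => G (x, z)) x ≤ jet n G (x, z) := by
  have h := jet_comp_le n (ContinuousLinearMap.inl ℝ V W) (0, z) hG x
  have h1 : max 1 ‖ContinuousLinearMap.inl ℝ V W‖ = 1 :=
    max_eq_left (ContinuousLinearMap.norm_inl_le_one ℝ V W)
  simpa [h1] using h

theorem continuous_jet (n : ℕ) {G : V → F} (hG : ContDiff ℝ ∞ G) : Continuous (jet n G) := by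
  unfold jet
  exact continuous_finsetSum _ fun m _ =>
    (hG.continuous_iteratedFDeriv (mod_cast le_top)).norm

/-- The plane wave `y ↦ exp (i L y)`. -/
noncomputable def wave (L : V →L[ℝ] ℝ) (y : V) : ℂ := Complex.exp (Complex.I * (L y : ℝ))

theorem norm_wave (L : V →L[ℝ] ℝ) (y : V) : ‖wave L y‖ = 1 := by
  rw [wave, mul_comm, Complex.norm_exp_ofReal_mul_I]

theorem hasFDerivAt_wave (L : V →L[ℝ] ℝ) (y : V) :
    HasFDerivAt (wave L) (L.smulRight (Complex.I * wave L y)) y := by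
  have h1 : HasFDerivAt (fun y => Complex.I * ((L y : ℝ) : ℂ))
      (Complex.I • (Complex.ofRealCLM.comp L)) y :=
    (Complex.ofRealCLM.hasFDerivAt.comp y L.hasFDerivAt).const_mul Complex.I
  refine h1.cexp.congr_fderiv ?_
  ext v
  simp [wave]
  ring

theorem contDiff_wave (L : V →L[ℝ] ℝ) : ContDiff ℝ ∞ (wave L) := by
  unfold wave
  exact (contDiff_const.mul (Complex.ofRealCLM.contDiff.comp L.contDiff)).cexp

/-- Each derivative multiplies the wave by `i L`. The polynomial growth in the frequency is what the
weights of superpositions of plane waves have to compensate. -/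
theorem jet_wave_le (n : ℕ) (L : V →L[ℝ] ℝ) (y : V) : jet n (wave L) y ≤ (1 + ‖L‖) ^ n := by
  induction n with
  | zero => simp [jet_zero, norm_wave]
  | succ n ih =>
    let B : ℂ →L[ℝ] (V →L[ℝ] ℂ) :=
      (ContinuousLinearMap.smulRightL ℝ V ℂ L).comp
        (ContinuousLinearMap.mul ℝ ℂ Complex.I)
    have hB : ‖B‖ ≤ ‖L‖ := by
      refine ContinuousLinearMap.opNorm_le_bound _ (norm_nonneg _) fun c => ?_
      simp [B]
    have hd : fderiv ℝ (wave L) = fun y => B (wave L y) := by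
      ext1 y
      rw [(hasFDerivAt_wave L y).fderiv]
      rfl
    rw [jet_succ, norm_wave, hd]
    have h1 := jet_clm_le n B (contDiff_wave L) y
    have h2 : ‖B‖ * jet n (wave L) y ≤ ‖L‖ * (1 + ‖L‖) ^ n :=
      mul_le_mul hB ih (jet_nonneg _ _ _) (norm_nonneg _)
    have h3 : (1 : ℝ) ≤ (1 + ‖L‖) ^ n := one_le_pow₀ (by linarith [norm_nonneg L])
    rw [pow_succ]
    nlinarith

/-- Smooth functions all of whose derivatives are bounded. -/
def Cb (G : V → F) : Prop := ContDiff ℝ ∞ G ∧ ∀ n, ∃ C, ∀ z, jet n G z ≤ C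

theorem Cb.exists_nonneg {G : V → F} (h : Cb G) (n : ℕ) : ∃ C, 0 ≤ C ∧ ∀ z, jet n G z ≤ C := by
  obtain ⟨C, hC⟩ := h.2 n
  exact ⟨C, (jet_nonneg n G 0).trans (hC 0), hC⟩

theorem Cb.const (c : F) : Cb (fun _ : V => c) := by
  refine ⟨contDiff_const, fun n => ?_⟩
  refine ⟨jet n (fun _ : V => c) 0, fun z => le_of_eq ?_⟩
  unfold jet
  refine Finset.sum_congr rfl fun m _ => ?_
  have h := iteratedFDeriv_comp_add_right (𝕜 := ℝ) (f := fun _ : V => c) m z 0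
  rw [zero_add] at h
  rw [h]

theorem Cb.add {G K : V → F} (hG : Cb G) (hK : Cb K) : Cb (fun z => G z + K z) := by
  refine ⟨hG.1.add hK.1, fun n => ?_⟩
  obtain ⟨C, hC⟩ := hG.2 n
  obtain ⟨D, hD⟩ := hK.2 n
  exact ⟨C + D, fun z => (jet_add_le n hG.1 hK.1 z).trans (add_le_add (hC z) (hD z))⟩

theorem Cb.neg {G : V → F} (hG : Cb G) : Cb (fun z => -G z) := by
  refine ⟨hG.1.neg, fun n => ?_⟩
  obtain ⟨C, hC⟩ := hG.2 n
  exact ⟨C, fun z => (jet_neg n G z).le.trans (hC z)⟩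

theorem Cb.clm (L : F₁ →L[ℝ] F₂) {G : V → F₁} (hG : Cb G) : Cb (fun z => L (G z)) := by
  refine ⟨L.contDiff.comp hG.1, fun n => ?_⟩
  obtain ⟨C, hC⟩ := hG.2 n
  exact ⟨‖L‖ * C, fun z => (jet_clm_le n L hG.1 z).trans
    (mul_le_mul_of_nonneg_left (hC z) (norm_nonneg _))⟩

theorem Cb.bilin (B : F₁ →L[ℝ] F₂ →L[ℝ] F) {G : V → F₁} {K : V → F₂} (hG : Cb G) (hK : Cb K) :
    Cb (fun z => B (G z) (K z)) := by
  refine ⟨B.isBoundedBilinearMap.contDiff.comp (hG.1.prodMk hK.1), fun n => ?_⟩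
  obtain ⟨C, hC0, hC⟩ := hG.exists_nonneg n
  obtain ⟨D, hD0, hD⟩ := hK.exists_nonneg n
  refine ⟨((n + 1) * 2 ^ n * ‖B‖) * C * D, fun z => (jet_bilin_le n B hG.1 hK.1 z).trans ?_⟩
  have := jet_nonneg n G z
  have := jet_nonneg n K z
  have := hC z
  have := hD z
  gcongr

theorem Cb.mul {G K : V → ℂ} (hG : Cb G) (hK : Cb K) : Cb (fun z => G z * K z) :=
  Cb.bilin (ContinuousLinearMap.mul ℝ ℂ) hG hK

theorem Cb.comp_affine (L : W →L[ℝ] V) (c : V) {G : V → F} (hG : Cb G) :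
    Cb (fun z => G (L z + c)) := by
  refine ⟨hG.1.comp (L.contDiff.add contDiff_const), fun n => ?_⟩
  obtain ⟨C, hC⟩ := hG.2 n
  exact ⟨max 1 ‖L‖ ^ n * C, fun z => (jet_comp_le n L c hG.1 z).trans
    (mul_le_mul_of_nonneg_left (hC _) (by positivity))⟩

theorem Cb.comp_clm (L : W →L[ℝ] V) {G : V → F} (hG : Cb G) : Cb (fun z => G (L z)) := by
  simpa using hG.comp_affine L 0

theorem Cb.slice_right {G : V × W → F} (hG : Cb G) (x : V) : Cb (fun z => G (x, z)) := by
  have := hG.comp_affine (ContinuousLinearMap.inr ℝ V W) (x, 0)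
  simpa using this

theorem Cb.wave (L : V →L[ℝ] ℝ) : Cb (wave L) :=
  ⟨contDiff_wave L, fun n => ⟨_, jet_wave_le n L⟩⟩

theorem Cb.of_hasCompactSupport {G : V → F} (hG : ContDiff ℝ ∞ G) (hc : HasCompactSupport G) :
    Cb G := by
  refine ⟨hG, fun n => ?_⟩
  have hcont := continuous_jet n hG
  have hsupp : HasCompactSupport (jet n G) := by
    refine HasCompactSupport.intro hc fun z hz => ?_
    unfold jet
    refine Finset.sum_eq_zero fun m _ => ?_
    have : iteratedFDeriv ℝ m G z = 0 := by
      by_contra hne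
      exact hz (support_iteratedFDeriv_subset (𝕜 := ℝ) m hne)
    rw [this, norm_zero]
  obtain ⟨C, hC⟩ := hsupp.exists_bound_of_continuous hcont
  exact ⟨C, fun z => (le_abs_self _).trans (hC z)⟩

end Jets

end WarpedDirac

namespace WarpedDirac

/-! ## Damping operators -/

section Damping

variable {V W : Type*} [NormedAddCommGroup V] [NormedSpace ℝ V]
  [NormedAddCommGroup W] [NormedSpace ℝ W]
  {F : Type*} [NormedAddCommGroup F] [NormedSpace ℂ F]

/-- The function `(1 - i ℓ)⁻¹`. -/
noncomputable def rres (ℓ : V →L[ℝ] ℝ) (z : V) : ℂ := (1 - Complex.I * (ℓ z : ℝ))⁻¹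

theorem one_sub_I_mul_ne_zero (t : ℝ) : (1 - Complex.I * (t : ℝ) : ℂ) ≠ 0 := by
  intro h
  have := congrArg Complex.re h
  simp at this

theorem norm_rres_sq (ℓ : V →L[ℝ] ℝ) (z : V) : ‖rres ℓ z‖ ^ 2 = (1 + (ℓ z) ^ 2)⁻¹ := by
  rw [rres, norm_inv, inv_pow, ← Complex.normSq_eq_norm_sq, Complex.normSq_apply]
  simp
  ring

theorem norm_rres_le_one (ℓ : V →L[ℝ] ℝ) (z : V) : ‖rres ℓ z‖ ≤ 1 := by
  have h := norm_rres_sq ℓ z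
  have h2 : (1 + (ℓ z) ^ 2)⁻¹ ≤ 1 := inv_le_one_of_one_le₀ (by nlinarith [sq_nonneg (ℓ z)])
  rw [← h] at h2
  nlinarith [norm_nonneg (rres ℓ z)]

theorem hasFDerivAt_rres (ℓ : V →L[ℝ] ℝ) (z : V) :
    HasFDerivAt (rres ℓ) (ℓ.smulRight (Complex.I * (rres ℓ z * rres ℓ z))) z := by
  have h1 : HasFDerivAt (fun y => 1 - Complex.I * ((ℓ y : ℝ) : ℂ))
      (-(Complex.I • (Complex.ofRealCLM.comp ℓ))) z :=
    ((Complex.ofRealCLM.hasFDerivAt.comp z ℓ.hasFDerivAt).const_mul Complex.I).const_sub 1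
  have h2 := (hasDerivAt_inv (one_sub_I_mul_ne_zero (ℓ z))).comp_hasFDerivAt z h1
  refine h2.congr_fderiv ?_
  ext v
  simp [rres, sq]
  ring

theorem contDiff_rres (ℓ : V →L[ℝ] ℝ) : ContDiff ℝ ∞ (rres ℓ) := by
  unfold rres
  exact (contDiff_const.sub (contDiff_const.mul (Complex.ofRealCLM.contDiff.comp ℓ.contDiff))).inv
    fun z => one_sub_I_mul_ne_zero (ℓ z)

/-- The derivative of `rres ℓ` is a fixed bilinear expression in two copies of `rres ℓ`, and `‖rres
ℓ‖ ≤ 1`; so, inductively, no derivative decays more slowly than the function. -/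
theorem exists_jet_rres_le (ℓ : V →L[ℝ] ℝ) (n : ℕ) :
    ∃ c, 0 ≤ c ∧ ∀ z, jet n (rres ℓ) z ≤ c * ‖rres ℓ z‖ := by
  induction n with
  | zero => exact ⟨1, zero_le_one, fun z => by simp [jet_zero]⟩
  | succ n ih =>
    obtain ⟨c, hc0, hc⟩ := ih
    let B : ℂ →L[ℝ] ℂ →L[ℝ] (V →L[ℝ] ℂ) :=
      (ContinuousLinearMap.compL ℝ ℂ ℂ (V →L[ℝ] ℂ)
        ((ContinuousLinearMap.smulRightL ℝ V ℂ ℓ).comp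
          (ContinuousLinearMap.mul ℝ ℂ Complex.I))).comp (ContinuousLinearMap.mul ℝ ℂ)
    have hd : fderiv ℝ (rres ℓ) = fun y => B (rres ℓ y) (rres ℓ y) := by
      ext1 y
      rw [(hasFDerivAt_rres ℓ y).fderiv]
      rfl
    obtain ⟨D, hD, hDB⟩ := exists_jet_bilin_le (V := V) n B
    refine ⟨1 + D * c * c, by positivity, fun z => ?_⟩
    rw [jet_succ, hd]
    have h1 := hDB (contDiff_rres ℓ) (contDiff_rres ℓ) z
    have h2 : D * jet n (rres ℓ) z * jet n (rres ℓ) z ≤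
        D * (c * ‖rres ℓ z‖) * (c * ‖rres ℓ z‖) := by
      have := hc z
      have := jet_nonneg n (rres ℓ) z
      gcongr
    have h3 : D * (c * ‖rres ℓ z‖) * (c * ‖rres ℓ z‖) ≤ D * c * c * ‖rres ℓ z‖ := by
      have h4 : ‖rres ℓ z‖ * ‖rres ℓ z‖ ≤ ‖rres ℓ z‖ :=
        mul_le_of_le_one_left (norm_nonneg _) (norm_rres_le_one ℓ z)
      calc _ = D * c * c * (‖rres ℓ z‖ * ‖rres ℓ z‖) := by ring
        _ ≤ _ := by gcongr
    linarith

/-- The damping operator `G ↦ (1 - i ℓ)⁻¹ (G - ∂_e G)`. -/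
noncomputable def damp (q : (V →L[ℝ] ℝ) × V) (G : V → F) (z : V) : F :=
  rres q.1 z • (G z - fderiv ℝ G z q.2)

theorem contDiff_fderiv_apply {G : V → F} (hG : ContDiff ℝ ∞ G) (e : V) :
    ContDiff ℝ ∞ (fun z => fderiv ℝ G z e) :=
  (hG.fderiv_right (m := ∞) (by simp)).clm_apply contDiff_const

theorem contDiff_damp (q : (V →L[ℝ] ℝ) × V) {G : V → F} (hG : ContDiff ℝ ∞ G) :
    ContDiff ℝ ∞ (damp q G) :=
  (contDiff_rres q.1).smul (hG.sub (contDiff_fderiv_apply hG q.2))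

theorem exists_jet_damp_le (q : (V →L[ℝ] ℝ) × V) (n : ℕ) :
    ∃ c, 0 ≤ c ∧ ∀ G : V → F, ContDiff ℝ ∞ G → ∀ z,
      jet n (damp q G) z ≤ c * ‖rres q.1 z‖ * jet (n + 1) G z := by
  obtain ⟨c, hc0, hc⟩ := exists_jet_rres_le q.1 n
  obtain ⟨D, hD, hDB⟩ := exists_jet_bilin_le (V := V) n
    (ContinuousLinearMap.lsmul ℝ ℂ : ℂ →L[ℝ] F →L[ℝ] F)
  refine ⟨D * c * (1 + ‖q.2‖), by positivity, fun G hG z => ?_⟩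
  have hd : ContDiff ℝ ∞ (fun z => G z - fderiv ℝ G z q.2) :=
    hG.sub (contDiff_fderiv_apply hG q.2)
  have h1 := hDB (contDiff_rres q.1) hd z
  have h2 := jet_sub_le n hG (contDiff_fderiv_apply hG q.2) z
  have h3 := jet_clm_le n (ContinuousLinearMap.apply ℝ F q.2)
    (hG.fderiv_right (m := ∞) (by simp)) z
  have h4 : ‖ContinuousLinearMap.apply ℝ F q.2‖ ≤ ‖q.2‖ :=
    ContinuousLinearMap.opNorm_le_bound _ (norm_nonneg _) fun c => by
      rw [mul_comm]; exact c.le_opNorm _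
  have h5 : jet n (fun z => fderiv ℝ G z q.2) z ≤ ‖q.2‖ * jet (n + 1) G z :=
    h3.trans (mul_le_mul h4 (jet_fderiv_le n G z) (jet_nonneg _ _ _) (norm_nonneg _))
  have h6 := jet_mono (Nat.le_succ n) G z
  have h7 : jet n (fun z => G z - fderiv ℝ G z q.2) z ≤ (1 + ‖q.2‖) * jet (n + 1) G z := by
    linarith
  have h8 := hc z
  have h9 := jet_nonneg n (rres q.1) z
  have h10 := jet_nonneg n (fun z => G z - fderiv ℝ G z q.2) z
  calc _ ≤ D * jet n (rres q.1) z * jet n (fun z => G z - fderiv ℝ G z q.2) z := h1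
    _ ≤ D * (c * ‖rres q.1 z‖) * ((1 + ‖q.2‖) * jet (n + 1) G z) := by gcongr
    _ = _ := by ring

theorem damp_sub (q : (V →L[ℝ] ℝ) × V) {G K : V → F} (hG : ContDiff ℝ ∞ G)
    (hK : ContDiff ℝ ∞ K) : damp q (fun z => G z - K z) = fun z => damp q G z - damp q K z := by
  ext z
  have h : fderiv ℝ (fun z => G z - K z) z = fderiv ℝ G z - fderiv ℝ K z :=
    fderiv_fun_sub (hG.differentiable (by simp) z) (hK.differentiable (by simp) z)
  simp only [damp, h, ← smul_sub, sub_apply]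
  congr 1
  abel

/-- The composition of several damping operators. -/
noncomputable def damps (l : List ((V →L[ℝ] ℝ) × V)) (G : V → F) : V → F :=
  l.foldr (fun q K => damp q K) G

theorem contDiff_damps (l : List ((V →L[ℝ] ℝ) × V)) {G : V → F} (hG : ContDiff ℝ ∞ G) :
    ContDiff ℝ ∞ (damps l G) := by
  induction l with
  | nil => exact hG
  | cons q l ih => exact contDiff_damp q ih

theorem damps_sub (l : List ((V →L[ℝ] ℝ) × V)) {G K : V → F} (hG : ContDiff ℝ ∞ G)
    (hK : ContDiff ℝ ∞ K) : damps l (fun z => G z - K z) = fun z => damps l G z - damps l K z := by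
  induction l with
  | nil => rfl
  | cons q l ih =>
    change damp q (damps l _) = _
    rw [ih, damp_sub q (contDiff_damps l hG) (contDiff_damps l hK)]
    rfl

/-- Each damping costs one derivative of `G` and gains one factor `‖rres‖`; later derivatives do not
spoil the factors gained, by `exists_jet_rres_le`. The order `n` varies in the induction because
every step consumes one. -/
theorem exists_jet_damps_le (l : List ((V →L[ℝ] ℝ) × V)) (n : ℕ) :
    ∃ c, 0 ≤ c ∧ ∀ G : V → F, ContDiff ℝ ∞ G → ∀ z,
      jet n (damps l G) z ≤ c * (l.map fun q => ‖rres q.1 z‖).prod * jet (n + l.length) G z := by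
  induction l generalizing n with
  | nil => exact ⟨1, zero_le_one, fun G _ z => by simp [damps]⟩
  | cons q l ih =>
    obtain ⟨c, hc0, hc⟩ := ih (n + 1)
    obtain ⟨d, hd0, hd⟩ := exists_jet_damp_le (F := F) q n
    refine ⟨d * c, by positivity, fun G hG z => ?_⟩
    have h1 := hd (damps l G) (contDiff_damps l hG) z
    have h2 := hc G hG z
    have h3 : n + 1 + l.length = n + (q :: l).length := by simp; omega
    rw [h3] at h2
    change jet n (damp q (damps l G)) z ≤ _
    rw [List.map_cons, List.prod_cons]
    calc _ ≤ d * ‖rres q.1 z‖ * jet (n + 1) (damps l G) z := h1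
      _ ≤ d * ‖rres q.1 z‖ * (c * (l.map fun q => ‖rres q.1 z‖).prod *
          jet (n + (q :: l).length) G z) := by gcongr
      _ = _ := by ring

theorem hasCompactSupport_damps (l : List ((V →L[ℝ] ℝ) × V)) {G : V → F}
    (hG : HasCompactSupport G) : HasCompactSupport (damps l G) := by
  induction l with
  | nil => exact hG
  | cons q l ih =>
    have h2 : HasCompactSupport (fun z => damps l G z - fderiv ℝ (damps l G) z q.2) := by
      refine HasCompactSupport.sub ih ?_
      exact (ih.fderiv (𝕜 := ℝ)).comp_left
        (g := fun T : V →L[ℝ] F => T q.2) (by simp)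
    exact h2.smul_left

/-- The damping operators on the second factor of a product. -/
noncomputable def liftDir (W : Type*) [NormedAddCommGroup W] [NormedSpace ℝ W]
    (q : (V →L[ℝ] ℝ) × V) : ((W × V) →L[ℝ] ℝ) × (W × V) :=
  (q.1.comp (ContinuousLinearMap.snd ℝ W V), (0, q.2))

/-- Lifted dampings differentiate only in the second factor, so freezing the parameter commutes with
them. This makes parameter dependence a question about one jointly smooth function. -/
theorem damps_slice (l : List ((V →L[ℝ] ℝ) × V)) {G : W × V → F} (hG : ContDiff ℝ ∞ G) (x : W) :
    damps l (fun z => G (x, z)) = fun z => damps (l.map (liftDir W)) G (x, z) := by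
  induction l with
  | nil => rfl
  | cons q l ih =>
    change damp q (damps l _) = fun z => damp (liftDir W q) (damps (l.map (liftDir W)) G) (x, z)
    rw [ih]
    ext z
    have h0 := (contDiff_damps (l.map (liftDir W)) hG).differentiable (by simp) (x, z)
    have h1 : HasFDerivAt (fun z : V => damps (l.map (liftDir W)) G (x, z))
        ((fderiv ℝ (damps (l.map (liftDir W)) G) (x, z)).comp (ContinuousLinearMap.inr ℝ W V)) z :=
      h0.hasFDerivAt.comp z (hasFDerivAt_prodMk_right x z)
    simp only [damp, h1.fderiv, liftDir, rres]
    simp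

end Damping

/-! ## The oscillatory integral -/

section Oscillatory

variable {F : Type*} [NormedAddCommGroup F] [NormedSpace ℂ F]

/-- The space of pairs `(s, s')`. -/
abbrev PP : Type := Plane × Plane

instance : (volume : Measure PP).IsAddHaarMeasure :=
  inferInstanceAs ((volume : Measure Plane).prod (volume : Measure Plane)).IsAddHaarMeasure

/-- The phase `exp (-i s · s')`. -/
noncomputable def phase (z : PP) : ℂ := Complex.exp (-Complex.I * ((inner ℝ z.1 z.2 : ℝ) : ℂ))

theorem norm_phase (z : PP) : ‖phase z‖ = 1 := by
  rw [phase, show -Complex.I * ((inner ℝ z.1 z.2 : ℝ) : ℂ) =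
    ((-(inner ℝ z.1 z.2 : ℝ) : ℝ) : ℂ) * Complex.I by push_cast; ring,
    Complex.norm_exp_ofReal_mul_I]

theorem contDiff_phase : ContDiff ℝ ∞ phase := by
  unfold phase
  refine (contDiff_const.mul (Complex.ofRealCLM.contDiff.comp ?_)).cexp
  exact contDiff_fst.inner ℝ contDiff_snd

theorem hasFDerivAt_phase (z : PP) : ∃ L : PP →L[ℝ] ℂ, HasFDerivAt phase L z ∧
    ∀ v, L v = -Complex.I * (((inner ℝ z.1 v.2 + inner ℝ v.1 z.2 : ℝ) : ℝ) : ℂ) * phase z := by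
  have h0 : HasFDerivAt (fun z : PP => (inner ℝ z.1 z.2 : ℝ)) _ z :=
    hasFDerivAt_fst.inner ℝ hasFDerivAt_snd
  have h1 := ((Complex.ofRealCLM.hasFDerivAt.comp z h0).const_mul (-Complex.I)).cexp
  refine ⟨_, h1, fun v => ?_⟩
  simp [phase, fderivInnerCLM_apply]
  ring

theorem integral_fderiv_apply_eq_zero {K : PP → F} (hK : ContDiff ℝ ∞ K)
    (hc : HasCompactSupport K) (e : PP) : ∫ z, fderiv ℝ K z e = 0 := by
  have h := integral_smul_fderiv_eq_neg_fderiv_smul_of_integrable (μ := (volume : Measure PP))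
    (f := fun _ : PP => (1 : ℝ)) (g := K) (v := e) (by simp)
    (by
      simp only [one_smul]
      refine Continuous.integrable_of_hasCompactSupport (contDiff_fderiv_apply hK e).continuous ?_
      exact (hc.fderiv (𝕜 := ℝ)).comp_left (g := fun T : PP →L[ℝ] F => T e) (by simp))
    (by simpa using hK.continuous.integrable_of_hasCompactSupport hc)
    (fun _ _ => differentiableAt_const _) (fun x _ => hK.differentiable (by simp) x)
  simpa using h

/-- Write `q = (ℓ, e)`. By `hq`, `∂_e phase = -i ℓ phase`; by `hq0`, `rres ℓ` is constant along `e`.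
Hence `phase • (damp q K - K)` is minus the `e`-derivative of the compactly supported `(phase * rres
ℓ) • K`, and its integral vanishes. -/
theorem integral_phase_damp {q : (PP →L[ℝ] ℝ) × PP}
    (hq : ∀ z : PP, inner ℝ z.1 q.2.2 + inner ℝ q.2.1 z.2 = q.1 z) (hq0 : q.1 q.2 = 0)
    {K : PP → F} (hK : ContDiff ℝ ∞ K) (hc : HasCompactSupport K) :
    ∫ z, phase z • damp q K z = ∫ z, phase z • K z := by
  have hi1 : Integrable (fun z => phase z • K z) :=
    (contDiff_phase.continuous.smul hK.continuous).integrable_of_hasCompactSupport hc.smul_left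
  have hcd : HasCompactSupport (damp q K) := hasCompactSupport_damps [q] hc
  have hi2 : Integrable (fun z => phase z • damp q K z) :=
    (contDiff_phase.continuous.smul (contDiff_damp q hK).continuous).integrable_of_hasCompactSupport
      hcd.smul_left
  rw [← sub_eq_zero, ← integral_sub hi2 hi1]
  have hM : ContDiff ℝ ∞ (fun z => (phase z * rres q.1 z) • K z) :=
    (contDiff_phase.mul (contDiff_rres q.1)).smul hK
  have h0 := integral_fderiv_apply_eq_zero hM (hc.smul_left (f := fun z => phase z * rres q.1 z)) q.2
  rw [← neg_zero, ← h0, ← integral_neg]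
  congr 1
  ext z
  obtain ⟨L, hL, hLv⟩ := hasFDerivAt_phase z
  have h1 := (hL.mul (hasFDerivAt_rres q.1 z)).smul (hK.differentiable (by simp) z).hasFDerivAt
  have h1' : fderiv ℝ (fun z => (phase z * rres q.1 z) • K z) z = _ := h1.fderiv
  rw [h1']
  have h2 : rres q.1 z * (1 - Complex.I * (q.1 z : ℝ)) = 1 :=
    inv_mul_cancel₀ (one_sub_I_mul_ne_zero _)
  have h3 : phase z • K z =
      (phase z * (rres q.1 z * (1 - Complex.I * (q.1 z : ℝ)))) • K z := by rw [h2, mul_one]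
  rw [h3]
  simp only [damp, add_apply, smul_apply, Pi.mul_apply,
    ContinuousLinearMap.smulRight_apply, hLv, hq, hq0]
  simp only [zero_smul, smul_sub, smul_smul, smul_eq_mul]
  module

end Oscillatory

end WarpedDirac

namespace WarpedDirac

/-! ### The absolutely convergent form of the oscillatory integral and its continuity -/

section OscillatoryFunctional

variable {F : Type*} [NormedAddCommGroup F] [NormedSpace ℂ F]

/-- The four damping operators attached to the coordinates of `ℝ² × ℝ²`. -/
noncomputable def oscGen : List ((PP →L[ℝ] ℝ) × PP) :=
  [((EuclideanSpace.proj 0).comp (ContinuousLinearMap.fst ℝ Plane Plane),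
      (0, EuclideanSpace.single 0 1)),
    ((EuclideanSpace.proj 1).comp (ContinuousLinearMap.fst ℝ Plane Plane),
      (0, EuclideanSpace.single 1 1)),
    ((EuclideanSpace.proj 0).comp (ContinuousLinearMap.snd ℝ Plane Plane),
      (EuclideanSpace.single 0 1, 0)),
    ((EuclideanSpace.proj 1).comp (ContinuousLinearMap.snd ℝ Plane Plane),
      (EuclideanSpace.single 1 1, 0))]

/-- Six rounds of the four damping operators. -/
noncomputable def oscList : List ((PP →L[ℝ] ℝ) × PP) := (List.replicate 6 oscGen).flatten

theorem length_oscList : oscList.length = 24 := by simp [oscList, oscGen]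

theorem oscList_spec {q : (PP →L[ℝ] ℝ) × PP} (h : q ∈ oscList) :
    (∀ z : PP, inner ℝ z.1 q.2.2 + inner ℝ q.2.1 z.2 = q.1 z) ∧ q.1 q.2 = 0 := by
  have h' : q ∈ oscGen := by
    simp only [oscList, List.mem_flatten, List.mem_replicate] at h
    obtain ⟨l, ⟨_, rfl⟩, hl⟩ := h
    exact hl
  simp only [oscGen, List.mem_cons, List.not_mem_nil, or_false] at h'
  rcases h' with rfl | rfl | rfl | rfl <;> simp [EuclideanSpace.inner_single_right,
    EuclideanSpace.inner_single_left]

/-- The integrable weight `(1 + ‖z‖²)⁻³`. -/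
noncomputable def wt (z : PP) : ℝ := ((1 + ‖z‖ ^ 2)⁻¹) ^ 3

theorem wt_nonneg (z : PP) : 0 ≤ wt z := by unfold wt; positivity

theorem integrable_wt : Integrable wt := by
  -- Decay of order `6` is integrable since `ℝ² × ℝ²` has dimension `4`.
  have h := integrable_rpow_neg_one_add_norm_sq (E := PP) (μ := volume) (r := 6) (by simp; norm_num)
  refine h.congr (Eventually.of_forall fun z => ?_)
  have h1 : (0 : ℝ) ≤ 1 + ‖z‖ ^ 2 := by positivity
  have h2 : (-6 / 2 : ℝ) = -((3 : ℕ) : ℝ) := by norm_num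
  simp only [wt]
  rw [h2, Real.rpow_neg h1, Real.rpow_natCast, inv_pow]

theorem continuous_wt : Continuous wt := by
  unfold wt
  refine (Continuous.inv₀ (by fun_prop) fun z => ?_).pow 3
  positivity

/-- One round contributes `∏ (1 + x_i²)^(-1/2)` over the four coordinates. Two rounds give at most
`(1 + ‖z‖²)⁻¹`, because the expanded product `∏ (1 + x_i²)` contains `1 + ∑ x_i²`; six rounds give
the cube. -/
theorem prod_oscList_le (z : PP) : (oscList.map fun q => ‖rres q.1 z‖).prod ≤ wt z := by
  have h0 : (oscList.map fun q => ‖rres q.1 z‖).prod =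
      ((oscGen.map fun q => ‖rres q.1 z‖).prod ^ 2) ^ 3 := by
    rw [oscList, List.map_flatten, List.map_replicate, List.prod_flatten, List.map_replicate,
      List.prod_replicate, ← pow_mul]
  rw [h0, wt]
  refine pow_le_pow_left₀ (by positivity) ?_ 3
  simp only [oscGen, List.map_cons, List.map_nil, List.prod_cons, List.prod_nil, mul_one, mul_pow,
    norm_rres_sq, ← mul_inv]
  refine inv_anti₀ (by positivity) ?_
  have h1 : ‖z.1‖ ^ 2 = z.1 0 ^ 2 + z.1 1 ^ 2 := by
    rw [EuclideanSpace.norm_sq_eq]; simp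
  have h2 : ‖z.2‖ ^ 2 = z.2 0 ^ 2 + z.2 1 ^ 2 := by
    rw [EuclideanSpace.norm_sq_eq]; simp
  -- The norm of a pair is the maximum of the two norms, so this is only an inequality, in the
  -- direction needed.
  have h3 : ‖z‖ ^ 2 ≤ ‖z.1‖ ^ 2 + ‖z.2‖ ^ 2 := by
    rw [Prod.norm_def]
    rcases max_choice ‖z.1‖ ‖z.2‖ with h | h <;> rw [h] <;> nlinarith [sq_nonneg ‖z.1‖,
      sq_nonneg ‖z.2‖]
  rw [h1, h2] at h3
  simp only [ContinuousLinearMap.comp_apply, ContinuousLinearMap.coe_fst',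
    ContinuousLinearMap.coe_snd', PiLp.proj_apply]
  nlinarith [mul_nonneg (sq_nonneg (z.1 0)) (sq_nonneg (z.1 1)),
    mul_nonneg (sq_nonneg (z.2 0)) (sq_nonneg (z.2 1)),
    mul_nonneg (add_nonneg (sq_nonneg (z.1 0)) (sq_nonneg (z.1 1)))
      (add_nonneg (sq_nonneg (z.2 0)) (sq_nonneg (z.2 1)))]

/-- The total damping operator. -/
noncomputable def oscOp (G : PP → F) : PP → F := damps oscList G

theorem contDiff_oscOp {G : PP → F} (hG : ContDiff ℝ ∞ G) : ContDiff ℝ ∞ (oscOp G) :=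
  contDiff_damps _ hG

-- The order `24` is the number of dampings in `oscList`, each of which uses one derivative.
variable (F) in
theorem exists_norm_oscOp_le :
    ∃ c, 0 ≤ c ∧ ∀ G : PP → F, ContDiff ℝ ∞ G → ∀ z, ‖oscOp G z‖ ≤ c * wt z * jet 24 G z := by
  obtain ⟨c, hc0, hc⟩ := exists_jet_damps_le (F := F) oscList 0
  refine ⟨c, hc0, fun G hG z => (norm_le_jet 0 _ z).trans ((hc G hG z).trans ?_)⟩
  rw [length_oscList, zero_add]
  have := prod_oscList_le z
  have := jet_nonneg 24 G z
  gcongr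

theorem integral_phase_oscOp {G : PP → F} (hG : ContDiff ℝ ∞ G) (hc : HasCompactSupport G) :
    ∫ z, phase z • oscOp G z = ∫ z, phase z • G z := by
  have key : ∀ l : List ((PP →L[ℝ] ℝ) × PP), (∀ q ∈ l, q ∈ oscList) →
      ∫ z, phase z • damps l G z = ∫ z, phase z • G z := by
    intro l
    induction l with
    | nil => intro _; rfl
    | cons q l ih =>
      intro h
      have hq := oscList_spec (h q (by simp))
      rw [← ih fun q' h' => h q' (by simp [h'])]
      exact integral_phase_damp hq.1 hq.2 (contDiff_damps l hG) (hasCompactSupport_damps l hc)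
  exact key oscList fun q h => h

/-- The oscillatory integral of a smooth function with bounded derivatives, in absolutely
convergent form. -/
noncomputable def J (G : PP → F) : F :=
  ((1 / (4 * Real.pi ^ 2) : ℝ) : ℂ) • ∫ z, phase z • oscOp G z

theorem integrable_phase_oscOp {G : PP → F} (hG : Cb G) :
    Integrable (fun z => phase z • oscOp G z) := by
  obtain ⟨c, hc0, hc⟩ := exists_norm_oscOp_le F
  obtain ⟨C, hC⟩ := hG.2 24
  refine Integrable.mono' (integrable_wt.const_mul (c * C))
    (contDiff_phase.continuous.smul (contDiff_oscOp hG.1).continuous).aestronglyMeasurable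
    (Eventually.of_forall fun z => ?_)
  rw [norm_smul, norm_phase, one_mul]
  have := hc G hG.1 z
  have := hC z
  have := wt_nonneg z
  calc _ ≤ c * wt z * jet 24 G z := hc G hG.1 z
    _ ≤ c * wt z * C := by gcongr
    _ = _ := by ring

variable {V W : Type*} [NormedAddCommGroup V] [NormedSpace ℝ V]
  [NormedAddCommGroup W] [NormedSpace ℝ W]

/-- Convergence of smooth functions, with all derivatives: pointwise, with uniform bounds. -/
structure BTends {E : Type*} [NormedAddCommGroup E] [NormedSpace ℝ E] {ι : Type*} (l : Filter ι)
    (Gi : ι → V → E) (G : V → E) : Prop where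
  smooth : ∀ᶠ i in l, ContDiff ℝ ∞ (Gi i)
  limit : Cb G
  bdd : ∀ n, ∃ C, ∀ᶠ i in l, ∀ z, jet n (Gi i) z ≤ C
  tends : ∀ n z, Tendsto (fun i => jet n (fun z => Gi i z - G z) z) l (𝓝 0)

theorem BTends.bilin {E E₁ E₂ : Type*} [NormedAddCommGroup E] [NormedSpace ℝ E]
    [NormedAddCommGroup E₁] [NormedSpace ℝ E₁] [NormedAddCommGroup E₂] [NormedSpace ℝ E₂]
    {ι : Type*} {l : Filter ι} (B : E₁ →L[ℝ] E₂ →L[ℝ] E) {Gi : ι → V → E₁} {G : V → E₁}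
    {K : V → E₂} (hG : BTends l Gi G) (hK : Cb K) :
    BTends l (fun i z => B (Gi i z) (K z)) (fun z => B (G z) (K z)) where
  smooth := hG.smooth.mono fun i hi =>
    B.isBoundedBilinearMap.contDiff.comp (hi.prodMk hK.1)
  limit := hG.limit.bilin B hK
  bdd n := by
    obtain ⟨C, hC⟩ := hG.bdd n
    obtain ⟨D, hD0, hD⟩ := hK.exists_nonneg n
    obtain ⟨e, he, heB⟩ := exists_jet_bilin_le (V := V) n B
    refine ⟨e * C * D, (hC.and hG.smooth).mono fun i hi z => ?_⟩
    have h1 := heB hi.2 hK.1 z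
    have h2 := hi.1 z
    have h3 := hD z
    have h4 := jet_nonneg n (Gi i) z
    have h5 : 0 ≤ C := h4.trans h2
    have h6 := jet_nonneg n K z
    calc _ ≤ _ := h1
      _ ≤ _ := by gcongr
  tends n z := by
    obtain ⟨e, he, heB⟩ := exists_jet_bilin_le (V := V) n B
    have h0 : Tendsto (fun i => e * jet n (fun z => Gi i z - G z) z * jet n K z) l (𝓝 0) := by
      simpa using ((hG.tends n z).const_mul e).mul_const (jet n K z)
    refine squeeze_zero' (Eventually.of_forall fun i => jet_nonneg _ _ _) ?_ h0
    refine hG.smooth.mono fun i hi => ?_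
    have h1 := heB (hi.sub hG.limit.1) hK.1 z
    simpa only [map_sub, sub_apply] using h1

theorem BTends.comp_affine {E : Type*} [NormedAddCommGroup E] [NormedSpace ℝ E] {ι : Type*}
    {l : Filter ι} (L : W →L[ℝ] V) (c : V) {Gi : ι → V → E} {G : V → E} (hG : BTends l Gi G) :
    BTends l (fun i z => Gi i (L z + c)) (fun z => G (L z + c)) where
  smooth := hG.smooth.mono fun i hi => hi.comp (L.contDiff.add contDiff_const)
  limit := hG.limit.comp_affine L c
  bdd n := by
    obtain ⟨C, hC⟩ := hG.bdd n
    refine ⟨max 1 ‖L‖ ^ n * C, (hC.and hG.smooth).mono fun i hi z => ?_⟩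
    exact (jet_comp_le n L c hi.2 z).trans (mul_le_mul_of_nonneg_left (hi.1 _) (by positivity))
  tends n z := by
    have h0 : Tendsto (fun i => max 1 ‖L‖ ^ n * jet n (fun z => Gi i z - G z) (L z + c)) l
        (𝓝 0) := by
      simpa using (hG.tends n (L z + c)).const_mul (max 1 ‖L‖ ^ n)
    refine squeeze_zero' (Eventually.of_forall fun i => jet_nonneg _ _ _) ?_ h0
    exact hG.smooth.mono fun i hi => jet_comp_le n L c (hi.sub hG.limit.1) z

theorem BTends.comp_clm {E : Type*} [NormedAddCommGroup E] [NormedSpace ℝ E] {ι : Type*}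
    {l : Filter ι} (L : W →L[ℝ] V) {Gi : ι → V → E} {G : V → E} (hG : BTends l Gi G) :
    BTends l (fun i z => Gi i (L z)) (fun z => G (L z)) := by
  simpa using hG.comp_affine L 0

theorem norm_smul_id_le {E : Type*} [NormedAddCommGroup E] [NormedSpace ℝ E] {ε : ℝ}
    (hε : 0 ≤ ε) : ‖ε • ContinuousLinearMap.id ℝ E‖ ≤ ε :=
  ContinuousLinearMap.opNorm_le_bound _ hε fun x => by
    simp [norm_smul, abs_of_nonneg hε]

theorem jet_comp_smul_le {E : Type*} [NormedAddCommGroup E] [NormedSpace ℝ E] (n : ℕ) {K : V → E}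
    (hK : ContDiff ℝ ∞ K) {ε : ℝ} (hε : 0 < ε ∧ ε ≤ 1) (z : V) :
    jet n (fun z => K (ε • z)) z ≤ jet n K (ε • z) := by
  have h := jet_comp_le n (ε • ContinuousLinearMap.id ℝ V) 0 hK z
  have h1 : max 1 ‖ε • ContinuousLinearMap.id ℝ V‖ = 1 :=
    max_eq_left ((norm_smul_id_le hε.1.le).trans hε.2)
  simpa [h1] using h

/-- Rescaled cutoff functions converge to `1`. -/
theorem bTends_cutoff {χ : V → ℂ} (hχ : Cb χ) (h0 : χ 0 = 1) :
    BTends (𝓝[>] (0 : ℝ)) (fun ε z => χ (ε • z)) (fun _ => 1) := by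
  have hbound : ∀ᶠ ε in 𝓝[>] (0 : ℝ), 0 < ε ∧ ε ≤ 1 := by
    filter_upwards [Ioc_mem_nhdsGT (zero_lt_one' ℝ)] with ε hε using hε
  refine ⟨Eventually.of_forall fun ε => hχ.1.comp (contDiff_const_smul ε), Cb.const 1,
    fun n => ?_, fun n z => ?_⟩
  · obtain ⟨C, hC⟩ := hχ.2 n
    exact ⟨C, hbound.mono fun ε hε z => (jet_comp_smul_le n hχ.1 hε z).trans (hC _)⟩
  · have h1 : Tendsto (fun ε : ℝ => ‖χ (ε • z) - 1‖) (𝓝[>] 0) (𝓝 0) := by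
      have hc : Continuous fun ε : ℝ => ‖χ (ε • z) - 1‖ :=
        ((hχ.1.continuous.comp (continuous_id.smul continuous_const)).sub continuous_const).norm
      have := hc.tendsto 0
      simp only [zero_smul, h0, sub_self, norm_zero] at this
      exact this.mono_left nhdsWithin_le_nhds
    -- Order zero is continuity of the cutoff at the origin; every derivative of positive order
    -- carries a factor `ε`.
    cases n with
    | zero => simpa only [jet_zero] using h1
    | succ n =>
      obtain ⟨C, hC⟩ := hχ.2 (n + 1)
      have h2 : Tendsto (fun ε : ℝ => ‖χ (ε • z) - 1‖ + ε * C) (𝓝[>] 0) (𝓝 0) := by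
        have h3 : Tendsto (fun ε : ℝ => ε * C) (𝓝[>] 0) (𝓝 0) := by
          have : Continuous fun ε : ℝ => ε * C := by fun_prop
          simpa using (this.tendsto 0).mono_left nhdsWithin_le_nhds
        simpa using h1.add h3
      refine squeeze_zero' (Eventually.of_forall fun i => jet_nonneg _ _ _) ?_ h2
      refine hbound.mono fun ε hε => ?_
      rw [jet_succ]
      refine add_le_add_right ?_ _
      have hd : fderiv ℝ (fun z => χ (ε • z) - 1) = fun z => ε • fderiv ℝ χ (ε • z) := by
        ext1 z
        have hz : HasFDerivAt (fun z : V => ε • z) (ε • ContinuousLinearMap.id ℝ V) z :=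
          (hasFDerivAt_id z).const_smul ε
        have := (((hχ.1.differentiable (by simp) (ε • z)).hasFDerivAt.comp z hz).sub_const 1).fderiv
        refine Eq.trans this ?_
        ext v
        simp
      have hsm : ContDiff ℝ ∞ (fderiv ℝ χ) := hχ.1.fderiv_right (by simp)
      rw [hd]
      have h3 := jet_clm_le n (ε • ContinuousLinearMap.id ℝ (V →L[ℝ] ℂ))
        (hsm.comp (contDiff_const_smul ε)) z
      have h5 : jet n (fun z => fderiv ℝ χ (ε • z)) z ≤ C :=
        (jet_comp_smul_le n hsm hε z).trans ((jet_fderiv_le n χ _).trans (hC _))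
      refine h3.trans (mul_le_mul (norm_smul_id_le hε.1.le) h5 (jet_nonneg _ _ _) hε.1.le)

theorem bTends_cutoff_smul {χ : V → ℂ} (hχ : Cb χ) (h0 : χ 0 = 1) {G : V → F} (hG : Cb G) :
    BTends (𝓝[>] (0 : ℝ)) (fun ε z => χ (ε • z) • G z) G := by
  have h := (bTends_cutoff hχ h0).bilin (ContinuousLinearMap.lsmul ℝ ℂ : ℂ →L[ℝ] F →L[ℝ] F) hG
  simpa using h

/-- Dominated convergence with a multiple of `wt` as majorant. The damped integrands converge
pointwise because `oscOp` is additive and bounded by the jet of order `24` at the same point. -/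
theorem tendsto_J {ι : Type*} {l : Filter ι} [l.IsCountablyGenerated] {Gi : ι → PP → F} {G : PP → F}
    (h : BTends l Gi G) : Tendsto (fun i => J (Gi i)) l (𝓝 (J G)) := by
  obtain ⟨c, hc0, hc⟩ := exists_norm_oscOp_le F
  obtain ⟨C, hC⟩ := h.bdd 24
  unfold J
  refine Tendsto.const_smul ?_ _
  refine tendsto_integral_filter_of_dominated_convergence (fun z => c * C * wt z) ?_ ?_
    (integrable_wt.const_mul _) ?_
  · exact h.smooth.mono fun i hi =>
      (contDiff_phase.continuous.smul (contDiff_oscOp hi).continuous).aestronglyMeasurable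
  · refine (h.smooth.and hC).mono fun i hi => Eventually.of_forall fun z => ?_
    rw [norm_smul, norm_phase, one_mul]
    have h1 := hc (Gi i) hi.1 z
    have h2 := hi.2 z
    have := wt_nonneg z
    calc _ ≤ c * wt z * jet 24 (Gi i) z := h1
      _ ≤ c * wt z * C := by gcongr
      _ = _ := by ring
  · refine Eventually.of_forall fun z => Tendsto.const_smul ?_ _
    rw [tendsto_iff_norm_sub_tendsto_zero]
    have h0 : Tendsto (fun i => c * wt z * jet 24 (fun z => Gi i z - G z) z) l (𝓝 0) := by
      simpa using (h.tends 24 z).const_mul (c * wt z)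
    refine squeeze_zero' (Eventually.of_forall fun i => norm_nonneg _) ?_ h0
    refine h.smooth.mono fun i hi => ?_
    have h1 := hc _ (hi.sub h.limit.1) z
    have h2 : oscOp (fun z => Gi i z - G z) z = oscOp (Gi i) z - oscOp G z :=
      congrFun (damps_sub oscList hi h.limit.1) z
    rwa [h2] at h1

theorem IsCutoff.cb {χ : PP → ℂ} (h : IsCutoff χ) : Cb χ := Cb.of_hasCompactSupport h.1 h.2.1

theorem oscInt_eq_J {χ : PP → ℂ} (hχ : IsCutoff χ) {G : PP → F} (hG : ContDiff ℝ ∞ G) {ε : ℝ}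
    (hε : 0 < ε) : oscInt χ (fun s s' => G (s, s')) ε = J fun z => χ (ε • z) • G z := by
  have h1 : ContDiff ℝ ∞ fun z => χ (ε • z) • G z :=
    (hχ.1.comp (contDiff_const_smul ε)).smul hG
  have h2 : HasCompactSupport fun z => χ (ε • z) • G z :=
    (hχ.2.1.comp_smul hε.ne').smul_right
  rw [J, integral_phase_oscOp h1 h2, oscInt]
  simp only [smul_smul]
  rfl

/-- For `ε > 0` the cut-off function has compact support, so integration by parts is exact and the
regularized integral is `J` of it. Continuity of `J` removes the cutoff, and the limit no longer
refers to `χ`. -/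
theorem hasOscInt_J {G : PP → F} (hG : Cb G) : HasOscInt (fun s s' => G (s, s')) (J G) := by
  intro χ hχ
  refine (tendsto_J (bTends_cutoff_smul hχ.cb hχ.2.2 hG)).congr' ?_
  filter_upwards [self_mem_nhdsWithin] with ε hε
  exact (oscInt_eq_J hχ hG.1 hε).symm

end OscillatoryFunctional

end WarpedDirac

namespace WarpedDirac

/-! ### Oscillatory integrals depending on parameters -/

section Parameters

variable {V : Type} [NormedAddCommGroup V] [NormedSpace ℝ V]

/-- The partial derivative with respect to the first variable. -/
noncomputable def dfst {E : Type*} [NormedAddCommGroup E] [NormedSpace ℝ E] (H : V × PP → E)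
    (p : V × PP) : V →L[ℝ] E :=
  (fderiv ℝ H p).comp (ContinuousLinearMap.inl ℝ V PP)

theorem contDiff_dfst {E : Type*} [NormedAddCommGroup E] [NormedSpace ℝ E] {H : V × PP → E}
    (hH : ContDiff ℝ ∞ H) : ContDiff ℝ ∞ (dfst H) :=
  (hH.fderiv_right (m := ∞) (by simp)).clm_comp contDiff_const

theorem hasFDerivAt_dfst {E : Type*} [NormedAddCommGroup E] [NormedSpace ℝ E] {H : V × PP → E}
    (hH : ContDiff ℝ ∞ H) (x : V) (z : PP) :
    HasFDerivAt (fun x => H (x, z)) (dfst H (x, z)) x :=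
  ((hH.differentiable (by simp) (x, z)).hasFDerivAt).comp x (hasFDerivAt_prodMk_left x z)

theorem jet_dfst_slice_le {E : Type*} [NormedAddCommGroup E] [NormedSpace ℝ E] {H : V × PP → E}
    (hH : ContDiff ℝ ∞ H) (n : ℕ) (x : V) (z : PP) :
    jet (n + 1) (fun x => H (x, z)) x = ‖H (x, z)‖ + jet n (fun x => dfst H (x, z)) x := by
  rw [jet_succ]
  have : fderiv ℝ (fun x => H (x, z)) = fun x => dfst H (x, z) := by
    ext1 x
    exact (hasFDerivAt_dfst hH x z).fderiv
  rw [this]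

/-- Smooth families whose derivatives with respect to the parameter are dominated. -/
structure Dominated {E : Type*} [NormedAddCommGroup E] [NormedSpace ℝ E] (H : V × PP → E) :
    Prop where
  smooth : ContDiff ℝ ∞ H
  bound : ∀ n, ∃ C, ∀ x z, jet n (fun x => H (x, z)) x ≤ C * wt z

theorem Dominated.dfst {E : Type*} [NormedAddCommGroup E] [NormedSpace ℝ E] {H : V × PP → E}
    (h : Dominated H) : Dominated (dfst H) where
  smooth := contDiff_dfst h.smooth
  bound n := by
    obtain ⟨C, hC⟩ := h.bound (n + 1)
    refine ⟨C, fun x z => ?_⟩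
    have := hC x z
    rw [jet_dfst_slice_le h.smooth] at this
    linarith [norm_nonneg (H (x, z))]

theorem Dominated.integrable {E : Type*} [NormedAddCommGroup E] [NormedSpace ℝ E] {H : V × PP → E}
    (h : Dominated H) (x : V) : Integrable (fun z => H (x, z)) := by
  obtain ⟨C, hC⟩ := h.bound 0
  refine Integrable.mono' (integrable_wt.const_mul C)
    (h.smooth.continuous.comp (by fun_prop)).aestronglyMeasurable (Eventually.of_forall fun z => ?_)
  simpa [jet_zero] using hC x z

theorem continuous_jet_slice {E : Type*} [NormedAddCommGroup E] [NormedSpace ℝ E] (n : ℕ)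
    {H : V × PP → E} (hH : ContDiff ℝ ∞ H) :
    Continuous (fun p : V × PP => jet n (fun x => H (x, p.2)) p.1) := by
  induction n generalizing E with
  | zero => simpa only [jet_zero] using hH.continuous.norm
  | succ n ih =>
    simp only [jet_dfst_slice_le hH]
    exact hH.continuous.norm.add (ih (contDiff_dfst hH))

theorem Dominated.integrable_jet {E : Type*} [NormedAddCommGroup E] [NormedSpace ℝ E]
    {H : V × PP → E} (h : Dominated H) (n : ℕ) (x : V) :
    Integrable (fun z => jet n (fun x => H (x, z)) x) := by
  obtain ⟨C, hC⟩ := h.bound n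
  refine Integrable.mono' (integrable_wt.const_mul C)
    ((continuous_jet_slice n h.smooth).comp
      (Continuous.prodMk_right x)).aestronglyMeasurable (Eventually.of_forall fun z => ?_)
  rw [Real.norm_of_nonneg (jet_nonneg _ _ _)]
  exact hC x z

theorem Dominated.hasFDerivAt {E : Type*} [NormedAddCommGroup E] [NormedSpace ℝ E]
    {H : V × PP → E} (h : Dominated H) (x : V) :
    HasFDerivAt (fun x => ∫ z, H (x, z)) (∫ z, WarpedDirac.dfst H (x, z)) x := by
  obtain ⟨C, hC⟩ := h.dfst.bound 0
  refine hasFDerivAt_integral_of_dominated_of_fderiv_le (s := univ)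
    (F' := fun x z => WarpedDirac.dfst H (x, z))
    (bound := fun z => C * wt z) univ_mem
    (Eventually.of_forall fun x => (h.integrable x).aestronglyMeasurable)
    (h.integrable x) (h.dfst.integrable x).aestronglyMeasurable
    (Eventually.of_forall fun z x _ => ?_) (integrable_wt.const_mul C)
    (Eventually.of_forall fun z x _ => hasFDerivAt_dfst h.smooth x z)
  simpa [jet_zero] using hC x z

/-- Domination passes to `dfst H`, so differentiation under the integral can be repeated. The target
space varies in the induction because `dfst H` takes values in `V →L[ℝ] E`. -/
theorem Dominated.contDiff_nat {E : Type*} [NormedAddCommGroup E] [NormedSpace ℝ E]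
    {H : V × PP → E} (h : Dominated H) (n : ℕ) : ContDiff ℝ n (fun x => ∫ z, H (x, z)) := by
  induction n generalizing E with
  | zero =>
    exact contDiff_zero.2
      (continuous_iff_continuousAt.2 fun x => (h.hasFDerivAt x).continuousAt)
  | succ n ih =>
    rw [show ((n + 1 : ℕ) : ℕ∞ω) = (n : ℕ∞ω) + 1 by push_cast; rfl, contDiff_succ_iff_hasFDerivAt]
    exact ⟨_, ih h.dfst, h.hasFDerivAt⟩

theorem Dominated.contDiff {E : Type*} [NormedAddCommGroup E] [NormedSpace ℝ E]
    {H : V × PP → E} (h : Dominated H) : ContDiff ℝ ∞ (fun x => ∫ z, H (x, z)) :=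
  contDiff_infty.2 h.contDiff_nat

theorem Dominated.jet_integral_le {E : Type*} [NormedAddCommGroup E] [NormedSpace ℝ E]
    {H : V × PP → E} (h : Dominated H) (n : ℕ) (x : V) :
    jet n (fun x => ∫ z, H (x, z)) x ≤ ∫ z, jet n (fun x => H (x, z)) x := by
  induction n generalizing E with
  | zero =>
    simp only [jet_zero]
    exact norm_integral_le_integral_norm _
  | succ n ih =>
    simp only [jet_dfst_slice_le h.smooth]
    rw [integral_add (h.integrable x).norm (h.dfst.integrable_jet n x), jet_succ]
    have hd : fderiv ℝ (fun x => ∫ z, H (x, z)) = fun x => ∫ z, WarpedDirac.dfst H (x, z) := by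
      ext1 x
      exact (h.hasFDerivAt x).fderiv
    rw [hd]
    exact add_le_add (norm_integral_le_integral_norm _) (ih h.dfst)

variable {F : Type*} [NormedAddCommGroup F] [NormedSpace ℂ F]

/-- The total damping operator with respect to the second variable. -/
noncomputable def oscOpSnd (G : V × PP → F) : V × PP → F := damps (oscList.map (liftDir V)) G

theorem oscOp_slice {G : V × PP → F} (hG : ContDiff ℝ ∞ G) (x : V) (z : PP) :
    oscOp (fun z => G (x, z)) z = oscOpSnd G (x, z) :=
  congrFun (damps_slice oscList hG x) z

variable (V F) in
theorem exists_jet_oscOpSnd_le (n : ℕ) :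
    ∃ c, 0 ≤ c ∧ ∀ G : V × PP → F, ContDiff ℝ ∞ G → ∀ x z,
      jet n (fun x => phase z • oscOpSnd G (x, z)) x ≤ c * wt z * jet (n + 24) G (x, z) := by
  obtain ⟨c, hc0, hc⟩ := exists_jet_damps_le (F := F) (oscList.map (liftDir V)) n
  refine ⟨c, hc0, fun G hG x z => ?_⟩
  have hs : ContDiff ℝ ∞ (oscOpSnd G) := contDiff_damps _ hG
  have h1 := jet_clm_le n (phase z • ContinuousLinearMap.id ℝ F)
    (hs.comp (contDiff_prodMk_left z)) x
  have h2 : ‖phase z • ContinuousLinearMap.id ℝ F‖ ≤ 1 :=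
    ContinuousLinearMap.opNorm_le_bound _ zero_le_one fun v => by simp [norm_smul, norm_phase]
  have h3 : jet n (fun x => phase z • oscOpSnd G (x, z)) x ≤
      jet n (fun x => oscOpSnd G (x, z)) x :=
    h1.trans (mul_le_of_le_one_left (jet_nonneg _ _ _) h2)
  refine h3.trans ((jet_slice_left_le n hs x z).trans ((hc G hG (x, z)).trans ?_))
  rw [List.length_map, length_oscList, List.map_map]
  have h4 : (List.map ((fun q => ‖rres q.1 (x, z)‖) ∘ liftDir V) oscList) =
      oscList.map fun q => ‖rres q.1 z‖ := by
    refine List.map_congr_left fun q _ => ?_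
    simp [liftDir, rres]
  rw [h4]
  have := prod_oscList_le z
  have := jet_nonneg (n + 24) G (x, z)
  gcongr

theorem dominated_oscOpSnd {G : V × PP → F} (hG : Cb G) :
    Dominated (fun p : V × PP => phase p.2 • oscOpSnd G p) where
  smooth := (contDiff_phase.comp contDiff_snd).smul (contDiff_damps _ hG.1)
  bound n := by
    obtain ⟨c, hc0, hc⟩ := exists_jet_oscOpSnd_le V F n
    obtain ⟨C, hC⟩ := hG.2 (n + 24)
    refine ⟨c * C, fun x z => (hc G hG.1 x z).trans ?_⟩
    have := hC (x, z)
    have := wt_nonneg z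
    calc c * wt z * jet (n + 24) G (x, z) ≤ c * wt z * C := by gcongr
      _ = _ := by ring

theorem J_slice {G : V × PP → F} (hG : ContDiff ℝ ∞ G) (x : V) :
    J (fun z => G (x, z)) =
      ((1 / (4 * Real.pi ^ 2) : ℝ) : ℂ) • ∫ z, phase z • oscOpSnd G (x, z) := by
  simp only [J, oscOp_slice hG]

-- The right-hand side keeps the weighted integral of the jet instead of its supremum: in `BTends.J`
-- the jets converge only pointwise, and dominated convergence is applied under this integral.
variable (V F) in
theorem exists_jet_J_le (n : ℕ) :
    ∃ c, 0 ≤ c ∧ ∀ G : V × PP → F, Cb G → ∀ x,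
      jet n (fun x => J fun z => G (x, z)) x ≤ c * ∫ z, wt z * jet (n + 24) G (x, z) := by
  obtain ⟨c, hc0, hc⟩ := exists_jet_oscOpSnd_le V F n
  set k : ℂ := ((1 / (4 * Real.pi ^ 2) : ℝ) : ℂ)
  refine ⟨‖k • ContinuousLinearMap.id ℝ F‖ * c, mul_nonneg (norm_nonneg _) hc0, fun G hG x => ?_⟩
  simp only [J_slice hG.1]
  have hdom := dominated_oscOpSnd hG
  refine (jet_clm_le n (k • ContinuousLinearMap.id ℝ F) hdom.contDiff x).trans ?_
  rw [mul_assoc]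
  refine mul_le_mul_of_nonneg_left ((hdom.jet_integral_le n x).trans ?_) (norm_nonneg _)
  rw [← integral_const_mul]
  refine integral_mono (hdom.integrable_jet n x) ?_ fun z => ?_
  · refine Integrable.const_mul ?_ c
    obtain ⟨C, hC⟩ := hG.2 (n + 24)
    refine Integrable.mono' (integrable_wt.const_mul C)
      (continuous_wt.mul ((continuous_jet _ hG.1).comp
        (Continuous.prodMk_right x))).aestronglyMeasurable (Eventually.of_forall fun z => ?_)
    rw [Real.norm_of_nonneg (mul_nonneg (wt_nonneg z) (jet_nonneg _ _ _)), mul_comm]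
    exact mul_le_mul_of_nonneg_right (hC _) (wt_nonneg z)
  · have := hc G hG.1 x z
    simpa [mul_assoc] using this

/-- This permits iterated oscillatory integrals, and it is the source of the smoothness of warped
vectors. -/
theorem Cb.J {G : V × PP → F} (hG : Cb G) : Cb (fun x => WarpedDirac.J fun z => G (x, z)) := by
  refine ⟨?_, fun n => ?_⟩
  · simp only [J_slice hG.1]
    exact (dominated_oscOpSnd hG).contDiff.const_smul _
  · obtain ⟨c, hc0, hc⟩ := exists_jet_J_le V F n
    obtain ⟨C, hC⟩ := hG.2 (n + 24)
    refine ⟨c * ∫ z, wt z * C, fun x => (hc G hG x).trans (mul_le_mul_of_nonneg_left ?_ hc0)⟩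
    refine integral_mono_of_nonneg
      (Eventually.of_forall fun z => mul_nonneg (wt_nonneg z) (jet_nonneg _ _ _))
      (integrable_wt.mul_const C)
      (Eventually.of_forall fun z => mul_le_mul_of_nonneg_left (hC _) (wt_nonneg z))

theorem J_sub {G K : PP → F} (hG : Cb G) (hK : Cb K) :
    J (fun z => G z - K z) = J G - J K := by
  have h : oscOp (fun z => G z - K z) = fun z => oscOp G z - oscOp K z :=
    damps_sub oscList hG.1 hK.1
  simp only [J, h, smul_sub]
  rw [integral_sub (integrable_phase_oscOp hG) (integrable_phase_oscOp hK), smul_sub]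

theorem BTends.J {ι : Type*} {l : Filter ι} [l.IsCountablyGenerated] {Gi : ι → V × PP → F}
    {G : V × PP → F} (h : BTends l Gi G) (hcb : ∀ᶠ i in l, Cb (Gi i)) :
    BTends l (fun i x => WarpedDirac.J fun z => Gi i (x, z))
      (fun x => WarpedDirac.J fun z => G (x, z)) where
  smooth := hcb.mono fun i hi => hi.J.1
  limit := h.limit.J
  bdd n := by
    obtain ⟨c, hc0, hc⟩ := exists_jet_J_le V F n
    obtain ⟨C, hC⟩ := h.bdd (n + 24)
    refine ⟨c * ∫ z, wt z * C, (hcb.and hC).mono fun i hi x =>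
      (hc (Gi i) hi.1 x).trans (mul_le_mul_of_nonneg_left ?_ hc0)⟩
    refine integral_mono_of_nonneg
      (Eventually.of_forall fun z => mul_nonneg (wt_nonneg z) (jet_nonneg _ _ _))
      (integrable_wt.mul_const C)
      (Eventually.of_forall fun z => mul_le_mul_of_nonneg_left (hi.2 _) (wt_nonneg z))
  tends n x := by
    obtain ⟨c, hc0, hc⟩ := exists_jet_J_le V F n
    obtain ⟨C, hC⟩ := h.bdd (n + 24)
    obtain ⟨D, hD⟩ := h.limit.2 (n + 24)
    have h0 : Tendsto (fun i => c * ∫ z, wt z * jet (n + 24) (fun p => Gi i p - G p) (x, z)) l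
        (𝓝 0) := by
      rw [show (0 : ℝ) = c * ∫ z : PP, (0 : ℝ) by simp]
      refine Tendsto.const_mul c ?_
      refine tendsto_integral_filter_of_dominated_convergence (fun z => (C + D) * wt z) ?_ ?_
        (integrable_wt.const_mul _) ?_
      · exact hcb.mono fun i hi => (continuous_wt.mul ((continuous_jet _
          (hi.1.sub h.limit.1)).comp (Continuous.prodMk_right x))).aestronglyMeasurable
      · refine (hcb.and hC).mono fun i hi => Eventually.of_forall fun z => ?_
        rw [Real.norm_of_nonneg (mul_nonneg (wt_nonneg z) (jet_nonneg _ _ _)), mul_comm]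
        refine mul_le_mul_of_nonneg_right ?_ (wt_nonneg z)
        exact (jet_sub_le _ hi.1.1 h.limit.1 _).trans (add_le_add (hi.2 _) (hD _))
      · refine Eventually.of_forall fun z => ?_
        simpa using (h.tends (n + 24) (x, z)).const_mul (wt z)
    refine squeeze_zero' (Eventually.of_forall fun i => jet_nonneg _ _ _) ?_ h0
    refine hcb.mono fun i hi => ?_
    have h1 := hc _ (hi.add h.limit.neg) x
    simp only [← sub_eq_add_neg] at h1
    have h2 : (fun x => WarpedDirac.J fun z => Gi i (x, z) - G (x, z)) =
        fun x => (WarpedDirac.J fun z => Gi i (x, z)) - WarpedDirac.J fun z => G (x, z) := by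
      ext1 x
      exact J_sub (hi.slice_right x) (h.limit.slice_right x)
    rwa [h2] at h1

end Parameters

end WarpedDirac

namespace WarpedDirac

/-! ### Symmetries of the oscillatory integral and its values on plane waves -/

section Evaluation

variable {F : Type*} [NormedAddCommGroup F] [NormedSpace ℂ F]

/-- The plane wave `y ↦ exp (i a · y)`. -/
noncomputable def pw (a : Plane) : Plane → ℂ := wave (innerSL ℝ a)

theorem pw_apply (a y : Plane) : pw a y = Complex.exp (Complex.I * ((inner ℝ a y : ℝ) : ℂ)) := rfl

theorem continuous_pw_uncurry : Continuous fun p : Plane × Plane => pw p.1 p.2 := by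
  simp only [pw_apply]
  fun_prop

theorem Cb.pw (a : Plane) : Cb (pw a) := Cb.wave _

theorem exists_bump : ∃ β : Plane → ℂ, ContDiff ℝ ∞ β ∧ HasCompactSupport β ∧ β 0 = 1 := by
  let b : ContDiffBump (0 : Plane) := ⟨1, 2, by norm_num, by norm_num⟩
  refine ⟨fun s => (b s : ℂ), Complex.ofRealCLM.contDiff.comp b.contDiff,
    b.hasCompactSupport.comp_left (g := fun t : ℝ => (t : ℂ)) (by simp), ?_⟩
  have : b 0 = 1 := b.one_of_mem_closedBall (by simp [b])
  simp [this]

theorem isCutoff_mul {β : Plane → ℂ} (hβ : ContDiff ℝ ∞ β) (hc : HasCompactSupport β)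
    (h0 : β 0 = 1) : IsCutoff fun z => β z.1 * β z.2 := by
  refine ⟨(hβ.comp contDiff_fst).mul (hβ.comp contDiff_snd), ?_, by simp [h0]⟩
  refine HasCompactSupport.intro (hc.isCompact.prod hc.isCompact) fun z hz => ?_
  by_cases h : z.1 ∈ tsupport β
  · have h2 : z.2 ∉ tsupport β := fun h2 => hz ⟨h, h2⟩
    simp [image_eq_zero_of_notMem_tsupport h2]
  · simp [image_eq_zero_of_notMem_tsupport h]

theorem exists_isCutoff : ∃ χ, IsCutoff χ := by
  obtain ⟨β, h1, h2, h3⟩ := exists_bump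
  exact ⟨_, isCutoff_mul h1 h2 h3⟩

theorem HasOscInt.unique {K : Plane → Plane → F} {a b : F} (ha : HasOscInt K a)
    (hb : HasOscInt K b) : a = b := by
  obtain ⟨χ, hχ⟩ := exists_isCutoff
  exact tendsto_nhds_unique (ha χ hχ) (hb χ hχ)

theorem J_eq_of_hasOscInt {G : PP → F} (hG : Cb G) {a : F}
    (h : HasOscInt (fun s s' => G (s, s')) a) : J G = a :=
  (hasOscInt_J hG).unique h

/-- Since the limit is the same for all cutoffs, a single convenient one is enough to compute `J`.
-/
theorem J_eq_of_tendsto {G : PP → F} (hG : Cb G) {a : F} {χ : PP → ℂ} (hχ : IsCutoff χ)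
    (h : Tendsto (oscInt χ fun s s' => G (s, s')) (𝓝[>] 0) (𝓝 a)) : J G = a :=
  tendsto_nhds_unique (hasOscInt_J hG χ hχ) h

theorem integrable_cutoff_smul {χ : PP → ℂ} (hχ : IsCutoff χ) {G : PP → F} (hG : Continuous G)
    {ε : ℝ} (hε : ε ≠ 0) : Integrable fun z => (phase z * χ (ε • z)) • G z := by
  have h2 : HasCompactSupport fun z => χ (ε • z) := hχ.2.1.comp_smul hε
  refine Continuous.integrable_of_hasCompactSupport ?_ ?_
  · exact (contDiff_phase.continuous.mul (hχ.1.continuous.comp (continuous_const_smul ε))).smul hG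
  · exact (HasCompactSupport.mul_left (f := phase) h2).smul_right

/-- The identity holds for the regularized integrals, which are Bochner integrals of continuous
compactly supported functions, and survives the limit. -/
theorem J_clm {F' : Type*} [NormedAddCommGroup F'] [NormedSpace ℂ F'] [CompleteSpace F]
    [CompleteSpace F'] (L : F →L[ℂ] F') {G : PP → F} (hG : Cb G) :
    J (fun z => L (G z)) = L (J G) := by
  have hG' : Cb fun z => L (G z) := hG.clm (L.restrictScalars ℝ)
  refine J_eq_of_hasOscInt hG' fun χ hχ => ?_
  refine ((L.continuous.tendsto _).comp (hasOscInt_J hG χ hχ)).congr' ?_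
  filter_upwards [self_mem_nhdsWithin] with ε hε
  simp only [Function.comp_apply, oscInt, map_smul]
  have h := L.integral_comp_comm (integrable_cutoff_smul hχ hG.1.continuous (ne_of_gt hε))
  simp only [map_smul] at h
  exact congrArg _ h.symm

/-- Invariance of the oscillatory integral under measure preserving linear maps which preserve
the phase. -/
theorem J_comp_equiv (L : PP ≃L[ℝ] PP) (hL : MeasurePreserving L) (hph : ∀ z, phase (L z) = phase z)
    {G : PP → F} (hG : Cb G) : J (fun z => G (L z)) = J G := by
  obtain ⟨χ, hχ⟩ := exists_isCutoff
  -- The change of variables also transforms the cutoff; independence of the cutoff absorbs this.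
  have hχ' : IsCutoff fun z => χ (L z) := by
    refine ⟨hχ.1.comp L.contDiff, hχ.2.1.comp_homeomorph L.toHomeomorph, ?_⟩
    have : L (0, 0) = (0, 0) := map_zero L
    change χ (L (0, 0)) = 1
    rw [this, hχ.2.2]
  have hG' : Cb fun z => G (L z) := hG.comp_clm (L : PP →L[ℝ] PP)
  refine J_eq_of_tendsto hG' hχ' ((hasOscInt_J hG χ hχ).congr fun ε => ?_)
  simp only [oscInt]
  congr 1
  rw [← hL.integral_comp L.toHomeomorph.measurableEmbedding]
  congr 1
  ext z
  have h1 : phase (L z) = phase z := hph z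
  unfold phase at h1
  rw [h1]
  have h2 : L (ε • z) = (ε • (L z).1, ε • (L z).2) := by rw [map_smul]; rfl
  change _ = (_ * χ (L (ε • z))) • G (L z)
  rw [h2]

theorem J_swap {G : PP → F} (hG : Cb G) : J (fun z => G z.swap) = J G :=
  J_comp_equiv (ContinuousLinearEquiv.prodComm ℝ Plane Plane) Measure.measurePreserving_swap
    (fun z => by simp [phase, real_inner_comm]) hG

theorem Q_zero_apply (s : Plane) : Q s 0 = s 1 := by simp [Q, dotProduct]

theorem Q_one_apply (s : Plane) : Q s 1 = -s 0 := by simp [Q, dotProduct]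

/-- The matrix `Q` as a continuous linear map. -/
noncomputable def Qc : Plane →L[ℝ] Plane :=
  LinearMap.toContinuousLinearMap
    { toFun := Q
      map_add' := fun s t => by
        ext i; fin_cases i <;> simp [Q_zero_apply, Q_one_apply]; ring
      map_smul' := fun c s => by
        ext i; fin_cases i <;> simp [Q_zero_apply, Q_one_apply] }

theorem Qc_apply (s : Plane) : Qc s = Q s := rfl

theorem inner_Q_left (s t : Plane) : (inner ℝ (Q s) t : ℝ) = -inner ℝ s (Q t) := by
  simp only [PiLp.inner_apply, Fin.sum_univ_two, Q_zero_apply, Q_one_apply]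
  simp

theorem inner_self_Q (s : Plane) : (inner ℝ s (Q s) : ℝ) = 0 := by
  have := inner_Q_left s s
  rw [real_inner_comm] at this
  linarith

/-- The shear `(s, s') ↦ (s, s' + λ Q s)`. -/
noncomputable def shear (lam : ℝ) : PP ≃L[ℝ] PP :=
  ContinuousLinearEquiv.equivOfInverse
    ((ContinuousLinearMap.fst ℝ Plane Plane).prod
      (ContinuousLinearMap.snd ℝ Plane Plane + lam • Qc.comp (ContinuousLinearMap.fst ℝ _ _)))
    ((ContinuousLinearMap.fst ℝ Plane Plane).prod
      (ContinuousLinearMap.snd ℝ Plane Plane - lam • Qc.comp (ContinuousLinearMap.fst ℝ _ _)))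
    (fun z => by simp) (fun z => by simp)

theorem shear_apply (lam : ℝ) (z : PP) : shear lam z = (z.1, z.2 + lam • Q z.1) := rfl

/-- The shear translates each fibre over `s`, so it preserves the measure, and it preserves the
phase because `s·Qs = 0`. -/
theorem J_shear (lam : ℝ) {G : PP → F} (hG : Cb G) :
    J (fun z => G (z.1, z.2 + lam • Q z.1)) = J G := by
  refine J_comp_equiv (shear lam) ?_ (fun z => ?_) hG
  · have := (MeasurePreserving.id (volume : Measure Plane)).skew_product
      (μc := (volume : Measure Plane)) (μd := (volume : Measure Plane))
      (g := fun s s' => s' + lam • Q s) ?_ (Eventually.of_forall fun s => ?_)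
    · exact this
    · exact (shear lam).continuous.snd.measurable
    · exact (measurePreserving_add_right volume (lam • Q s)).map_eq
  · simp [phase, shear_apply, inner_add_right, inner_smul_right, inner_self_Q]

/-- The Fourier transform of the cutoff. -/
noncomputable def ker (β : Plane → ℂ) (y : Plane) : ℂ :=
  ∫ s, Complex.exp (-Complex.I * ((inner ℝ s y : ℝ) : ℂ)) * β s

-- Take for `h` the Fourier transform of `g`, in the normalization with `2π` in the exponent. It is
-- a Schwartz function, hence integrable against the weight of degree `24` forced by `jet_wave_le`.
open scoped FourierTransform in
theorem exists_superposition {g : Plane → ℂ} (hg : ContDiff ℝ ∞ g) (hc : HasCompactSupport g) :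
    ∃ h : Plane → ℂ, Continuous h ∧ Integrable (fun p => ‖h p‖ * (1 + ‖p‖) ^ 24) ∧
      (∀ y, g y = ∫ p, h p * pw ((2 * Real.pi) • p) y) ∧
      ∀ y, ker g ((2 * Real.pi) • y) = h y := by
  let gs := hc.toSchwartzMap hg
  let hs : SchwartzMap Plane ℂ := 𝓕 gs
  refine ⟨⇑hs, hs.continuous, ?_, fun y => ?_, fun y => ?_⟩
  · have h1 := (hs.integrable_pow_mul volume 0).add (hs.integrable_pow_mul volume 24)
    refine Integrable.mono' (h1.const_mul (2 ^ 23)) ?_ (Eventually.of_forall fun p => ?_)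
    · exact (hs.continuous.norm.mul (by fun_prop)).aestronglyMeasurable
    · rw [Real.norm_of_nonneg (by positivity)]
      -- Convexity: `(1 + x)^24 ≤ 2^23 (1 + x^24)`, the origin of the factor `2 ^ 23`.
      have h2 := add_pow_le (zero_le_one' ℝ) (norm_nonneg p) 24
      simp only [Pi.add_apply]
      have h3 : 0 ≤ ‖hs p‖ := norm_nonneg _
      calc _ ≤ ‖hs p‖ * (2 ^ 23 * (1 ^ 24 + ‖p‖ ^ 24)) := by gcongr
        _ = _ := by ring
  · have h1 : g y = 𝓕⁻ (𝓕 gs) y := by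
      rw [FourierTransform.fourierInv_fourier_eq]; rfl
    rw [h1, SchwartzMap.fourierInv_coe, Real.fourierInv_eq']
    congr 1
    ext p
    rw [pw_apply, smul_eq_mul, mul_comm]
    congr 2
    rw [inner_smul_left]
    simp
    ring
  · rw [SchwartzMap.fourier_coe, Real.fourier_eq', ker]
    congr 1
    ext p
    rw [smul_eq_mul]
    congr 2
    rw [inner_smul_right]
    simp
    ring

/-- Fourier inversion at the origin; the constant is the Jacobian `(2π)²` of rescaling the plane. -/
theorem integrable_ker {β : Plane → ℂ} (hβ : ContDiff ℝ ∞ β) (hc : HasCompactSupport β) :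
    Integrable (ker β) ∧ ∫ y, ker β y = (4 * Real.pi ^ 2 : ℝ) • β 0 := by
  obtain ⟨h, hcont, hint, hsup, hker⟩ := exists_superposition hβ hc
  have hpi : (0 : ℝ) < 2 * Real.pi := by positivity
  have hk : (fun y => ker β y) = fun y => h ((2 * Real.pi)⁻¹ • y) := by
    ext y
    rw [← hker, smul_smul, mul_inv_cancel₀ hpi.ne', one_smul]
  have hi : Integrable h := by
    refine Integrable.mono' hint hcont.aestronglyMeasurable (Eventually.of_forall fun p => ?_)
    exact le_mul_of_one_le_right (norm_nonneg _) (one_le_pow₀ (by linarith [norm_nonneg p]))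
  refine ⟨?_, ?_⟩
  · change Integrable fun y => ker β y
    rw [hk]
    exact hi.comp_smul (inv_ne_zero hpi.ne')
  · rw [hk, Measure.integral_comp_inv_smul_of_nonneg _ _ hpi.le, hsup 0]
    simp only [pw_apply, inner_zero_right, Complex.ofReal_zero, mul_zero, Complex.exp_zero, mul_one]
    rw [finrank_euclideanSpace, Fintype.card_fin]
    congr 1
    ring

/-- With a product cutoff the `s`-integral can be done first: it gives `ε⁻² ker β ((s' - a) / ε)`, a
kernel concentrating at `s' = a`. The substitution `s' = a + ε y` absorbs `ε⁻²`. -/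
theorem oscInt_pw_smul_eq [CompleteSpace F] {β : Plane → ℂ} (hβ : ContDiff ℝ ∞ β) (hc : HasCompactSupport β)
    (h0 : β 0 = 1) {K : Plane → F} (hK : Continuous K) (a : Plane) {ε : ℝ} (hε : 0 < ε) :
    oscInt (fun z => β z.1 * β z.2) (fun s s' => pw a s • K s') ε =
      ((1 / (4 * Real.pi ^ 2) : ℝ) : ℂ) •
        ∫ y, ker β y • (β (ε • (a + ε • y)) • K (a + ε • y)) := by
  have hχ := isCutoff_mul hβ hc h0
  have hcont : Continuous fun z : PP => pw a z.1 • K z.2 :=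
    ((Cb.pw a).1.continuous.comp continuous_fst).smul (hK.comp continuous_snd)
  have hint := integrable_cutoff_smul hχ hcont hε.ne'
  rw [oscInt]
  congr 1
  have e1 : ∫ z : PP, (Complex.exp (-Complex.I * ((inner ℝ z.1 z.2 : ℝ) : ℂ)) *
      (fun z : PP => β z.1 * β z.2) (ε • z.1, ε • z.2)) • (fun s s' => pw a s • K s') z.1 z.2 =
      ∫ s', ∫ s, (phase (s, s') * (β (ε • s) * β (ε • s'))) • (pw a s • K s') :=
    integral_prod_symm _ hint
  rw [e1]
  have e2 : ∀ s' : Plane, ∫ s, (phase (s, s') * (β (ε • s) * β (ε • s'))) • (pw a s • K s') =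
      ((ε ^ 2)⁻¹ : ℝ) • (ker β (ε⁻¹ • (s' - a)) • (β (ε • s') • K s')) := by
    intro s'
    have h1 : ∀ s, (phase (s, s') * (β (ε • s) * β (ε • s'))) • (pw a s • K s') =
        (Complex.exp (-Complex.I * ((inner ℝ (ε • s) (ε⁻¹ • (s' - a)) : ℝ) : ℂ)) * β (ε • s)) •
          (β (ε • s') • K s') := by
      intro s
      rw [smul_smul, smul_smul]
      congr 1
      have h2 : phase (s, s') * pw a s =
          Complex.exp (-Complex.I * ((inner ℝ (ε • s) (ε⁻¹ • (s' - a)) : ℝ) : ℂ)) := by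
        rw [phase, pw_apply, ← Complex.exp_add, inner_smul_left, inner_smul_right, inner_sub_right,
          real_inner_comm s a]
        congr 1
        simp only [conj_trivial]
        rw [← mul_assoc ε, mul_inv_cancel₀ hε.ne']
        push_cast
        ring
      rw [← h2]
      ring
    simp only [h1]
    rw [integral_smul_const]
    have h3 := Measure.integral_comp_smul_of_nonneg (volume : Measure Plane)
      (fun r => Complex.exp (-Complex.I * ((inner ℝ r (ε⁻¹ • (s' - a)) : ℝ) : ℂ)) * β r) ε
      (hR := hε.le)
    rw [h3, finrank_euclideanSpace, Fintype.card_fin, smul_assoc]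
    rfl
  simp only [e2]
  rw [← integral_add_left_eq_self _ a]
  simp only [add_sub_cancel_left]
  have e3 : ∀ y : Plane, ((ε ^ 2)⁻¹ : ℝ) • (ker β (ε⁻¹ • y) • (β (ε • (a + y)) • K (a + y))) =
      (fun y : Plane => ((ε ^ 2)⁻¹ : ℝ) • (ker β y •
        (β (ε • (a + ε • y)) • K (a + ε • y)))) (ε⁻¹ • y) := by
    intro y
    simp only [smul_inv_smul₀ hε.ne']
  rw [integral_congr_ae (Eventually.of_forall e3),
    Measure.integral_comp_inv_smul_of_nonneg (volume : Measure Plane) (fun y : Plane =>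
      ((ε ^ 2)⁻¹ : ℝ) • (ker β y • (β (ε • (a + ε • y)) • K (a + ε • y)))) hε.le,
    finrank_euclideanSpace,
    Fintype.card_fin, integral_smul, smul_smul, mul_inv_cancel₀ (by positivity), one_smul]

theorem Cb.smul {V : Type*} [NormedAddCommGroup V] [NormedSpace ℝ V] {f : V → ℂ} {G : V → F}
    (hf : Cb f) (hG : Cb G) : Cb fun z => f z • G z :=
  Cb.bilin (ContinuousLinearMap.lsmul ℝ ℂ : ℂ →L[ℝ] F →L[ℝ] F) hf hG

theorem cb_pw_smul (a : Plane) {K : Plane → F} (hK : Cb K) : Cb fun z : PP => pw a z.1 • K z.2 :=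
  ((Cb.pw a).comp_clm (ContinuousLinearMap.fst ℝ Plane Plane)).smul
    (hK.comp_clm (ContinuousLinearMap.snd ℝ Plane Plane))

/-- Formally `(4π²)⁻¹ ∫ ds exp(-i s·(s' - a)) = δ(s' - a)`. The rescaled `ker β` is the approximate
identity which makes this precise. -/
theorem J_pw_smul (a : Plane) {K : Plane → F} (hK : Cb K) [CompleteSpace F] :
    J (fun z => pw a z.1 • K z.2) = K a := by
  obtain ⟨β, hβ, hc, h0⟩ := exists_bump
  obtain ⟨hki, hkv⟩ := integrable_ker hβ hc
  obtain ⟨C, hC⟩ := hc.exists_bound_of_continuous hβ.continuous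
  obtain ⟨D, hD⟩ := hK.2 0
  refine J_eq_of_tendsto (cb_pw_smul a hK) (isCutoff_mul hβ hc h0) ?_
  have h1 : K a = ((1 / (4 * Real.pi ^ 2) : ℝ) : ℂ) • ∫ y, ker β y • K a := by
    rw [integral_smul_const, hkv, h0, smul_smul]
    have : ((1 / (4 * Real.pi ^ 2) : ℝ) : ℂ) * (4 * Real.pi ^ 2 : ℝ) • (1 : ℂ) = 1 := by
      have hpi : (Real.pi : ℂ) ≠ 0 := by exact_mod_cast Real.pi_ne_zero
      rw [Complex.real_smul]
      push_cast
      field_simp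
    rw [this, one_smul]
  rw [h1]
  have h2 : Tendsto (fun ε : ℝ => ((1 / (4 * Real.pi ^ 2) : ℝ) : ℂ) •
      ∫ y, ker β y • (β (ε • (a + ε • y)) • K (a + ε • y))) (𝓝[>] 0)
      (𝓝 (((1 / (4 * Real.pi ^ 2) : ℝ) : ℂ) • ∫ y, ker β y • K a)) := by
    refine Tendsto.const_smul ?_ _
    refine tendsto_integral_filter_of_dominated_convergence (fun y => ‖ker β y‖ * (C * D)) ?_ ?_
      (hki.norm.mul_const _) ?_
    · refine Eventually.of_forall fun ε => hki.aestronglyMeasurable.smul ?_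
      refine Continuous.aestronglyMeasurable ?_
      exact (hβ.continuous.comp (by fun_prop)).smul (hK.1.continuous.comp (by fun_prop))
    · refine Eventually.of_forall fun ε => Eventually.of_forall fun y => ?_
      rw [norm_smul, norm_smul]
      have hD' := hD (a + ε • y)
      rw [jet_zero] at hD'
      have hC' := hC (ε • (a + ε • y))
      have hC0 := (norm_nonneg _).trans hC'
      gcongr
    · refine Eventually.of_forall fun y => Tendsto.const_smul ?_ _
      have hcont : Continuous fun ε : ℝ => β (ε • (a + ε • y)) • K (a + ε • y) :=
        (hβ.continuous.comp (by fun_prop)).smul (hK.1.continuous.comp (by fun_prop))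
      have := hcont.tendsto 0
      simp only [zero_smul, h0, add_zero, one_smul] at this
      exact this.mono_left nhdsWithin_le_nhds
  refine h2.congr' ?_
  filter_upwards [self_mem_nhdsWithin] with ε hε
  exact (oscInt_pw_smul_eq hβ hc h0 hK.1.continuous a hε).symm

theorem J_smul_pw (a : Plane) {K : Plane → F} (hK : Cb K) [CompleteSpace F] :
    J (fun z => pw a z.2 • K z.1) = K a := by
  rw [← J_pw_smul a hK, ← J_swap (cb_pw_smul a hK)]
  rfl

theorem pw_zero (y : Plane) : pw 0 y = 1 := by simp [pw_apply]

theorem J_fst {K : Plane → F} (hK : Cb K) [CompleteSpace F] : J (fun z => K z.1) = K 0 := by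
  simpa [pw_zero] using J_smul_pw 0 hK

theorem J_snd {K : Plane → F} (hK : Cb K) [CompleteSpace F] : J (fun z => K z.2) = K 0 := by
  simpa [pw_zero] using J_pw_smul 0 hK

theorem J_snd_sub (lam : ℝ) {K : Plane → F} (hK : Cb K) [CompleteSpace F] :
    J (fun z => K (z.2 - lam • Q z.1)) = K 0 := by
  have h := J_shear (-lam) (hK.comp_clm (ContinuousLinearMap.snd ℝ Plane Plane))
  simp only [ContinuousLinearMap.coe_snd', neg_smul, ← sub_eq_add_neg] at h
  rw [h]
  exact J_snd hK

end Evaluation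

end WarpedDirac

namespace WarpedDirac

/-! ### Interchanging the oscillatory integral with superpositions of plane waves -/

section Composition

theorem exists_norm_J_le : ∃ c, 0 ≤ c ∧ ∀ (G : PP → ℂ) (C : ℝ), ContDiff ℝ ∞ G →
    (∀ z, jet 24 G z ≤ C) → ‖J G‖ ≤ c * C := by
  obtain ⟨c, hc0, hc⟩ := exists_norm_oscOp_le ℂ
  refine ⟨‖((1 / (4 * Real.pi ^ 2) : ℝ) : ℂ)‖ * (c * ∫ z, wt z),
    mul_nonneg (norm_nonneg _) (mul_nonneg hc0 (integral_nonneg wt_nonneg)), fun G C hG hC => ?_⟩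
  rw [J, norm_smul, mul_assoc]
  refine mul_le_mul_of_nonneg_left ?_ (norm_nonneg _)
  calc _ ≤ ∫ z, c * wt z * C := by
        refine norm_integral_le_of_norm_le ((integrable_wt.const_mul c).mul_const C)
          (Eventually.of_forall fun z => ?_)
        rw [norm_smul, norm_phase, one_mul]
        have := wt_nonneg z
        exact (hc G hG z).trans (mul_le_mul_of_nonneg_left (hC z) (by positivity))
    _ = _ := by rw [integral_mul_const, integral_const_mul]

/-- A plane wave times a function, composed with linear maps. -/
noncomputable def packet (f : Plane → ℂ) (ℓ m : PP →L[ℝ] Plane) (n : Plane →L[ℝ] Plane)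
    (a : Plane) (z : PP) : ℂ := pw a (ℓ z) * f (m z + n a)

theorem packet_cb {f : Plane → ℂ} (hf : Cb f) (ℓ m : PP →L[ℝ] Plane) (n : Plane →L[ℝ] Plane)
    (a : Plane) : Cb (packet f ℓ m n a) :=
  ((Cb.pw a).comp_clm ℓ).mul (hf.comp_affine m (n a))

/-- A derivative of the wave of frequency `2πp` costs at most `(1 + 2π‖ℓ‖)(1 + ‖p‖)`. The shift by
`n a` is harmless, since the derivatives of `f` are bounded uniformly on the plane. -/
theorem exists_jet_packet_le {f : Plane → ℂ} (hf : Cb f) (ℓ m : PP →L[ℝ] Plane)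
    (n : Plane →L[ℝ] Plane) : ∃ C, 0 ≤ C ∧ ∀ p z,
      jet 24 (packet f ℓ m n ((2 * Real.pi) • p)) z ≤ C * (1 + ‖p‖) ^ 24 := by
  obtain ⟨e, he, heB⟩ := exists_jet_bilin_le (V := PP) 24 (ContinuousLinearMap.mul ℝ ℂ)
  obtain ⟨D, hD0, hD⟩ := hf.exists_nonneg 24
  refine ⟨e * (1 + 2 * Real.pi * ‖ℓ‖) ^ 24 * (max 1 ‖m‖ ^ 24 * D), by positivity, fun p z => ?_⟩
  set a := (2 * Real.pi) • p with ha
  have h1 := heB ((contDiff_wave (innerSL ℝ a)).comp ℓ.contDiff)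
    (hf.1.comp (m.contDiff.add (contDiff_const (c := n a)))) z
  have h2 : jet 24 (wave (innerSL ℝ a) ∘ ℓ) z ≤ (1 + 2 * Real.pi * ‖ℓ‖) ^ 24 * (1 + ‖p‖) ^ 24 := by
    refine (jet_wave_le 24 ((innerSL ℝ a).comp ℓ) z).trans ?_
    rw [← mul_pow]
    refine pow_le_pow_left₀ (by positivity) ?_ _
    have h3 := ContinuousLinearMap.opNorm_comp_le (innerSL ℝ a) ℓ
    rw [innerSL_apply_norm, ha, norm_smul, Real.norm_of_nonneg (by positivity)] at h3
    rw [ha]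
    have h4 : 0 ≤ 2 * Real.pi * ‖ℓ‖ := by positivity
    have := norm_nonneg p
    nlinarith
  have h3 : jet 24 (f ∘ fun z => m z + n a) z ≤ max 1 ‖m‖ ^ 24 * D :=
    (jet_comp_le 24 m (n a) hf.1 z).trans (mul_le_mul_of_nonneg_left (hD _) (by positivity))
  have h5 := jet_nonneg 24 (f ∘ fun z => m z + n a) z
  calc _ ≤ _ := h1
    _ ≤ e * ((1 + 2 * Real.pi * ‖ℓ‖) ^ 24 * (1 + ‖p‖) ^ 24) * (max 1 ‖m‖ ^ 24 * D) := by
        gcongr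
    _ = _ := by ring

/-- For fixed `ε > 0` the cutoff makes the double integral absolutely convergent and Fubini applies.
The limit `ε → 0` is then taken under the integral over `p`: `exists_norm_J_le` and the uniform jets
of the rescaled cutoffs bound the integrand by a multiple of `‖h p‖ (1 + ‖p‖)^24`. -/
theorem J_superposition {h : Plane → ℂ} (hh : Continuous h)
    (hi : Integrable (fun p => ‖h p‖ * (1 + ‖p‖) ^ 24)) {f : Plane → ℂ} (hf : Cb f)
    (ℓ m : PP →L[ℝ] Plane) (n : Plane →L[ℝ] Plane) {G : PP → ℂ} (hG : Cb G)
    (hsum : ∀ z, G z = ∫ p, h p * packet f ℓ m n ((2 * Real.pi) • p) z) :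
    J G = ∫ p, h p * J (packet f ℓ m n ((2 * Real.pi) • p)) := by
  obtain ⟨χ, hχ⟩ := exists_isCutoff
  obtain ⟨C, hC0, hC⟩ := exists_jet_packet_le hf ℓ m n
  obtain ⟨c, hc0, hc⟩ := exists_norm_J_le
  obtain ⟨X, hX0, hX⟩ := hχ.cb.exists_nonneg 24
  obtain ⟨e, he, heB⟩ := exists_jet_bilin_le (V := PP) 24
    (ContinuousLinearMap.lsmul ℝ ℂ : ℂ →L[ℝ] ℂ →L[ℝ] ℂ)
  set P : Plane → PP → ℂ := fun p => packet f ℓ m n ((2 * Real.pi) • p)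
  have hPcb : ∀ p, Cb (P p) := fun p => packet_cb hf ℓ m n _
  have hPc : Continuous fun q : PP × Plane => P q.2 q.1 := by
    refine (continuous_pw_uncurry.comp (f := fun q : PP × Plane =>
      ((2 * Real.pi) • q.2, ℓ q.1)) (by fun_prop)).mul (hf.1.continuous.comp (by fun_prop))
  have hfub : ∀ ε : ℝ, 0 < ε →
      Integrable (fun q : PP × Plane => (phase q.1 * χ (ε • q.1)) • (h q.2 * P q.2 q.1))
        (volume.prod volume) := by
    intro ε hε
    have h1 : Integrable fun z => (phase z * χ (ε • z)) • (1 : ℂ) :=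
      integrable_cutoff_smul hχ continuous_const hε.ne'
    refine Integrable.mono' (h1.norm.mul_prod (hi.const_mul C)) ?_
      (Eventually.of_forall fun q => ?_)
    · refine Continuous.aestronglyMeasurable ?_
      have hk : Continuous fun q : PP × Plane => phase q.1 * χ (ε • q.1) :=
        (contDiff_phase.continuous.comp continuous_fst).mul
          (hχ.1.continuous.comp (continuous_fst.const_smul ε))
      exact hk.smul ((hh.comp continuous_snd).mul hPc)
    · rw [norm_smul, norm_mul (h q.2), smul_eq_mul, mul_one]
      have h2 := (norm_le_jet 24 (P q.2) q.1).trans (hC q.2 q.1)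
      have h3 := norm_nonneg (h q.2)
      calc _ ≤ ‖phase q.1 * χ (ε • q.1)‖ * (‖h q.2‖ * (C * (1 + ‖q.2‖) ^ 24)) := by gcongr
        _ = _ := by ring
  have hpt : ∀ (ε : ℝ) (p : Plane), ((1 / (4 * Real.pi ^ 2) : ℝ) : ℂ) •
      ∫ z, (phase z * χ (ε • z)) • (h p * P p z) =
      h p * oscInt χ (fun s s' => P p (s, s')) ε := by
    intro ε p
    have h3 : oscInt χ (fun s s' => P p (s, s')) ε = ((1 / (4 * Real.pi ^ 2) : ℝ) : ℂ) •
        ∫ z, (phase z * χ (ε • z)) • P p z := rfl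
    have h4 : ∀ z, (phase z * χ (ε • z)) • (h p * P p z) =
        h p * ((phase z * χ (ε • z)) • P p z) := fun z => by simp only [smul_eq_mul]; ring
    rw [h3, integral_congr_ae (Eventually.of_forall h4), integral_const_mul]
    simp only [smul_eq_mul]
    ring
  have hosc : ∀ ε : ℝ, 0 < ε → oscInt χ (fun s s' => G (s, s')) ε =
      ∫ p, h p * oscInt χ (fun s s' => P p (s, s')) ε := by
    intro ε hε
    have h1 : ∀ z : PP, (phase z * χ (ε • z)) • G z =
        ∫ p, (phase z * χ (ε • z)) • (h p * P p z) := fun z => by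
      rw [hsum, integral_smul]
    have h2 : oscInt χ (fun s s' => G (s, s')) ε = ((1 / (4 * Real.pi ^ 2) : ℝ) : ℂ) •
        ∫ z, (phase z * χ (ε • z)) • G z := rfl
    rw [h2]
    simp only [h1]
    rw [integral_integral_swap (hfub ε hε), ← integral_smul]
    congr 1
    ext p
    exact hpt ε p
  refine J_eq_of_tendsto hG hχ ?_
  have hlim : Tendsto (fun ε : ℝ => ∫ p, h p * oscInt χ (fun s s' => P p (s, s')) ε) (𝓝[>] 0)
      (𝓝 (∫ p, h p * J (P p))) := by
    have hev : ∀ᶠ ε in 𝓝[>] (0 : ℝ), 0 < ε ∧ ε ≤ 1 := by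
      filter_upwards [Ioc_mem_nhdsGT (zero_lt_one' ℝ)] with ε hε using hε
    refine tendsto_integral_filter_of_dominated_convergence
      (fun p => c * (e * X * C) * (‖h p‖ * (1 + ‖p‖) ^ 24)) ?_ ?_ (hi.const_mul _) ?_
    · refine hev.mono fun ε hε => ?_
      have h1 := ((hfub ε hε.1).integral_prod_right).aestronglyMeasurable
      have h2 := h1.const_smul ((1 / (4 * Real.pi ^ 2) : ℝ) : ℂ)
      refine h2.congr (Eventually.of_forall fun p => ?_)
      exact hpt ε p
    · refine hev.mono fun ε hε => Eventually.of_forall fun p => ?_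
      rw [norm_mul, oscInt_eq_J hχ (hPcb p).1 hε.1]
      have h1 : ‖J fun z => χ (ε • z) • P p z‖ ≤ c * (e * X * (C * (1 + ‖p‖) ^ 24)) := by
        refine hc _ _ ((hχ.1.comp (contDiff_const_smul ε)).smul (hPcb p).1) fun z => ?_
        have h2 := heB (hχ.1.comp (contDiff_const_smul ε)) (hPcb p).1 z
        have h3 : jet 24 (χ ∘ fun z => ε • z) z ≤ X :=
          (jet_comp_smul_le 24 hχ.1 hε z).trans (hX _)
        have h4 := hC p z
        have h5 := jet_nonneg 24 (P p) z
        calc _ ≤ _ := h2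
          _ ≤ _ := by gcongr
      calc _ ≤ ‖h p‖ * (c * (e * X * (C * (1 + ‖p‖) ^ 24))) := by gcongr
        _ = _ := by ring
    · exact Eventually.of_forall fun p => (hasOscInt_J (hPcb p) χ hχ).const_mul (h p)
  refine hlim.congr' ?_
  filter_upwards [self_mem_nhdsWithin] with ε hε
  exact (hosc ε hε).symm

end Composition

end WarpedDirac

namespace WarpedDirac

/-! ### Twisted products of functions on the plane -/

section Moyal

theorem pw_add (a x y : Plane) : pw a (x + y) = pw a x * pw a y := by
  rw [pw_apply, pw_apply, pw_apply, ← Complex.exp_add, inner_add_right]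
  congr 1
  push_cast
  ring

theorem pw_smul_Q (a s : Plane) (c : ℝ) : pw a (c • Q s) = pw (-(c • Q a)) s := by
  rw [pw_apply, pw_apply, inner_neg_left, inner_smul_left, inner_smul_right, inner_Q_left]
  simp

theorem pw_self_smul_Q (a : Plane) (c : ℝ) : pw a (c • Q a) = 1 := by
  rw [pw_apply, inner_smul_right, inner_self_Q]
  simp

/-- The twisted product of `f` and `g`, before restriction to the diagonal. -/
noncomputable def twist (lam : ℝ) (f g : Plane → ℂ) (v : PP) : ℂ :=
  J fun w : PP => f (v.1 + lam • Q w.1) * g (v.2 + w.2)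

/-- The first argument in the twisted product. -/
noncomputable def twistFst (lam : ℝ) : PP × PP →L[ℝ] Plane :=
  (ContinuousLinearMap.fst ℝ Plane Plane).comp (ContinuousLinearMap.fst ℝ PP PP) +
    lam • Qc.comp ((ContinuousLinearMap.fst ℝ Plane Plane).comp (ContinuousLinearMap.snd ℝ PP PP))

/-- The second argument in the twisted product. -/
noncomputable def twistSnd : PP × PP →L[ℝ] Plane :=
  (ContinuousLinearMap.snd ℝ Plane Plane).comp (ContinuousLinearMap.fst ℝ PP PP) +
    (ContinuousLinearMap.snd ℝ Plane Plane).comp (ContinuousLinearMap.snd ℝ PP PP)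

theorem cb_twist_integrand (lam : ℝ) {f g : Plane → ℂ} (hf : Cb f) (hg : Cb g) :
    Cb fun p : PP × PP => f (p.1.1 + lam • Q p.2.1) * g (p.1.2 + p.2.2) :=
  (hf.comp_clm (twistFst lam)).mul (hg.comp_clm twistSnd)

theorem cb_twist (lam : ℝ) {f g : Plane → ℂ} (hf : Cb f) (hg : Cb g) : Cb (twist lam f g) :=
  (cb_twist_integrand lam hf hg).J

theorem bTends_twist (lam : ℝ) {f g : Plane → ℂ} (hf : Cb f) {ι : Type*} {l : Filter ι}
    [l.IsCountablyGenerated] {gi : ι → Plane → ℂ} (hg : BTends l gi g)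
    (hcb : ∀ᶠ i in l, Cb (gi i)) : BTends l (fun i => twist lam f (gi i)) (twist lam f g) := by
  have h : BTends l (fun i (p : PP × PP) => f (p.1.1 + lam • Q p.2.1) * gi i (p.1.2 + p.2.2))
      (fun p => f (p.1.1 + lam • Q p.2.1) * g (p.1.2 + p.2.2)) := by
    have := (hg.comp_clm twistSnd).bilin (ContinuousLinearMap.mul ℝ ℂ) (hf.comp_clm (twistFst lam))
    simp only [ContinuousLinearMap.mul_apply', mul_comm (gi _ _), mul_comm (g _)] at this
    exact this
  exact h.J (hcb.mono fun i hi => cb_twist_integrand lam hf hi)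

variable {h : Plane → ℂ} (hh : Continuous h)
  (hi : Integrable (fun p => ‖h p‖ * (1 + ‖p‖) ^ 24)) {f g : Plane → ℂ} (hf : Cb f) (hg : Cb g)
  (hsup : ∀ y, g y = ∫ p, h p * pw ((2 * Real.pi) • p) y)

include hh hi hf hg hsup

/-- For a wave of frequency `a` as second factor, the integral over `w` sets `w.1 = a`
(`J_smul_pw`): the wave is evaluated at `v.2`, and the argument of `f` is shifted by `λQa`. -/
theorem twist_superposition (lam : ℝ) (v : PP) :
    twist lam f g v = ∫ p, h p * (pw ((2 * Real.pi) • p) v.2 *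
      f (v.1 + lam • Q ((2 * Real.pi) • p))) := by
  have hf' : Cb fun y => f (v.1 + y) := by
    simpa [add_comm] using hf.comp_affine (ContinuousLinearMap.id ℝ Plane) v.1
  have hpc : Continuous fun p : Plane => pw ((2 * Real.pi) • p) v.2 :=
    continuous_pw_uncurry.comp (f := fun p : Plane => ((2 * Real.pi) • p, v.2)) (by fun_prop)
  have hi' : Integrable fun p => ‖h p * pw ((2 * Real.pi) • p) v.2‖ * (1 + ‖p‖) ^ 24 := by
    simpa [pw, norm_wave] using hi
  have hG : Cb fun w : PP => f (v.1 + lam • Q w.1) * g (v.2 + w.2) :=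
    (cb_twist_integrand lam hf hg).slice_right v
  have hs : ∀ w : PP, f (v.1 + lam • Q w.1) * g (v.2 + w.2) =
      ∫ p, (h p * pw ((2 * Real.pi) • p) v.2) * packet (fun y => f (v.1 + y))
        (ContinuousLinearMap.snd ℝ Plane Plane)
        (lam • Qc.comp (ContinuousLinearMap.fst ℝ Plane Plane)) 0 ((2 * Real.pi) • p) w := by
    intro w
    rw [hsup, ← integral_const_mul]
    refine integral_congr_ae (Eventually.of_forall fun p => ?_)
    simp [packet, pw_add, Qc_apply]
    ring
  have key := J_superposition (hh.mul hpc) hi' hf' _ _ _ hG hs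
  refine key.trans (integral_congr_ae (Eventually.of_forall fun p => ?_))
  have hK : Cb fun t => f (v.1 + lam • Q t) := hf'.comp_clm (lam • Qc)
  have h1 := J_smul_pw ((2 * Real.pi) • p) hK
  have h2 : packet (fun y => f (v.1 + y)) (ContinuousLinearMap.snd ℝ Plane Plane)
      (lam • Qc.comp (ContinuousLinearMap.fst ℝ Plane Plane)) 0 ((2 * Real.pi) • p) =
      fun z : PP => pw ((2 * Real.pi) • p) z.2 • f (v.1 + lam • Q z.1) := by
    ext z
    simp [packet, Qc_apply]
  simp only [h2, Pi.mul_apply, mul_assoc]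
  rw [h1]

/-- For one frequency `a`, the wave at `z.2 - λQ z.1` factors into the wave of frequency `λQa` in
`z.1` and that of frequency `a` in `z.2`, so the integral sets `z.2 = λQa`. There the remaining wave
is `1`, as `a·Qa = 0`, and the evaluation point and the earlier shift add up to `2λQa`. -/
theorem J_twist_crossed_of_superposition (lam : ℝ) :
    J (fun z : PP => twist lam f g (z.2, z.2 - lam • Q z.1)) =
      ∫ p, h p * f ((2 * lam) • Q ((2 * Real.pi) • p)) := by
  have key := J_superposition hh hi hf
    (ContinuousLinearMap.snd ℝ Plane Plane - lam • Qc.comp (ContinuousLinearMap.fst ℝ Plane Plane))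
    (ContinuousLinearMap.snd ℝ Plane Plane) (lam • Qc)
    (G := fun z : PP => twist lam f g (z.2, z.2 - lam • Q z.1))
    ((cb_twist lam hf hg).comp_clm ((ContinuousLinearMap.snd ℝ Plane Plane).prod
      (ContinuousLinearMap.snd ℝ Plane Plane -
        lam • Qc.comp (ContinuousLinearMap.fst ℝ Plane Plane))))
    (fun z => twist_superposition hh hi hf hg hsup lam _)
  rw [key]
  refine integral_congr_ae (Eventually.of_forall fun p => congrArg (h p * ·) ?_)
  set a := (2 * Real.pi) • p
  have hK : Cb fun y => pw a y * f (y + lam • Q a) :=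
    (Cb.pw a).mul (hf.comp_affine (ContinuousLinearMap.id ℝ Plane) (lam • Q a))
  have h1 := J_pw_smul (lam • Q a) hK
  rw [pw_self_smul_Q, one_mul, ← add_smul, ← two_mul] at h1
  rw [← h1]
  refine congrArg J (funext fun z => ?_)
  have h2 : pw a (z.2 - lam • Q z.1) = pw (lam • Q a) z.1 * pw a z.2 := by
    rw [sub_eq_neg_add, pw_add, ← neg_smul, pw_smul_Q, neg_smul, neg_neg]
  simp [packet, Qc_apply, h2, mul_assoc]

/-- As a function of `z.2`, the wave of frequency `a` at `-cQ z.2` has frequency `cQa`, so `f` is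
evaluated at `cQa`. For `c = 2λ` this is the value found for the crossed twisted product. -/
theorem J_mul_dual_of_superposition (c : ℝ) :
    J (fun z : PP => f z.1 * g (-(c • Q z.2))) =
      ∫ p, h p * f (c • Q ((2 * Real.pi) • p)) := by
  have key := J_superposition hh hi hf
    (-(c • Qc.comp (ContinuousLinearMap.snd ℝ Plane Plane)))
    (ContinuousLinearMap.fst ℝ Plane Plane) 0
    (G := fun z : PP => f z.1 * g (-(c • Q z.2)))
    ((hf.comp_clm (ContinuousLinearMap.fst ℝ Plane Plane)).mul
      (hg.comp_clm (-(c • Qc.comp (ContinuousLinearMap.snd ℝ Plane Plane)))))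
    (fun z => by
      rw [hsup, ← integral_const_mul]
      congr 1
      ext p
      simp [packet, Qc_apply]
      ring)
  rw [key]
  refine integral_congr_ae (Eventually.of_forall fun p => congrArg (h p * ·) ?_)
  set a := (2 * Real.pi) • p
  rw [← J_smul_pw (c • Q a) hf]
  refine congrArg J (funext fun z => ?_)
  have h2 : pw a (-(c • Q z.2)) = pw (c • Q a) z.2 := by
    rw [← neg_smul, pw_smul_Q, neg_smul, neg_neg]
  simp [packet, Qc_apply, h2]

/-- After a shear the evaluation point is `z.2 = -λQa`, which cancels the shift of `f`. Every
frequency thus contributes `f 0`, and the integral over the frequencies reassembles `g 0`. -/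
theorem J_twist_nested_of_superposition (lam : ℝ) :
    J (fun z : PP => twist lam f g (z.2 - lam • Q z.1, z.2)) = f 0 * g 0 := by
  have key := J_superposition hh hi hf
    (ContinuousLinearMap.snd ℝ Plane Plane)
    (ContinuousLinearMap.snd ℝ Plane Plane - lam • Qc.comp (ContinuousLinearMap.fst ℝ Plane Plane))
    (lam • Qc)
    (G := fun z : PP => twist lam f g (z.2 - lam • Q z.1, z.2))
    ((cb_twist lam hf hg).comp_clm ((ContinuousLinearMap.snd ℝ Plane Plane -
        lam • Qc.comp (ContinuousLinearMap.fst ℝ Plane Plane)).prod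
      (ContinuousLinearMap.snd ℝ Plane Plane)))
    (fun z => twist_superposition hh hi hf hg hsup lam _)
  have h0 : ∀ p : Plane, J (packet f (ContinuousLinearMap.snd ℝ Plane Plane)
      (ContinuousLinearMap.snd ℝ Plane Plane -
        lam • Qc.comp (ContinuousLinearMap.fst ℝ Plane Plane))
      (lam • Qc) ((2 * Real.pi) • p)) = f 0 := by
    intro p
    set a := (2 * Real.pi) • p
    rw [← J_shear lam (packet_cb hf _ _ _ a)]
    have hK : Cb fun y => pw a y * f (y + lam • Q a) :=
      (Cb.pw a).mul (hf.comp_affine (ContinuousLinearMap.id ℝ Plane) (lam • Q a))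
    have h1 := J_pw_smul (-(lam • Q a)) hK
    rw [← neg_smul, pw_self_smul_Q, one_mul, neg_smul, neg_add_cancel] at h1
    rw [← h1]
    refine congrArg J (funext fun z => ?_)
    have h2 : pw a (z.2 + lam • Q z.1) = pw (-(lam • Q a)) z.1 * pw a z.2 := by
      rw [add_comm, pw_add, pw_smul_Q]
    simp [packet, Qc_apply, h2, mul_assoc]
  rw [key]
  simp only [h0]
  rw [integral_mul_const, mul_comm, hsup 0]
  simp [pw_apply]

omit hh hi hf hg hsup

/-- Functions with bounded derivatives are limits of superpositions of plane waves. -/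
theorem exists_bTends_superposition (hg : Cb g) : ∃ gi : ℝ → Plane → ℂ,
    BTends (𝓝[>] (0 : ℝ)) gi g ∧ ∀ᶠ ε in 𝓝[>] (0 : ℝ), Cb (gi ε) ∧
      ∃ h : Plane → ℂ, Continuous h ∧ Integrable (fun p => ‖h p‖ * (1 + ‖p‖) ^ 24) ∧
        ∀ y, gi ε y = ∫ p, h p * pw ((2 * Real.pi) • p) y := by
  obtain ⟨β, hβ, hc, h0⟩ := exists_bump
  have hβb := Cb.of_hasCompactSupport hβ hc
  refine ⟨_, bTends_cutoff_smul hβb h0 hg, ?_⟩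
  filter_upwards [self_mem_nhdsWithin] with ε hε
  have h1 : ContDiff ℝ ∞ fun y => β (ε • y) • g y := (hβ.comp (contDiff_const_smul ε)).smul hg.1
  have h2 : HasCompactSupport fun y => β (ε • y) • g y :=
    (hc.comp_smul (ne_of_gt hε)).smul_right
  obtain ⟨h, hh, hi, hs, _⟩ := exists_superposition h1 h2
  exact ⟨Cb.of_hasCompactSupport h1 h2, h, hh, hi, hs⟩

/-- A `Cb` function need not be an integrable superposition of waves, but its products with rescaled
bumps are. They converge to it in the sense of `BTends`, under which both sides are continuous in
`g`. -/
theorem J_twist_crossed (hf : Cb f) (hg : Cb g) (lam : ℝ) :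
    J (fun z : PP => twist lam f g (z.2, z.2 - lam • Q z.1)) =
      J (fun z : PP => f z.1 * g (-((2 * lam) • Q z.2))) := by
  obtain ⟨gi, hgi, hev⟩ := exists_bTends_superposition hg
  have h1 := tendsto_J ((bTends_twist lam hf hgi (hev.mono fun _ h => h.1)).comp_clm
    ((ContinuousLinearMap.snd ℝ Plane Plane).prod (ContinuousLinearMap.snd ℝ Plane Plane -
        lam • Qc.comp (ContinuousLinearMap.fst ℝ Plane Plane))))
  have h2 := tendsto_J ((hgi.comp_clm
    (-((2 * lam) • Qc.comp (ContinuousLinearMap.snd ℝ Plane Plane)))).bilin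
    (ContinuousLinearMap.mul ℝ ℂ) (hf.comp_clm (ContinuousLinearMap.fst ℝ Plane Plane)))
  simp only [ContinuousLinearMap.mul_apply', mul_comm (gi _ _), mul_comm (g _)] at h2
  refine tendsto_nhds_unique h1 (h2.congr' ?_)
  filter_upwards [hev] with ε hε
  obtain ⟨hcb, h, hh, hi, hs⟩ := hε
  exact (J_mul_dual_of_superposition hh hi hf hcb hs (2 * lam)).trans
    (J_twist_crossed_of_superposition hh hi hf hcb hs lam).symm

theorem J_twist_nested (hf : Cb f) (hg : Cb g) (lam : ℝ) :
    J (fun z : PP => twist lam f g (z.2 - lam • Q z.1, z.2)) = f 0 * g 0 := by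
  obtain ⟨gi, hgi, hev⟩ := exists_bTends_superposition hg
  have h1 := tendsto_J ((bTends_twist lam hf hgi (hev.mono fun _ h => h.1)).comp_clm
    ((ContinuousLinearMap.snd ℝ Plane Plane -
        lam • Qc.comp (ContinuousLinearMap.fst ℝ Plane Plane)).prod
      (ContinuousLinearMap.snd ℝ Plane Plane)))
  have h2 : Tendsto (fun ε => f 0 * gi ε 0) (𝓝[>] 0) (𝓝 (f 0 * g 0)) := by
    refine Tendsto.const_mul _ ?_
    rw [tendsto_iff_norm_sub_tendsto_zero]
    simpa only [jet_zero] using hgi.tends 0 0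
  refine tendsto_nhds_unique h1 (h2.congr' ?_)
  filter_upwards [hev] with ε hε
  obtain ⟨hcb, h, hh, hi, hs⟩ := hε
  exact (J_twist_nested_of_superposition hh hi hf hcb hs lam).symm

end Moyal

end WarpedDirac

namespace WarpedDirac

/-! ## The volume measure is locally finite -/

section Volume

variable {M : Type*} [TopologicalSpace M] [ChartedSpace R4 M] [IsManifold (𝓡 4) ∞ M]

theorem SpinSpacetime.linearIndependent_frame (X : SpinSpacetime M) (p : M) {v : Fin 4 → ℝ}
    (h : ∑ a, v a • X.e a p = 0) : v = 0 := by
  ext b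
  have h1 : X.g p (∑ a, v a • X.e a p) (X.e b p) = 0 := by rw [h]; simp
  simp only [map_sum, LinearMap.sum_apply, map_smul, LinearMap.smul_apply, X.orthonormal,
    smul_eq_mul, mul_ite, mul_zero, Finset.sum_ite_eq', Finset.mem_univ, if_true] at h1
  rcases mul_eq_zero.1 h1 with h2 | h2
  · exact h2
  · unfold eta at h2
    split_ifs at h2 <;> norm_num at h2

/-- The determinant of the frame in the chart at `x`. -/
noncomputable def SpinSpacetime.frameDet (X : SpinSpacetime M) (x p : M) : ℝ :=
  (Matrix.of fun i a : Fin 4 => X.frameCoord x a p i).det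

/-- An orthonormal frame is linearly independent, and the differential of a chart is invertible. -/
theorem SpinSpacetime.frameDet_ne_zero (X : SpinSpacetime M) {x p : M}
    (hp : p ∈ (chartAt R4 x).source) : X.frameDet x p ≠ 0 := by
  intro h0
  obtain ⟨v, hv, hv0⟩ := Matrix.exists_mulVec_eq_zero_iff.2 h0
  apply hv
  refine X.linearIndependent_frame p ?_
  have hinv : (mfderiv (𝓡 4) 𝓘(ℝ, R4) (extChartAt (𝓡 4) x) p).IsInvertible :=
    isInvertible_mfderiv_extChartAt (by simpa using hp)
  have hinj := hinv.injective
  apply hinj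
  rw [map_zero, map_sum]
  have h1 : ∀ a, mfderiv (𝓡 4) 𝓘(ℝ, R4) (extChartAt (𝓡 4) x) p (v a • X.e a p) =
      v a • X.frameCoord x a p := fun a => by rw [map_smul]; rfl
  simp only [h1]
  change (∑ a, v a • X.frameCoord x a p : R4) = 0
  ext i
  have h2 := congrFun hv0 i
  simp only [Matrix.mulVec, dotProduct, Matrix.of_apply, Pi.zero_apply] at h2
  have h3 : ((∑ a, v a • X.frameCoord x a p : R4)) i = 0 := by
    simp only [WithLp.ofLp_sum, WithLp.ofLp_smul, Finset.sum_apply, Pi.smul_apply, smul_eq_mul]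
    rw [← h2]
    exact Finset.sum_congr rfl fun a _ => mul_comm _ _
  exact h3

theorem SpinSpacetime.continuousOn_frameCoord (X : SpinSpacetime M) (x : M) (a : Fin 4) :
    ContinuousOn (X.frameCoord x a) (chartAt R4 x).source := by
  have h1 : ContinuousOn (fun p => (trivializationAt R4 (TangentSpace (𝓡 4) : M → Type) x
      ⟨p, X.e a p⟩).2) (chartAt R4 x).source := by
    refine continuous_snd.comp_continuousOn ?_
    refine (trivializationAt R4 (TangentSpace (𝓡 4) : M → Type) x).continuousOn.comp
      (X.smooth a).continuous.continuousOn ?_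
    intro p hp
    rw [Bundle.Trivialization.mem_source]
    simpa using hp
  refine h1.congr fun p hp => ?_
  have h2 := TangentBundle.continuousLinearMapAt_trivializationAt (I := 𝓡 4) hp
  have h3 := congrArg (fun L : TangentSpace (𝓡 4) p →L[ℝ] R4 => L (X.e a p)) h2
  have hb : p ∈ (trivializationAt R4 (TangentSpace (𝓡 4) : M → Type) x).baseSet := by
    simpa using hp
  refine Eq.trans h3.symm ?_
  change (trivializationAt R4 (TangentSpace (𝓡 4) : M → Type) x).linearMapAt ℝ p (X.e a p) = _
  rw [Bundle.Trivialization.coe_linearMapAt_of_mem _ hb]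

theorem SpinSpacetime.continuousOn_frameDet (X : SpinSpacetime M) (x : M) :
    ContinuousOn (X.frameDet x) (chartAt R4 x).source := by
  unfold SpinSpacetime.frameDet
  have : Continuous fun A : Matrix (Fin 4) (Fin 4) ℝ => A.det := continuous_id.matrix_det
  refine this.comp_continuousOn (f := fun p => Matrix.of fun i a => X.frameCoord x a p i) ?_
  refine continuousOn_pi.2 fun i => continuousOn_pi.2 fun a => ?_
  exact (EuclideanSpace.proj (𝕜 := ℝ) i).continuous.comp_continuousOn
    (X.continuousOn_frameCoord x a)

/-- The density is continuous in a chart, as the frame determinant does not vanish, hence bounded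
near each point. Local finiteness is what makes continuous compactly supported functions integrable
below. -/
theorem SpinSpacetime.IsVolume.isLocallyFiniteMeasure [MeasurableSpace M] [BorelSpace M]
    {X : SpinSpacetime M} {μ : Measure M} (hμ : X.IsVolume μ) : IsLocallyFiniteMeasure μ := by
  refine ⟨fun x => ?_⟩
  set φ := chartAt R4 x
  set D : R4 → ℝ := fun y => |X.frameDet x (φ.symm y)|⁻¹ with hD
  have hDc : ContinuousOn D φ.target := by
    refine ContinuousOn.inv₀ (ContinuousOn.abs ?_) fun y hy => ?_
    · exact (X.continuousOn_frameDet x).comp φ.continuousOn_symm fun y hy => φ.map_target hy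
    · exact abs_ne_zero.2 (X.frameDet_ne_zero (φ.map_target hy))
  have hx : φ x ∈ φ.target := φ.map_source (mem_chart_source R4 x)
  have hnhds : {y | D y < D (φ x) + 1} ∩ φ.target ∩ Metric.ball (φ x) 1 ∈ 𝓝 (φ x) := by
    refine inter_mem (inter_mem ?_ (φ.open_target.mem_nhds hx)) (Metric.ball_mem_nhds _ one_pos)
    exact (hDc.continuousAt (φ.open_target.mem_nhds hx)).eventually_lt
      continuousAt_const (by simp)
  obtain ⟨V, hVsub, hVo, hxV⟩ := mem_nhds_iff.1 hnhds
  have hopen : IsOpen (φ.source ∩ φ ⁻¹' V) := φ.isOpen_inter_preimage hVo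
  refine ⟨φ.source ∩ φ ⁻¹' V, hopen.mem_nhds ⟨mem_chart_source R4 x, hxV⟩, ?_⟩
  rw [hμ x _ hopen.measurableSet inter_subset_left]
  have himg : φ '' (φ.source ∩ φ ⁻¹' V) = V := by
    ext y
    constructor
    · rintro ⟨p, hp, rfl⟩
      exact hp.2
    · intro hy
      have hyt := (hVsub hy).1.2
      exact ⟨φ.symm y, ⟨φ.map_target hyt, by simpa [φ.right_inv hyt] using hy⟩, φ.right_inv hyt⟩
  rw [himg]
  calc _ ≤ ∫⁻ _ in V, ENNReal.ofReal (D (φ x) + 1) := by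
        refine setLIntegral_mono' hVo.measurableSet fun y hy => ?_
        exact ENNReal.ofReal_le_ofReal (le_of_lt (hVsub hy).1.1)
    _ = ENNReal.ofReal (D (φ x) + 1) * volume V := setLIntegral_const _ _
    _ < ⊤ := by
        refine ENNReal.mul_lt_top ENNReal.ofReal_lt_top ?_
        exact (measure_mono fun y hy => (hVsub hy).2).trans_lt measure_ball_lt_top

end Volume

/-! ## Differentiation of smooth families of functions -/

section Families

variable {M : Type*} [TopologicalSpace M] [ChartedSpace R4 M] [IsManifold (𝓡 4) ∞ M]
  {E : Type*} [NormedAddCommGroup E] [NormedSpace ℝ E]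

theorem hasDerivAt_family {Ψ : ℝ × M → E}
    (hΨ : ContMDiff (𝓘(ℝ, ℝ).prod (𝓡 4)) 𝓘(ℝ, E) ∞ Ψ) (t : ℝ) (p : M) :
    HasDerivAt (fun t => Ψ (t, p)) (deriv (fun t => Ψ (t, p)) t) t := by
  have h1 : ContMDiff 𝓘(ℝ, ℝ) 𝓘(ℝ, E) ∞ (fun t => Ψ (t, p)) :=
    hΨ.comp (contMDiff_id.prodMk contMDiff_const)
  exact (h1.contDiff.differentiable (by simp) t).hasDerivAt

/-- Ensures that the Lie derivative of a test section is again a smooth section, so that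
differentiation can be iterated. -/
theorem contMDiff_deriv_family {Ψ : ℝ × M → E}
    (hΨ : ContMDiff (𝓘(ℝ, ℝ).prod (𝓡 4)) 𝓘(ℝ, E) ∞ Ψ) :
    ContMDiff (𝓘(ℝ, ℝ).prod (𝓡 4)) 𝓘(ℝ, E) ∞
      (fun z : ℝ × M => deriv (fun t => Ψ (t, z.2)) z.1) := by
  intro z₀
  have h1 : ContMDiff ((𝓘(ℝ, ℝ).prod (𝓡 4)).prod 𝓘(ℝ, ℝ)) 𝓘(ℝ, E) ∞
      (Function.uncurry fun (z : ℝ × M) (t : ℝ) => Ψ (t, z.2)) :=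
    hΨ.comp (contMDiff_snd.prodMk (contMDiff_snd.comp contMDiff_fst))
  have h2 := ContMDiffAt.mfderiv (I := 𝓘(ℝ, ℝ)) (I' := 𝓘(ℝ, E)) (m := ∞)
    (fun (z : ℝ × M) (t : ℝ) => Ψ (t, z.2)) (fun z => z.1) (h1 (z₀, z₀.1))
    (contMDiff_fst z₀) (by simp)
  have e := inTangentCoordinates_model_space (I := 𝓘(ℝ, ℝ)) (I' := 𝓘(ℝ, E))
    (fun z : ℝ × M => z.1) (fun z => Ψ (z.1, z.2))
    (fun z : ℝ × M => (mfderiv 𝓘(ℝ, ℝ) 𝓘(ℝ, E) (fun t => Ψ (t, z.2)) z.1 : ℝ →L[ℝ] E)) z₀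
  replace h2 := (congrArg (fun T : ℝ × M → ℝ →L[ℝ] E =>
    ContMDiffAt (𝓘(ℝ, ℝ).prod (𝓡 4)) 𝓘(ℝ, ℝ →L[ℝ] E) ∞ T z₀) e).mp h2
  have h3 : ContMDiffAt (𝓘(ℝ, ℝ).prod (𝓡 4)) 𝓘(ℝ, E) ∞
      (fun z : ℝ × M => (mfderiv 𝓘(ℝ, ℝ) 𝓘(ℝ, E) (fun t => Ψ (t, z.2)) z.1 : ℝ →L[ℝ] E) 1) z₀ :=
    h2.clm_apply contMDiffAt_const
  refine h3.congr_of_eventuallyEq (Eventually.of_forall fun z => ?_)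
  simp only [mfderiv_eq_fderiv]
  rfl

/-- Differentiation under the integral sign for families with locally uniform compact supports. -/
theorem hasDerivAt_integral_of_compact [MeasurableSpace M] [BorelSpace M]
    [SecondCountableTopology M] {μ : Measure M} [IsFiniteMeasureOnCompacts μ] [T2Space M]
    {Θ Θ' : ℝ × M → ℂ}
    (hΘ : Continuous Θ) (hΘ' : Continuous Θ')
    (hd : ∀ t p, HasDerivAt (fun t => Θ (t, p)) (Θ' (t, p)) t) (t₀ : ℝ) {K : Set M}
    (hK : IsCompact K) (hs : ∀ t ∈ Metric.ball t₀ 1, ∀ p ∉ K, Θ (t, p) = 0) :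
    HasDerivAt (fun t => ∫ p, Θ (t, p) ∂μ) (∫ p, Θ' (t₀, p) ∂μ) t₀ := by
  -- For `p` outside `K` the family vanishes on a whole neighbourhood of `t`, so its `t`-derivative
  -- vanishes too.
  have hs' : ∀ t ∈ Metric.ball t₀ 1, ∀ p ∉ K, Θ' (t, p) = 0 := by
    intro t ht p hp
    have h1 : (fun t => Θ (t, p)) =ᶠ[𝓝 t] fun _ => 0 :=
      Filter.eventually_of_mem (Metric.isOpen_ball.mem_nhds ht) fun s hs0 => hs s hs0 p hp
    exact ((hd t p).congr_of_eventuallyEq h1.symm).unique (hasDerivAt_const t 0)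
  obtain ⟨C, hC⟩ := ((isCompact_closedBall t₀ 1).prod hK).exists_bound_of_continuousOn
    hΘ'.continuousOn
  have hint : ∀ {Ξ : M → ℂ}, Continuous Ξ → (∀ p ∉ K, Ξ p = 0) → Integrable Ξ μ :=
    fun hc h0 => hc.integrable_of_hasCompactSupport (HasCompactSupport.intro hK h0)
  have hslice : ∀ {Ξ : ℝ × M → ℂ} (t : ℝ), Continuous Ξ → Continuous fun p => Ξ (t, p) :=
    fun t hc => hc.comp (Continuous.prodMk_right t)
  have hmem : t₀ ∈ Metric.ball t₀ 1 := Metric.mem_ball_self one_pos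
  refine (hasDerivAt_integral_of_dominated_loc_of_deriv_le (s := Metric.ball t₀ 1)
    (F := fun t p => Θ (t, p)) (F' := fun t p => Θ' (t, p))
    (bound := K.indicator fun _ => C) (Metric.ball_mem_nhds _ one_pos) ?_ ?_ ?_ ?_ ?_ ?_).2
  · filter_upwards [Metric.ball_mem_nhds t₀ one_pos] with t ht
    exact (hint (hslice t hΘ) (hs t ht)).aestronglyMeasurable
  · exact hint (hslice t₀ hΘ) (hs t₀ hmem)
  · exact (hint (hslice t₀ hΘ') (hs' t₀ hmem)).aestronglyMeasurable
  · refine Eventually.of_forall fun p t ht => ?_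
    by_cases hp : p ∈ K
    · rw [indicator_of_mem hp]
      exact hC (t, p) ⟨Metric.ball_subset_closedBall ht, hp⟩
    · rw [indicator_of_notMem hp, hs' t ht p hp, norm_zero]
  · rw [integrable_indicator_iff hK.measurableSet]
    exact integrableOn_const hK.measure_lt_top.ne
  · exact Eventually.of_forall fun p t _ => hd t p

end Families

end WarpedDirac

namespace WarpedDirac

/-! ## The spin representation -/

section SpinRep

theorem blocks_mul (P Q R S P' Q' R' S' : Matrix (Fin 2) (Fin 2) ℂ) :
    blocks P Q R S * blocks P' Q' R' S' =
      blocks (P * P' + Q * R') (P * Q' + Q * S') (R * P' + S * R') (R * Q' + S * S') := by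
  simp only [blocks, Matrix.reindex_apply]
  rw [Matrix.submatrix_mul_equiv, Matrix.fromBlocks_multiply]

theorem blocks_one : blocks 1 0 0 1 = 1 := by
  simp [blocks, Matrix.fromBlocks_one]

theorem smul_blocks (c : ℂ) (P Q R S : Matrix (Fin 2) (Fin 2) ℂ) :
    c • blocks P Q R S = blocks (c • P) (c • Q) (c • R) (c • S) := by
  simp only [blocks, Matrix.reindex_apply, ← Matrix.fromBlocks_smul]
  rfl

theorem spinRep_one : spinRep 1 = 1 := by
  simp only [spinRep, inv_one, Matrix.SpecialLinearGroup.coe_one, Matrix.conjTranspose_one,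
    sub_self, smul_blocks, smul_zero]
  rw [← blocks_one]
  have : (2⁻¹ : ℂ) • (1 + 1 : Matrix (Fin 2) (Fin 2) ℂ) = 1 := by
    rw [← two_smul ℂ, smul_smul]; norm_num
  rw [this]

theorem spinRep_mul (L L' : SL2C) : spinRep (L * L') = spinRep L * spinRep L' := by
  simp only [spinRep, mul_inv_rev, Matrix.SpecialLinearGroup.coe_mul, Matrix.conjTranspose_mul]
  rw [Matrix.smul_mul, Matrix.mul_smul, blocks_mul, smul_smul, smul_blocks, smul_blocks]
  congr 1
  all_goals
    simp only [Matrix.add_mul, Matrix.mul_add, Matrix.sub_mul, Matrix.mul_sub]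
    module

theorem beta_mul_beta : beta * beta = 1 := by
  simp [beta, gammaLow, blocks_mul, blocks_one]

theorem beta_inv : beta⁻¹ = beta := Matrix.inv_eq_left_inv beta_mul_beta

theorem beta_conjTranspose : betaᴴ = beta := by
  simp [beta, gammaLow, blocks, Matrix.conjTranspose_submatrix, Matrix.fromBlocks_conjTranspose]

/-- The spin representation as a function of the entries of the matrix. -/
noncomputable def spinEntries (A : Fin 2 → Fin 2 → ℂ) : Matrix (Fin 4) (Fin 4) ℂ :=
  (2⁻¹ : ℂ) • blocks ((Matrix.adjugate (Matrix.of A))ᴴ + Matrix.of A)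
    ((Matrix.adjugate (Matrix.of A))ᴴ - Matrix.of A)
    ((Matrix.adjugate (Matrix.of A))ᴴ - Matrix.of A)
    ((Matrix.adjugate (Matrix.of A))ᴴ + Matrix.of A)

/-- In `SL(2, ℂ)` the inverse is the adjugate, so `spinRep` extends to a smooth function of
arbitrary matrix entries. Smoothness of the flow cocycles then follows by composition. -/
theorem spinRep_eq_spinEntries (L : SL2C) :
    spinRep L = spinEntries fun i j => (L : Matrix (Fin 2) (Fin 2) ℂ) i j := by
  simp only [spinRep, spinEntries, Matrix.SpecialLinearGroup.coe_inv]
  rfl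

theorem contDiff_entry (i j : Fin 2) : ContDiff ℝ ∞ fun A : Fin 2 → Fin 2 → ℂ => A i j := by
  fun_prop

theorem contDiff_adjugate_entry (i j : Fin 2) :
    ContDiff ℝ ∞ fun A : Fin 2 → Fin 2 → ℂ => (Matrix.adjugate (Matrix.of A)) i j := by
  simp only [Matrix.adjugate_fin_two]
  fin_cases i <;> fin_cases j <;> simp <;> fun_prop

theorem contDiff_spinEntries (i j : Fin 4) :
    ContDiff ℝ ∞ fun A : Fin 2 → Fin 2 → ℂ => spinEntries A i j := by
  have hadj : ∀ i j : Fin 2, ContDiff ℝ ∞ fun A : Fin 2 → Fin 2 → ℂ =>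
      (Matrix.adjugate (Matrix.of A))ᴴ i j := fun i j =>
    Complex.conjCLE.contDiff.comp (contDiff_adjugate_entry j i)
  simp only [spinEntries, blocks, Matrix.smul_apply, Matrix.reindex_apply, Matrix.submatrix_apply,
    smul_eq_mul]
  refine contDiff_const.mul ?_
  generalize (finSumFinEquiv (m := 2) (n := 2)).symm i = i₀
  generalize (finSumFinEquiv (m := 2) (n := 2)).symm j = j₀
  rcases i₀ with i₀ | i₀ <;> rcases j₀ with j₀ | j₀ <;>
    simp only [Matrix.fromBlocks_apply₁₁, Matrix.fromBlocks_apply₁₂, Matrix.fromBlocks_apply₂₁,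
      Matrix.fromBlocks_apply₂₂, Matrix.add_apply, Matrix.sub_apply, Matrix.of_apply] <;>
    first
      | exact (hadj _ _).add (contDiff_entry _ _)
      | exact (hadj _ _).sub (contDiff_entry _ _)

end SpinRep

/-! ## The action of the flow on test sections -/

section FlowAction

variable {M : Type*} [TopologicalSpace M] [ChartedSpace R4 M] [IsManifold (𝓡 4) ∞ M]
  {X : SpinSpacetime M} {ξ : KillingPair X}

/-- A smooth cocycle of matrices over the flow of a Killing pair. -/
structure FlowMat (ξ : KillingPair X) where
  R : Plane → M → Matrix (Fin 4) (Fin 4) ℂ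
  smooth : ∀ i j, ContMDiff (𝓘(ℝ, Plane).prod (𝓡 4)) 𝓘(ℝ, ℂ) ∞
    (fun z : Plane × M => R z.1 z.2 i j)
  zero : ∀ p, R 0 p = 1
  add : ∀ s t p, R (s + t) p = R s p * R t (ξ.flow (-s) p)

/-- The action of the flow on sections which is defined by a cocycle. -/
def FlowMat.act (A : FlowMat ξ) (s : Plane) (f : M → Fin 4 → ℂ) (p : M) : Fin 4 → ℂ :=
  A.R s p *ᵥ f (ξ.flow (-s) p)

theorem FlowMat.act_zero (A : FlowMat ξ) (f : M → Fin 4 → ℂ) (p : M) : A.act 0 f p = f p := by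
  simp [FlowMat.act, A.zero, ξ.flow_zero]

theorem FlowMat.act_add (A : FlowMat ξ) (s t : Plane) (f : M → Fin 4 → ℂ) (p : M) :
    A.act (s + t) f p = A.R s p *ᵥ A.act t f (ξ.flow (-s) p) := by
  simp only [FlowMat.act, A.add, Matrix.mulVec_mulVec, ← ξ.flow_add]
  rw [neg_add, add_comm (-s)]

theorem FlowMat.contMDiff_act (A : FlowMat ξ) {f : M → Fin 4 → ℂ}
    (hf : ContMDiff (𝓡 4) 𝓘(ℝ, Fin 4 → ℂ) ∞ f) :
    ContMDiff (𝓘(ℝ, Plane).prod (𝓡 4)) 𝓘(ℝ, Fin 4 → ℂ) ∞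
      (fun z : Plane × M => A.act z.1 f z.2) := by
  have hneg : ContMDiff (𝓘(ℝ, Plane).prod (𝓡 4)) (𝓡 4) ∞
      (fun z : Plane × M => ξ.flow (-z.1) z.2) :=
    ξ.smooth.comp ((contDiff_neg.contMDiff.comp contMDiff_fst).prodMk contMDiff_snd)
  have hcomp := hf.comp hneg
  rw [contMDiff_pi_space] at hcomp ⊢
  intro i
  have hS : ContDiff ℝ ∞ (fun v : (Fin 4 → ℂ) × (Fin 4 → ℂ) => ∑ j, v.1 j * v.2 j) := by
    fun_prop
  have hR : ContMDiff (𝓘(ℝ, Plane).prod (𝓡 4)) 𝓘(ℝ, Fin 4 → ℂ) ∞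
      (fun z : Plane × M => fun j => A.R z.1 z.2 i j) :=
    contMDiff_pi_space.2 fun j => A.smooth i j
  exact hS.contMDiff.comp (hR.prodMk_space (contMDiff_pi_space.2 hcomp))

/-- The coordinate vectors of the plane. -/
noncomputable def dirE (i : Fin 2) : Plane := EuclideanSpace.single i 1

theorem FlowMat.contMDiff_act_line (A : FlowMat ξ) (i : Fin 2) {f : M → Fin 4 → ℂ}
    (hf : ContMDiff (𝓡 4) 𝓘(ℝ, Fin 4 → ℂ) ∞ f) :
    ContMDiff (𝓘(ℝ, ℝ).prod (𝓡 4)) 𝓘(ℝ, Fin 4 → ℂ) ∞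
      (fun z : ℝ × M => A.act (z.1 • dirE i) f z.2) := by
  have h1 : ContDiff ℝ ∞ fun t : ℝ => t • dirE i := contDiff_id.smul contDiff_const
  exact (A.contMDiff_act hf).comp ((h1.contMDiff.comp contMDiff_fst).prodMk contMDiff_snd)

/-- The Lie derivative of a test section along the `i`-th Killing field. -/
noncomputable def FlowMat.lie [T2Space M] (A : FlowMat ξ) (i : Fin 2) (f : testSections M) : testSections M :=
  ⟨fun p => deriv (fun t : ℝ => A.act (t • dirE i) f p) 0, by
    refine ⟨(contMDiff_deriv_family (A.contMDiff_act_line i f.2.1)).comp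
      (contMDiff_const.prodMk contMDiff_id), HasCompactSupport.intro f.2.2 fun p hp => ?_⟩
    have hcont : Continuous fun t : ℝ => ξ.flow (-(t • dirE i)) p :=
      ξ.smooth.continuous.comp (f := fun t : ℝ => (-(t • dirE i), p)) (by fun_prop)
    have hopen : IsOpen (tsupport (f : M → Fin 4 → ℂ))ᶜ := (isClosed_tsupport _).isOpen_compl
    have h1 : (fun t : ℝ => A.act (t • dirE i) f p) =ᶠ[𝓝 0] fun _ => 0 := by
      filter_upwards [hcont.continuousAt.preimage_mem_nhds
        (hopen.mem_nhds (by simpa [ξ.flow_zero] using hp))] with t ht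
      simp [FlowMat.act, image_eq_zero_of_notMem_tsupport ht]
    rw [h1.deriv_eq]
    simp⟩

/-- By the cocycle law, the action at time `t` is a fixed matrix applied to the action at time `t -
t₀` at the point carried back by the flow. This reduces everything to time zero, where the
derivative is `lie` by definition. -/
theorem FlowMat.hasDerivAt_act [T2Space M] (A : FlowMat ξ) (i : Fin 2) (f : testSections M) (t₀ : ℝ) (p : M) :
    HasDerivAt (fun t : ℝ => A.act (t • dirE i) f p) (A.act (t₀ • dirE i) (A.lie i f) p) t₀ := by
  set q := ξ.flow (-(t₀ • dirE i)) p
  let L : (Fin 4 → ℂ) →L[ℝ] (Fin 4 → ℂ) :=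
    LinearMap.toContinuousLinearMap ((Matrix.mulVecLin (A.R (t₀ • dirE i) p)).restrictScalars ℝ)
  have h1 := hasDerivAt_family (A.contMDiff_act_line i f.2.1) 0 q
  have h2 : HasDerivAt (fun t : ℝ => A.act ((t - t₀) • dirE i) f q)
      ((A.lie i f : M → Fin 4 → ℂ) q) t₀ := by
    have h3 := h1
    rw [← sub_self t₀] at h3
    have h4 := h3.comp_sub_const t₀ t₀
    rw [sub_self] at h4
    exact h4
  have h5 := L.hasFDerivAt.comp_hasDerivAt t₀ h2
  refine (h5.congr_of_eventuallyEq (Eventually.of_forall fun t => ?_))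
  have h6 : t • dirE i = t₀ • dirE i + (t - t₀) • dirE i := by rw [← add_smul]; congr 1; ring
  change A.act (t • dirE i) f p = A.R (t₀ • dirE i) p *ᵥ A.act ((t - t₀) • dirE i) f q
  rw [h6, A.act_add]

/-- Only real homogeneity of `b` in its first argument is asked for, since the form is antilinear
there. For `t` near `t₀` all supports lie in the image under the flow of a compact set. -/
theorem FlowMat.hasDerivAt_integral_act [T2Space M] [SecondCountableTopology M]
    [MeasurableSpace M] [BorelSpace M]
    {μ : Measure M} [IsFiniteMeasureOnCompacts μ] (A : FlowMat ξ) (i : Fin 2)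
    (f : testSections M) {k : M → Fin 4 → ℂ} (hk : Continuous k)
    {b : (Fin 4 → ℂ) → (Fin 4 → ℂ) → ℂ} (hb : Continuous fun v : (Fin 4 → ℂ) × (Fin 4 → ℂ) => b v.1 v.2)
    (hadd : ∀ v v' w, b (v + v') w = b v w + b v' w) (hsmul : ∀ (c : ℝ) v w, b (c • v) w = c • b v w)
    (t₀ : ℝ) :
    HasDerivAt (fun t : ℝ => ∫ p, b (A.act (t • dirE i) f p) (k p) ∂μ)
      (∫ p, b (A.act (t₀ • dirE i) (A.lie i f) p) (k p) ∂μ) t₀ := by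
  have hc : ∀ f : testSections M, Continuous fun z : ℝ × M => b (A.act (z.1 • dirE i) f z.2) (k z.2) :=
    fun f => hb.comp ((A.contMDiff_act_line i f.2.1).continuous.prodMk (hk.comp continuous_snd))
  have hflow : Continuous fun z : ℝ × M => ξ.flow (z.1 • dirE i) z.2 :=
    ξ.smooth.continuous.comp (f := fun z : ℝ × M => (z.1 • dirE i, z.2)) (by fun_prop)
  have hb0 : ∀ w, b 0 w = 0 := fun w => by simpa using hsmul 0 0 w
  refine hasDerivAt_integral_of_compact (hc f) (hc (A.lie i f)) (fun t p => ?_) t₀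
    (((isCompact_closedBall t₀ 1).prod f.2.2.isCompact).image hflow) (fun t ht p hp => ?_)
  · let L : (Fin 4 → ℂ) →L[ℝ] ℂ :=
      { toFun := fun v => b v (k p)
        map_add' := fun v v' => hadd v v' _
        map_smul' := fun c v => hsmul c v _
        cont := hb.comp (continuous_id.prodMk continuous_const) }
    exact L.hasFDerivAt.comp_hasDerivAt t (A.hasDerivAt_act i f t p)
  · have h1 : ξ.flow (-(t • dirE i)) p ∉ tsupport (f : M → Fin 4 → ℂ) := by
      intro h2
      refine hp ⟨(t, ξ.flow (-(t • dirE i)) p), ⟨Metric.ball_subset_closedBall ht, h2⟩, ?_⟩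
      simp [← ξ.flow_add, ξ.flow_zero]
    have h2 : A.act (t • dirE i) f p = 0 := by
      simp [FlowMat.act, image_eq_zero_of_notMem_tsupport h1]
    simp only [h2, hb0]

variable (φ : SpinFlow ξ)

/-- The cocycle of the flow on spinors. -/
noncomputable def SpinFlow.spinMat : FlowMat ξ where
  R s p := spinRep ((φ.lift s).L p)
  smooth i j := by
    simp only [spinRep_eq_spinEntries]
    exact (contDiff_spinEntries i j).contMDiff.comp
      (contMDiff_pi_space.2 fun i => contMDiff_pi_space.2 fun j => φ.smooth i j)
  zero p := by rw [φ.lift_zero, spinRep_one]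
  add s t p := by rw [φ.lift_add, spinRep_mul]

/-- The cocycle of the flow on cospinors. -/
noncomputable def SpinFlow.cospinMat : FlowMat ξ where
  R s p := (spinRep ((φ.lift s).L p)⁻¹)ᵀ
  smooth i j := by
    have h : ∀ L : SL2C, (spinRep L⁻¹)ᵀ i j =
        spinEntries (fun i j => Matrix.adjugate (Matrix.of fun i j =>
          (L : Matrix (Fin 2) (Fin 2) ℂ) i j) i j) j i := fun L => by
      rw [Matrix.transpose_apply, spinRep_eq_spinEntries, Matrix.SpecialLinearGroup.coe_inv]
      rfl
    simp only [h]
    have h2 : ContDiff ℝ ∞ fun A : Fin 2 → Fin 2 → ℂ =>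
        spinEntries (fun i j => Matrix.adjugate (Matrix.of A) i j) j i :=
      (contDiff_spinEntries j i).comp
        (contDiff_pi.2 fun i => contDiff_pi.2 fun j => contDiff_adjugate_entry i j)
    exact h2.contMDiff.comp
      (contMDiff_pi_space.2 fun i => contMDiff_pi_space.2 fun j => φ.smooth i j)
  zero p := by rw [φ.lift_zero, inv_one, spinRep_one, Matrix.transpose_one]
  add s t p := by rw [φ.lift_add, mul_inv_rev, spinRep_mul, Matrix.transpose_mul]

theorem SpinFlow.symm_apply (s : Plane) (p : M) : (φ.lift s).h.symm p = ξ.flow (-s) p := by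
  rw [Equiv.symm_apply_eq, φ.lift_h, ← ξ.flow_add, add_neg_cancel, ξ.flow_zero]

theorem SpinFlow.actSpinor_apply (s : Plane) (f : testSections M) (p : M) :
    ((φ.lift s).actSpinor f : M → Fin 4 → ℂ) p = φ.spinMat.act s f p := by
  change spinRep ((φ.lift s).L p) *ᵥ (f : M → Fin 4 → ℂ) ((φ.lift s).h.symm p) = _
  rw [φ.symm_apply]
  rfl

theorem SpinFlow.actCospinor_apply (s : Plane) (f : testSections M) (p : M) :
    ((φ.lift s).actCospinor f : M → Fin 4 → ℂ) p = φ.cospinMat.act s f p := by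
  change (f : M → Fin 4 → ℂ) ((φ.lift s).h.symm p) ᵥ* spinRep ((φ.lift s).L p)⁻¹ = _
  rw [φ.symm_apply, ← Matrix.mulVec_transpose]
  rfl

theorem SpinFlow.u_zero (f : Test M) : (φ.lift 0).u f = f := by
  refine Prod.ext (Subtype.ext (funext fun p => ?_)) (Subtype.ext (funext fun p => ?_))
  · exact (φ.actSpinor_apply 0 f.1 p).trans (FlowMat.act_zero _ _ _)
  · exact (φ.actCospinor_apply 0 f.2 p).trans (FlowMat.act_zero _ _ _)

theorem SpinFlow.u_add (s t : Plane) (f : Test M) :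
    (φ.lift (s + t)).u f = (φ.lift s).u ((φ.lift t).u f) := by
  refine Prod.ext (Subtype.ext (funext fun p => ?_)) (Subtype.ext (funext fun p => ?_))
  · refine (φ.actSpinor_apply (s + t) f.1 p).trans ?_
    refine Eq.trans ?_ (φ.actSpinor_apply s ((φ.lift t).actSpinor f.1) p).symm
    rw [FlowMat.act_add]
    change _ = φ.spinMat.R s p *ᵥ ((φ.lift t).actSpinor f.1 : M → Fin 4 → ℂ) (ξ.flow (-s) p)
    rw [φ.actSpinor_apply]
  · refine (φ.actCospinor_apply (s + t) f.2 p).trans ?_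
    refine Eq.trans ?_ (φ.actCospinor_apply s ((φ.lift t).actCospinor f.2) p).symm
    rw [FlowMat.act_add]
    change _ = φ.cospinMat.R s p *ᵥ ((φ.lift t).actCospinor f.2 : M → Fin 4 → ℂ) (ξ.flow (-s) p)
    rw [φ.actCospinor_apply]

/-- The Lie derivative of an element of `𝒟` along the `i`-th Killing field. -/
noncomputable def SpinFlow.lie [T2Space M] (i : Fin 2) (f : Test M) : Test M :=
  (φ.spinMat.lie i f.1, φ.cospinMat.lie i f.2)

/-- The only analytic input from the geometry: differentiability of the form along each axis.
Smoothness in norm is extracted from it by the anticommutation relations. -/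
theorem SpinFlow.hasDerivAt_form [T2Space M] [SecondCountableTopology M] [MeasurableSpace M]
    [BorelSpace M] {μ : Measure M} [IsFiniteMeasureOnCompacts μ] {m : ℝ}
    (G : FundamentalSolutions X m) (i : Fin 2) (f h : Test M) (t₀ : ℝ) :
    HasDerivAt (fun t : ℝ => G.form μ ((φ.lift (t • dirE i)).u f) h)
      (G.form μ ((φ.lift (t₀ • dirE i)).u (φ.lie i f)) h) t₀ := by
  have hk1 : Continuous (G.S h.1 : M → Fin 4 → ℂ) := (G.S h.1).2.continuous
  have hk2 : Continuous (G.coS h.2 : M → Fin 4 → ℂ) := (G.coS h.2).2.continuous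
  have h1 := φ.spinMat.hasDerivAt_integral_act (μ := μ) i f.1 hk1
    (b := fun v w => (star v ᵥ* beta) ⬝ᵥ w)
    (((continuous_star.comp continuous_fst).matrix_vecMul continuous_const).dotProduct
      continuous_snd)
    (fun v v' w => by rw [star_add, Matrix.add_vecMul, add_dotProduct])
    (fun c v w => by rw [star_smul, Matrix.smul_vecMul, smul_dotProduct, star_trivial]) t₀
  have h2 := φ.cospinMat.hasDerivAt_integral_act (μ := μ) i f.2 hk2
    (b := fun v w => w ⬝ᵥ (beta⁻¹ *ᵥ star v))
    (continuous_snd.dotProduct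
      (continuous_const.matrix_mulVec (continuous_star.comp continuous_fst)))
    (fun v v' w => by rw [star_add, Matrix.mulVec_add, dotProduct_add])
    (fun c v w => by rw [star_smul, Matrix.mulVec_smul, dotProduct_smul, star_trivial]) t₀
  have h3 := (h1.const_mul (-Complex.I)).add (h2.const_mul Complex.I)
  simp only [← φ.actSpinor_apply, ← φ.actCospinor_apply] at h3
  exact h3

theorem conj_conj (f : Test M) : conj (conj f) = f := by
  refine Prod.ext (Subtype.ext (funext fun p => ?_)) (Subtype.ext (funext fun p => ?_))
  · change beta⁻¹ *ᵥ star (star ((f.1 : M → Fin 4 → ℂ) p) ᵥ* beta) = _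
    rw [Matrix.star_vecMul, star_star, beta_conjTranspose, beta_inv, Matrix.mulVec_mulVec,
      beta_mul_beta, Matrix.one_mulVec]
  · change star (beta⁻¹ *ᵥ star ((f.2 : M → Fin 4 → ℂ) p)) ᵥ* beta = _
    rw [Matrix.star_mulVec, star_star, beta_inv, beta_conjTranspose, Matrix.vecMul_vecMul,
      beta_mul_beta, Matrix.vecMul_one]

end FlowAction

end WarpedDirac

namespace WarpedDirac

/-! ## Covariant fields -/

section Covariant

/-- A smooth function whose translates differ from it by linear isometries is bounded together with
all its derivatives. -/
theorem Cb.of_isometric_translates {V F : Type*} [NormedAddCommGroup V] [NormedSpace ℝ V]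
    [NormedAddCommGroup F] [NormedSpace ℝ F] {G : V → F} (hG : ContDiff ℝ ∞ G)
    (α : V → F →ₗᵢ[ℝ] F) (h : ∀ s v, G (s + v) = α s (G v)) : Cb G := by
  refine ⟨hG, fun n => ⟨jet n G 0, fun s => le_of_eq ?_⟩⟩
  unfold jet
  refine Finset.sum_congr rfl fun m _ => ?_
  have h1 := iteratedFDeriv_comp_add_left (𝕜 := ℝ) (f := G) m s 0
  rw [add_zero] at h1
  have h2 : (fun v => G (s + v)) = α s ∘ G := funext fun v => h s v
  rw [← h1, h2]
  exact (α s).norm_iteratedFDeriv_comp_left (n := (∞ : ℕ∞ω)) hG.contDiffAt (mod_cast le_top)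

variable {V : Type*} [AddCommGroup V] [Module ℂ V]
variable {H : Type*} [NormedAddCommGroup H] [InnerProductSpace ℂ H] [CompleteSpace H]

/-- A linear family `b` of operators which is covariant under the action `T` of the plane on the
labels and its unitary representation `W`. -/
structure IsCovariant (b : V →ₗ[ℂ] (H →L[ℂ] H)) (T : Plane → V → V) (W : Plane → H ≃ₗᵢ[ℂ] H) :
    Prop where
  zero : ∀ ψ, W 0 ψ = ψ
  add : ∀ s t ψ, W (s + t) ψ = W s (W t ψ)
  cov : ∀ s f ψ, W s (b f ψ) = b (T s f) (W s ψ)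
  action_add : ∀ s t f, T (s + t) f = T s (T t f)

/-- Canonical anticommutation relations with the form `S`, for which the action `T` is weakly
differentiable with generators `D 0` and `D 1`. -/
structure IsDifferentiableCAR (b : V →ₗ[ℂ] (H →L[ℂ] H)) (T : Plane → V → V) (S : V → V → ℂ)
    (D : Fin 2 → V → V) : Prop where
  anticomm : ∀ f h, star (b f) * b h + b h * star (b f) = S f h • 1
  hasDerivAt : ∀ i f h (t : ℝ), HasDerivAt (fun t : ℝ => S (T (t • dirE i) f) h)
    (S (T (t • dirE i) (D i f)) h) t

/-- Conjugation with a unitary operator. -/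
noncomputable def conjIsometry (e : H ≃ₗᵢ[ℂ] H) : (H →L[ℂ] H) →ₗᵢ[ℂ] (H →L[ℂ] H) where
  toFun A := e.toLinearIsometry.toContinuousLinearMap ∘L (A ∘L (e.symm : H →L[ℂ] H))
  map_add' A A' := by ext; simp
  map_smul' c A := by ext; simp
  norm_map' A := by
    change ‖e.toLinearIsometry.toContinuousLinearMap ∘L (A ∘L (e.symm : H →L[ℂ] H))‖ = _
    rw [LinearIsometry.norm_toContinuousLinearMap_comp]
    exact ContinuousLinearMap.opNorm_comp_linearIsometryEquiv A e.symm

theorem conjIsometry_apply (e : H ≃ₗᵢ[ℂ] H) (A : H →L[ℂ] H) (ψ : H) :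
    conjIsometry e A ψ = e (A (e.symm ψ)) := rfl

variable {b : V →ₗ[ℂ] (H →L[ℂ] H)} {T : Plane → V → V} {W : Plane → H ≃ₗᵢ[ℂ] H}
  {S : V → V → ℂ} {D : Fin 2 → V → V}

theorem IsCovariant.apply_action (hc : IsCovariant b T W) (s : Plane) (f : V) :
    b (T s f) = conjIsometry (W s) (b f) := by
  ext ψ
  rw [conjIsometry_apply, hc.cov, LinearIsometryEquiv.apply_symm_apply]

theorem IsCovariant.norm_action (hc : IsCovariant b T W) (s : Plane) (f : V) :
    ‖b (T s f)‖ = ‖b f‖ := by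
  rw [hc.apply_action, LinearIsometry.norm_map]

theorem IsCovariant.action_zero (hc : IsCovariant b T W) (f : V) : b (T 0 f) = b f := by
  ext ψ
  rw [← hc.zero (b f ψ), hc.cov, hc.zero]

/-- The derivative at the origin of the orbit of a field operator. -/
noncomputable def orbitDeriv (b : V →ₗ[ℂ] (H →L[ℂ] H)) (D : Fin 2 → V → V)
    (f : V) : Plane →L[ℝ] (H →L[ℂ] H) :=
  ∑ i, (EuclideanSpace.proj i : Plane →L[ℝ] ℝ).smulRight (b (D i f))

theorem orbitDeriv_apply (f : V) (v : Plane) : orbitDeriv b D f v = ∑ i, v i • b (D i f) := by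
  simp [orbitDeriv]

theorem eq_sum_dirE (v : Plane) : v = v 0 • dirE 0 + v 1 • dirE 1 := by
  ext i
  fin_cases i <;> simp [dirE]

namespace IsDifferentiableCAR

variable (hS : IsDifferentiableCAR b T S D)

include hS

/-- Expectation of the anticommutation relation in `ψ`: `‖b f ψ‖² + ‖(b f)^* ψ‖²` equals `|S f f|
‖ψ‖²`. -/
theorem norm_sq_le [Nontrivial H] (f : V) : ‖b f‖ ^ 2 ≤ ‖S f f‖ := by
  have h1 : ∀ ψ, ‖b f ψ‖ ^ 2 ≤ ‖S f f‖ * ‖ψ‖ ^ 2 := fun ψ => by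
    have h2 := congrArg (fun A : H →L[ℂ] H => (inner ℂ ψ (A ψ) : ℂ)) (hS.anticomm f f)
    simp only [add_apply, mul_apply_eq_comp, smul_apply,
      one_apply_eq_self, inner_add_right, inner_smul_right,
      ContinuousLinearMap.star_eq_adjoint, ContinuousLinearMap.adjoint_inner_right] at h2
    rw [← ContinuousLinearMap.adjoint_inner_left (b f) _ ψ] at h2
    simp only [inner_self_eq_norm_sq_to_K] at h2
    have h3 := congrArg norm h2
    rw [norm_mul] at h3
    have h4 : ‖((‖ψ‖ : ℂ)) ^ 2‖ = ‖ψ‖ ^ 2 := by simp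
    have h5 : ‖((‖b f ψ‖ : ℂ)) ^ 2 + ((‖ContinuousLinearMap.adjoint (b f) ψ‖ : ℂ)) ^ 2‖ =
        ‖b f ψ‖ ^ 2 + ‖ContinuousLinearMap.adjoint (b f) ψ‖ ^ 2 := by
      rw [← Complex.ofReal_pow, ← Complex.ofReal_pow, ← Complex.ofReal_add, Complex.norm_real,
        Real.norm_of_nonneg (by positivity)]
    have h6 : ‖b f ψ‖ ^ 2 + ‖ContinuousLinearMap.adjoint (b f) ψ‖ ^ 2 = ‖S f f‖ * ‖ψ‖ ^ 2 := by
      rw [← h4, ← h5]; exact h3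
    nlinarith [sq_nonneg ‖ContinuousLinearMap.adjoint (b f) ψ‖]
  have h2 : ‖b f‖ ≤ Real.sqrt ‖S f f‖ := by
    refine ContinuousLinearMap.opNorm_le_bound _ (Real.sqrt_nonneg _) fun ψ => ?_
    refine abs_le_of_sq_le_sq' ?_ (by positivity) |>.2
    rw [mul_pow, Real.sq_sqrt (norm_nonneg _)]
    exact h1 ψ
  calc ‖b f‖ ^ 2 ≤ Real.sqrt ‖S f f‖ ^ 2 := by gcongr
    _ = _ := Real.sq_sqrt (norm_nonneg _)

theorem norm_form_le [Nontrivial H] (f h : V) : ‖S f h‖ ≤ 2 * ‖b f‖ * ‖b h‖ := by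
  have h1 : ‖S f h‖ = ‖S f h • (1 : H →L[ℂ] H)‖ := by rw [norm_smul, norm_one, mul_one]
  rw [h1, ← hS.anticomm]
  calc _ ≤ ‖star (b f) * b h‖ + ‖b h * star (b f)‖ := norm_add_le _ _
    _ ≤ ‖star (b f)‖ * ‖b h‖ + ‖b h‖ * ‖star (b f)‖ := add_le_add (norm_mul_le _ _) (norm_mul_le _ _)
    _ = _ := by rw [norm_star]; ring

/-- `S` is not assumed additive; it inherits this from `b`, because the anticommutators determine
its values. In the same way it is antilinear in the first argument, hence real scalars in
`form_smul`. -/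
theorem form_sub [Nontrivial H] (f f' h : V) : S (f - f') h = S f h - S f' h := by
  refine smul_left_injective ℂ (one_ne_zero (α := H →L[ℂ] H)) ?_
  simp only [sub_smul, ← hS.anticomm, map_sub, star_sub, sub_mul, mul_sub]
  abel

theorem form_smul [Nontrivial H] (t : ℝ) (f h : V) : S ((t : ℂ) • f) h = t * S f h := by
  refine smul_left_injective ℂ (one_ne_zero (α := H →L[ℂ] H)) ?_
  simp only [mul_smul, ← hS.anticomm, map_smul, star_smul, smul_add, smul_mul_assoc, mul_smul_comm]
  simp

/-- The mean value inequality is applied to `τ ↦ S (c τ) (c t)`, with the end point `c t` as fixed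
second argument. It bounds `|S (c t) (c t)|`, hence `‖b (c t)‖²`, by `2N‖b (c t)‖|t|`, and one
factor `‖b (c t)‖` cancels. -/
theorem norm_path_le [Nontrivial H] {c c' : ℝ → V} {N : ℝ} (t : ℝ)
    (hd : ∀ h τ, HasDerivAt (fun t => S (c t) h) (S (c' τ) h) τ) (h0 : ∀ h, S (c 0) h = 0)
    (hN : ∀ τ, |τ| ≤ |t| → ‖b (c' τ)‖ ≤ N) : ‖b (c t)‖ ≤ 2 * N * |t| := by
  have h1 : ‖S (c t) (c t)‖ ≤ (2 * N * ‖b (c t)‖) * ‖t - 0‖ := by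
    have h2 := (convex_closedBall (0 : ℝ) |t|).norm_image_sub_le_of_norm_hasDerivWithin_le
      (f := fun τ => S (c τ) (c t)) (f' := fun τ => S (c' τ) (c t)) (C := 2 * N * ‖b (c t)‖)
      (x := 0) (y := t) (fun τ _ => (hd (c t) τ).hasDerivWithinAt) (fun τ hτ => ?_)
      (by simp) (by simp)
    · simpa [h0] using h2
    · refine (hS.norm_form_le _ _).trans ?_
      have := hN τ (by simpa using hτ)
      gcongr
  rw [sub_zero, Real.norm_eq_abs] at h1
  have h3 := (hS.norm_sq_le (c t)).trans h1
  rcases (norm_nonneg (b (c t))).eq_or_lt with h4 | h4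
  · rw [← h4]
    have := (norm_nonneg _).trans (hN 0 (by simp))
    positivity
  · nlinarith

variable (hc : IsCovariant b T W)

include hc

theorem form_action_zero [Nontrivial H] (f h : V) : S (T 0 f) h = S f h := by
  refine smul_left_injective ℂ (one_ne_zero (α := H →L[ℂ] H)) ?_
  simp only [← hS.anticomm, hc.action_zero]

theorem norm_sub_le [Nontrivial H] (i : Fin 2) (f : V) (t : ℝ) :
    ‖b (T (t • dirE i) f) - b f‖ ≤ 2 * ‖b (D i f)‖ * |t| := by
  rw [← map_sub]
  refine hS.norm_path_le (c := fun t => T (t • dirE i) f - f) (c' := fun t => T (t • dirE i) (D i f))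
    t (fun h τ => ?_) (fun h => ?_) (fun τ _ => (hc.norm_action _ _).le)
  · simpa only [hS.form_sub] using (hS.hasDerivAt i f h τ).sub_const (S f h)
  · rw [hS.form_sub, zero_smul, hS.form_action_zero hc, sub_self]

/-- Second-order version: the path whose speed is `T (t • dirE i) (D i f) - D i f`, which
`norm_sub_le` bounds linearly in time. -/
theorem norm_sub_sub_le [Nontrivial H] (i : Fin 2) (f : V) (t : ℝ) :
    ‖b (T (t • dirE i) f) - b f - (t : ℂ) • b (D i f)‖ ≤ 4 * ‖b (D i (D i f))‖ * t ^ 2 := by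
  rw [← map_sub, ← map_smul, ← map_sub]
  refine (hS.norm_path_le (c := fun t => T (t • dirE i) f - f - (t : ℂ) • D i f)
    (c' := fun t => T (t • dirE i) (D i f) - D i f) (N := 2 * ‖b (D i (D i f))‖ * |t|)
    t (fun h τ => ?_) (fun h => ?_) (fun τ hτ => ?_)).trans (le_of_eq ?_)
  · simp only [hS.form_sub, hS.form_smul]
    have h1 : HasDerivAt (fun t : ℝ => (t : ℂ) * S (D i f) h) (S (D i f) h) τ := by
      simpa using (Complex.ofRealCLM.hasDerivAt (x := τ)).mul_const (S (D i f) h)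
    exact ((hS.hasDerivAt i f h τ).sub_const (S f h)).sub h1
  · simp only [hS.form_sub, hS.form_smul, zero_smul, hS.form_action_zero hc]
    simp
  · rw [map_sub]
    refine (hS.norm_sub_le hc i (D i f) τ).trans ?_
    gcongr
  · rw [← sq_abs t]; ring

theorem hasFDerivAt_orbit_zero [Nontrivial H] (f : V) :
    HasFDerivAt (fun s => b (T s f)) (orbitDeriv b D f) 0 := by
  have hbound : ∀ v : Plane, ‖b (T v f) - b f - orbitDeriv b D f v‖ ≤
      (4 * ‖b (D 1 (D 1 f))‖ + 2 * ‖b (D 0 (D 1 f))‖ + 4 * ‖b (D 0 (D 0 f))‖) * ‖v‖ ^ 2 := by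
    intro v
    have hv : ∀ i, |v i| ≤ ‖v‖ := fun i => PiLp.norm_apply_le v i
    have h1 : b (T v f) = conjIsometry (W (v 0 • dirE 0)) (b (T (v 1 • dirE 1) f)) := by
      rw [← hc.apply_action, ← hc.action_add, ← eq_sum_dirE]
    -- Go first along axis 1, then along axis 0. The remainder of the first leg is transported
    -- isometrically, the middle term is the change of its derivative along the second leg, and the
    -- last is the remainder of that leg.
    have h2 : b (T v f) - b f - orbitDeriv b D f v =
        conjIsometry (W (v 0 • dirE 0))
          (b (T (v 1 • dirE 1) f) - b f - ((v 1 : ℝ) : ℂ) • b (D 1 f)) +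
        ((v 1 : ℝ) : ℂ) • (b (T (v 0 • dirE 0) (D 1 f)) - b (D 1 f)) +
        (b (T (v 0 • dirE 0) f) - b f - ((v 0 : ℝ) : ℂ) • b (D 0 f)) := by
      rw [map_sub, map_sub, ← h1, ← hc.apply_action, map_smul, ← hc.apply_action, orbitDeriv_apply,
        Fin.sum_univ_two, Complex.coe_smul, Complex.coe_smul, Complex.coe_smul, smul_sub]
      abel
    rw [h2]
    refine (norm_add₃_le).trans ?_
    rw [LinearIsometry.norm_map, norm_smul, Complex.norm_real, Real.norm_eq_abs]
    have e1 := hS.norm_sub_sub_le hc 1 f (v 1)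
    have e2 := hS.norm_sub_le hc 0 (D 1 f) (v 0)
    have e3 := hS.norm_sub_sub_le hc 0 f (v 0)
    have q1 : (v 1) ^ 2 ≤ ‖v‖ ^ 2 := by rw [← sq_abs]; gcongr; exact hv 1
    have q0 : (v 0) ^ 2 ≤ ‖v‖ ^ 2 := by rw [← sq_abs]; gcongr; exact hv 0
    have e1' := e1.trans (mul_le_mul_of_nonneg_left q1 (by positivity))
    have e3' := e3.trans (mul_le_mul_of_nonneg_left q0 (by positivity))
    have e2' : |v 1| * ‖b (T (v 0 • dirE 0) (D 1 f)) - b (D 1 f)‖ ≤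
        ‖v‖ * (2 * ‖b (D 0 (D 1 f))‖ * ‖v‖) :=
      mul_le_mul (hv 1) (e2.trans (mul_le_mul_of_nonneg_left (hv 0) (by positivity)))
        (norm_nonneg _) (norm_nonneg _)
    nlinarith
  rw [hasFDerivAt_iff_isLittleO_nhds_zero]
  refine Asymptotics.IsBigO.trans_isLittleO (g := fun v : Plane => ‖v‖ ^ 2) ?_ ?_
  · refine Asymptotics.IsBigO.of_bound (4 * ‖b (D 1 (D 1 f))‖ + 2 * ‖b (D 0 (D 1 f))‖ +
      4 * ‖b (D 0 (D 0 f))‖) (Eventually.of_forall fun v => ?_)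
    rw [zero_add, hc.action_zero, norm_pow, norm_norm]
    exact hbound v
  · exact (Asymptotics.isLittleO_norm_pow_id one_lt_two)

theorem hasFDerivAt_orbit [Nontrivial H] (f : V) (s : Plane) :
    HasFDerivAt (fun s => b (T s f))
      (∑ i, (EuclideanSpace.proj i : Plane →L[ℝ] ℝ).smulRight (b (T s (D i f)))) s := by
  have h1 := hS.hasFDerivAt_orbit_zero hc f
  let L : (H →L[ℂ] H) →L[ℝ] (H →L[ℂ] H) :=
    (conjIsometry (W s)).toContinuousLinearMap.restrictScalars ℝ
  have h2 : HasFDerivAt (fun t => b (T t f)) (orbitDeriv b D f) (s - s) := by rwa [sub_self]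
  have h3 := L.hasFDerivAt.comp s (HasFDerivAt.comp (f := fun t : Plane => t - s) s h2 ((hasFDerivAt_id s).sub_const s))
  refine (h3.congr_fderiv ?_).congr_of_eventuallyEq (Eventually.of_forall fun t => ?_)
  · ext1 v
    change conjIsometry (W s) (orbitDeriv b D f v) = _
    rw [orbitDeriv_apply, map_sum, sum_apply]
    refine Finset.sum_congr rfl fun i _ => ?_
    rw [ContinuousLinearMap.smulRight_apply, hc.apply_action, ← Complex.coe_smul, map_smul,
      Complex.coe_smul]
    rfl
  · change b (T t f) = conjIsometry (W s) (b (T (t - s) f))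
    rw [← hc.apply_action, ← hc.action_add, add_sub_cancel]

/-- The derivative of an orbit is built from the orbits of `D 0 f` and `D 1 f`, so regularity
bootstraps. -/
theorem contDiff_orbit [Nontrivial H] (f : V) : ContDiff ℝ ∞ fun s => b (T s f) := by
  rw [contDiff_infty]
  intro n
  induction n generalizing f with
  | zero =>
    exact contDiff_zero.2 (continuous_iff_continuousAt.2 fun s =>
      (hS.hasFDerivAt_orbit hc f s).continuousAt)
  | succ n ih =>
    refine contDiff_succ_iff_hasFDerivAt.2 ⟨_, ?_, hS.hasFDerivAt_orbit hc f⟩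
    refine ContDiff.sum fun i _ => ?_
    exact (ContinuousLinearMap.smulRightL ℝ Plane (H →L[ℂ] H)
      (EuclideanSpace.proj i : Plane →L[ℝ] ℝ)).contDiff.comp (ih (D i f))

/-- The orbits of the field operators are smooth with bounded derivatives. -/
theorem cb_orbit [Nontrivial H] (f : V) : Cb fun s => b (T s f) := by
  refine Cb.of_isometric_translates (hS.contDiff_orbit hc f)
    (fun s => ⟨(conjIsometry (W s)).toLinearMap.restrictScalars ℝ, (conjIsometry (W s)).norm_map⟩) fun s v => ?_
  rw [hc.action_add, hc.apply_action s]
  rfl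

end IsDifferentiableCAR

theorem IsCovariant.cb_of_smoothVector (hc : IsCovariant b T W) {Ψ : H} (hΨ : SmoothVector W Ψ) :
    Cb fun s => W s Ψ :=
  Cb.of_isometric_translates hΨ (fun s => ⟨(W s).toLinearEquiv.toLinearMap.restrictScalars ℝ, (W s).norm_map⟩)
    fun s v => hc.add s v Ψ

end Covariant

end WarpedDirac

namespace WarpedDirac

/-! ## Warped convolutions of covariant fields -/

section Warped

variable {V : Type*} [AddCommGroup V] [Module ℂ V]
variable {H : Type*} [NormedAddCommGroup H] [InnerProductSpace ℂ H] [CompleteSpace H]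
variable {b : V →ₗ[ℂ] (H →L[ℂ] H)} {T : Plane → V → V} {W : Plane → H ≃ₗᵢ[ℂ] H}

theorem Cb.sub {E F : Type*} [NormedAddCommGroup E] [NormedSpace ℝ E] [NormedAddCommGroup F]
    [NormedSpace ℝ F] {G K : E → F} (hG : Cb G) (hK : Cb K) : Cb fun z => G z - K z := by
  simpa only [sub_eq_add_neg] using hG.add hK.neg

theorem J_add {F : Type*} [NormedAddCommGroup F] [NormedSpace ℂ F] [CompleteSpace F]
    {G K : PP → F} (hG : Cb G) (hK : Cb K) : J (fun z => G z + K z) = J G + J K := by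
  have h1 := J_sub hG hK.neg
  have h2 := J_clm (-ContinuousLinearMap.id ℂ F) hK
  simp only [neg_apply, ContinuousLinearMap.coe_id', id_eq] at h2
  simpa only [sub_neg_eq_add, h2] using h1

theorem J_const_mul (c : ℂ) {G : PP → ℂ} (hG : Cb G) : J (fun z => c * G z) = c * J G :=
  J_clm (ContinuousLinearMap.mul ℂ ℂ c) hG

theorem J_mul_const (c : ℂ) {G : PP → ℂ} (hG : Cb G) : J (fun z => G z * c) = J G * c := by
  simpa only [mul_comm _ c] using J_const_mul c hG

/-- A closed subspace is its double orthogonal complement, so membership is tested by functionals,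
and these commute with `J`. -/
theorem J_mem {K : Submodule ℂ H} (hK : IsClosed (K : Set H)) {G : PP → H} (hG : Cb G)
    (h : ∀ z, G z ∈ K) : J G ∈ K := by
  have : CompleteSpace K := hK.completeSpace_coe
  rw [← Submodule.orthogonal_orthogonal K, Submodule.mem_orthogonal]
  intro x hx
  change innerSL ℂ x (J G) = 0
  rw [← J_clm (innerSL ℂ x) hG]
  have h0 : (fun z => innerSL ℂ x (G z)) = fun _ => (0 : ℂ) :=
    funext fun z => (Submodule.mem_orthogonal' K x).1 hx _ (h z)
  rw [h0]
  exact J_fst (K := fun _ => (0 : ℂ)) (Cb.const 0)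

theorem Cb.apply {E : Type*} [NormedAddCommGroup E] [NormedSpace ℝ E] {A : E → H →L[ℂ] H}
    {ψ : E → H} (hA : Cb A) (hψ : Cb ψ) : Cb fun x => A x (ψ x) :=
  Cb.bilin (ContinuousLinearMap.restrictScalarsL ℂ H H ℝ ℝ) hA hψ

theorem Cb.clm_complex {E : Type*} [NormedAddCommGroup E] [NormedSpace ℝ E] {ψ : E → H}
    (hψ : Cb ψ) (L : H →L[ℂ] ℂ) : Cb fun x => L (ψ x) :=
  hψ.clm (L.restrictScalars ℝ)

theorem Cb.comp_Q {F : Type*} [NormedAddCommGroup F] [NormedSpace ℝ F] {K : Plane → F} (hK : Cb K)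
    (lam : ℝ) : Cb fun s => K (lam • Q s) :=
  hK.comp_clm (lam • Qc)

variable (hc : IsCovariant b T W) (hb : ∀ f, Cb fun s => b (T s f))

include hc

/-- Moving `W (λQs)` to the right past the field separates the variables: the field depends on `s`,
the vector on `s'`. -/
theorem IsCovariant.warpIntegrand_eq (lam : ℝ) (f : V) (Ψ : H) (s s' : Plane) :
    warpIntegrand W lam (b f) Ψ s s' = b (T (lam • Q s) f) (W s' Ψ) := by
  rw [warpIntegrand, hc.cov, ← hc.add, add_sub_cancel]

include hb

theorem IsCovariant.cb_warpIntegrand (lam : ℝ) (f : V) {Ψ : H} (hΨ : SmoothVector W Ψ) :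
    Cb fun z : PP => b (T (lam • Q z.1) f) (W z.2 Ψ) :=
  ((hb f).comp_clm (lam • Qc.comp (ContinuousLinearMap.fst ℝ Plane Plane))).apply
    ((hc.cb_of_smoothVector hΨ).comp_clm (ContinuousLinearMap.snd ℝ Plane Plane))

theorem IsCovariant.hasOscInt_warp (lam : ℝ) (f : V) {Ψ : H} (hΨ : SmoothVector W Ψ) :
    HasOscInt (warpIntegrand W lam (b f) Ψ) (J fun z : PP => b (T (lam • Q z.1) f) (W z.2 Ψ)) := by
  have h := hasOscInt_J (hc.cb_warpIntegrand hb lam f hΨ)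
  have h2 : warpIntegrand W lam (b f) Ψ = fun s s' => b (T (lam • Q s) f) (W s' Ψ) :=
    funext₂ fun s s' => hc.warpIntegrand_eq lam f Ψ s s'
  rwa [h2]

theorem IsCovariant.warp_eq (lam : ℝ) (f : V) {Ψ : H} (hΨ : SmoothVector W Ψ) :
    warp W lam (b f) Ψ = J fun z : PP => b (T (lam • Q z.1) f) (W z.2 Ψ) := by
  have h := hc.hasOscInt_warp hb lam f hΨ
  rw [warp, dif_pos ⟨_, h⟩]
  exact HasOscInt.unique (Exists.choose_spec (⟨_, h⟩ : ∃ Φ, HasOscInt _ Φ)) h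

theorem IsCovariant.apply_warp (lam : ℝ) (f : V) {Ψ : H} (hΨ : SmoothVector W Ψ) (x : Plane) :
    W x (warp W lam (b f) Ψ) =
      J fun z : PP => b (T (x + lam • Q z.1) f) (W (x + z.2) Ψ) := by
  rw [hc.warp_eq hb lam f hΨ]
  have h := J_clm ((W x : H →L[ℂ] H)) (hc.cb_warpIntegrand hb lam f hΨ)
  refine h.symm.trans (congrArg J (funext fun z => ?_))
  change W x (b (T (lam • Q z.1) f) (W z.2 Ψ)) = _
  rw [hc.cov, ← hc.add, ← hc.action_add]

/-- By `apply_warp` the translation enters the integrand as a smooth parameter, and `Cb.J` applies.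
This is what allows warped fields to be applied repeatedly. -/
theorem IsCovariant.smoothVector_warp (lam : ℝ) (f : V) {Ψ : H} (hΨ : SmoothVector W Ψ) :
    SmoothVector W (warp W lam (b f) Ψ) := by
  have h1 : Cb fun p : Plane × PP => b (T (p.1 + lam • Q p.2.1) f) (W (p.1 + p.2.2) Ψ) :=
    ((hb f).comp_clm (ContinuousLinearMap.fst ℝ Plane PP +
      lam • Qc.comp ((ContinuousLinearMap.fst ℝ Plane Plane).comp
        (ContinuousLinearMap.snd ℝ Plane PP)))).apply
    ((hc.cb_of_smoothVector hΨ).comp_clm (ContinuousLinearMap.fst ℝ Plane PP +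
      (ContinuousLinearMap.snd ℝ Plane Plane).comp (ContinuousLinearMap.snd ℝ Plane PP)))
  have h2 := h1.J.1
  simp only [← hc.apply_warp hb lam f hΨ] at h2
  exact h2

theorem IsCovariant.warp_mem (lam : ℝ) {K K' : Submodule ℂ H} (hK' : IsClosed (K' : Set H))
    (hW : ∀ s, ∀ ψ ∈ K, W s ψ ∈ K) (hKK' : ∀ f, ∀ ψ ∈ K, b f ψ ∈ K') (f : V) {Ψ : H}
    (hΨ : SmoothVector W Ψ) (hm : Ψ ∈ K) : warp W lam (b f) Ψ ∈ K' := by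
  rw [hc.warp_eq hb lam f hΨ]
  exact J_mem hK' (hc.cb_warpIntegrand hb lam f hΨ) fun z => hKK' _ _ (hW _ _ hm)

variable {Ω : H} (hΩ : ∀ s, W s Ω = Ω)

include hΩ

omit hc hb in
theorem smoothVector_of_invariant : SmoothVector W Ω := by
  unfold SmoothVector
  simp only [hΩ]
  exact contDiff_const

/-- Invariance of `Ω` removes `s'` from the integrand, and `J` of a function of `s` alone is its
value at `0`. -/
theorem IsCovariant.warp_vacuum (lam : ℝ) (f : V) : warp W lam (b f) Ω = b f Ω := by
  rw [hc.warp_eq hb lam f (smoothVector_of_invariant hΩ)]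
  simp only [hΩ]
  have h := J_fst (((hb f).comp_Q lam).apply (Cb.const Ω))
  rw [h]
  have h0 : lam • Q 0 = 0 := by rw [← Qc_apply, map_zero, smul_zero]
  rw [h0, hc.action_zero]

/-- The unitary on the left is absorbed by `Ω`, and what remains is a function of `s' - λQs`. A
shear makes it a function of `s'` alone, evaluated at `0`. -/
theorem IsCovariant.inner_warp (lam : ℝ) (f : V) {Ψ : H} (hΨ : SmoothVector W Ψ) :
    inner ℂ Ω (warp W lam (b f) Ψ) = inner ℂ Ω (b f Ψ) := by
  rw [hc.warp_eq hb lam f hΨ]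
  have h1 := J_clm (innerSL ℂ Ω) (hc.cb_warpIntegrand hb lam f hΨ)
  refine h1.symm.trans ?_
  have h2 : ∀ z : PP, innerSL ℂ Ω (b (T (lam • Q z.1) f) (W z.2 Ψ)) =
      inner ℂ Ω (b f (W (z.2 - lam • Q z.1) Ψ)) := fun z => by
    rw [← hc.warpIntegrand_eq, innerSL_apply_apply, warpIntegrand, ← hΩ (lam • Q z.1),
      LinearIsometryEquiv.inner_map_map, hΩ]
  simp only [h2]
  have h3 := J_snd_sub lam (((hc.cb_of_smoothVector hΨ).clm_complex
    ((innerSL ℂ Ω).comp (b f))))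
  refine h3.trans ?_
  change inner ℂ Ω (b f (W 0 Ψ)) = _
  rw [hc.zero]

omit hb in
theorem IsCovariant.inner_translate (f g : V) (s t : Plane) :
    inner ℂ Ω (b (T s f) (b (T t g) Ω)) = (inner ℂ Ω (b f (b (T (t - s) g) Ω)) : ℂ) := by
  have h1 : b (T s f) (b (T t g) Ω) = W s (b f (b (T (t - s) g) Ω)) := by
    rw [hc.cov, hc.cov, hΩ, ← hc.action_add, add_sub_cancel]
  rw [h1]
  calc (inner ℂ Ω (W s (b f (b (T (t - s) g) Ω))) : ℂ)
      = inner ℂ (W s Ω) (W s (b f (b (T (t - s) g) Ω))) := by rw [hΩ]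
    _ = _ := LinearIsometryEquiv.inner_map_map _ _ _

omit hc in
theorem cb_twoPoint (f g : V) : Cb fun x => (inner ℂ Ω (b f (b (T x g) Ω)) : ℂ) :=
  ((hb g).apply (Cb.const Ω)).clm_complex ((innerSL ℂ Ω).comp (b f))

omit hΩ in
/-- The expectation value of a double warped convolution as an iterated oscillatory integral. -/
theorem IsCovariant.clm_warp_warp (lam : ℝ) (L : H →L[ℂ] ℂ) (f g : V) {Ψ : H}
    (hΨ : SmoothVector W Ψ) :
    L (warp W lam (b f) (warp W lam (b g) Ψ)) = J fun z : PP => J fun y : PP =>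
      L (b (T (lam • Q z.1) f) (b (T (z.2 + lam • Q y.1) g) (W (z.2 + y.2) Ψ))) := by
  have hs := hc.smoothVector_warp hb lam g hΨ
  rw [hc.warp_eq hb lam f hs, ← J_clm L (hc.cb_warpIntegrand hb lam f hs)]
  refine congrArg J (funext fun z => ?_)
  have h1 : Cb fun y : PP => b (T (z.2 + lam • Q y.1) g) (W (z.2 + y.2) Ψ) := by
    have e1 := (hb g).comp_affine (lam • Qc.comp (ContinuousLinearMap.fst ℝ Plane Plane)) z.2
    have e2 := (hc.cb_of_smoothVector hΨ).comp_affine (ContinuousLinearMap.snd ℝ Plane Plane) z.2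
    have e3 := e1.apply e2
    simp only [add_comm _ z.2] at e3
    exact e3
  rw [hc.apply_warp hb lam g hΨ]
  exact (J_clm (L.comp (b (T (lam • Q z.1) f))) h1).symm

/-- The deformed four-point function of a field with a quasifree vacuum vector. -/
theorem IsCovariant.inner_warp_four (lam : ℝ) (f₁ f₂ f₃ f₄ : V)
    (hwick : ∀ f₁ f₂ f₃ f₄ : V, (inner ℂ Ω (b f₁ (b f₂ (b f₃ (b f₄ Ω)))) : ℂ) =
      inner ℂ Ω (b f₁ (b f₂ Ω)) * inner ℂ Ω (b f₃ (b f₄ Ω))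
      - inner ℂ Ω (b f₁ (b f₃ Ω)) * inner ℂ Ω (b f₂ (b f₄ Ω))
      + inner ℂ Ω (b f₁ (b f₄ Ω)) * inner ℂ Ω (b f₂ (b f₃ Ω))) :
    (inner ℂ Ω (warp W lam (b f₁) (warp W lam (b f₂) (warp W lam (b f₃)
      (warp W lam (b f₄) Ω)))) : ℂ) =
      inner ℂ Ω (b f₁ (b f₂ Ω)) * inner ℂ Ω (b f₃ (b f₄ Ω))
      + inner ℂ Ω (b f₁ (b f₄ Ω)) * inner ℂ Ω (b f₂ (b f₃ Ω))
      - J fun z : PP => inner ℂ Ω (b f₁ (b (T z.1 f₃) Ω)) *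
          inner ℂ Ω (b f₂ (b (T (-((2 * lam) • Q z.2)) f₄) Ω)) := by
  have hΩs : SmoothVector W Ω := smoothVector_of_invariant hΩ
  have h4 := hc.warp_vacuum hb hΩ lam f₄
  have h4s := hc.smoothVector_warp hb lam f₄ hΩs
  have h3s := hc.smoothVector_warp hb lam f₃ h4s
  -- The leftmost warping disappears against `Ω` and the rightmost through `h4`; only the two middle
  -- ones leave oscillatory integrals.
  rw [hc.inner_warp hb hΩ lam f₁ (hc.smoothVector_warp hb lam f₂ h3s)]
  refine (hc.clm_warp_warp hb lam ((innerSL ℂ Ω).comp (b f₁)) f₂ f₃ h4s).trans ?_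
  set a : V → V → Plane → ℂ := fun f g x => inner ℂ Ω (b f (b (T x g) Ω)) with ha
  have hcb : ∀ f g, Cb (a f g) := fun f g => cb_twoPoint hb hΩ f g
  have hzero : ∀ f g, inner ℂ Ω (b f (b g Ω)) = a f g 0 := fun f g => by
    simp only [ha, hc.action_zero]
  -- Wick's formula, with two-point functions depending only on differences of translations. The
  -- variable `z` belongs to the warping of `f₂`, and `y` to that of `f₃`.
  have hpt : ∀ z y : PP, ((innerSL ℂ Ω).comp (b f₁)) (b (T (lam • Q z.1) f₂)
      (b (T (z.2 + lam • Q y.1) f₃) (W (z.2 + y.2) (warp W lam (b f₄) Ω)))) =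
      a f₁ f₂ (lam • Q z.1) * a f₃ f₄ (y.2 - lam • Q y.1)
      - a f₁ f₃ (z.2 + lam • Q y.1) * a f₂ f₄ ((z.2 - lam • Q z.1) + y.2)
      + a f₂ f₃ ((z.2 - lam • Q z.1) + lam • Q y.1) * a f₁ f₄ (z.2 + y.2) := fun z y => by
    rw [h4, hc.cov, hΩ]
    refine (hwick _ _ _ _).trans ?_
    rw [hc.inner_translate hΩ f₃ f₄, hc.inner_translate hΩ f₂ f₄, hc.inner_translate hΩ f₂ f₃]
    simp only [ha]
    rw [add_sub_add_left_eq_sub, add_sub_right_comm z.2, add_sub_right_comm z.2,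
      mul_comm (inner ℂ Ω (b f₁ (b (T (z.2 + y.2) f₄) Ω)))]
  -- In the first pairing the integral over `y` sets the argument to `0`; the other two are twisted
  -- products by definition, at points linear in `z`.
  have hinner : ∀ z : PP, (J fun y : PP => ((innerSL ℂ Ω).comp (b f₁)) (b (T (lam • Q z.1) f₂)
      (b (T (z.2 + lam • Q y.1) f₃) (W (z.2 + y.2) (warp W lam (b f₄) Ω))))) =
      a f₁ f₂ (lam • Q z.1) * a f₃ f₄ 0
      - twist lam (a f₁ f₃) (a f₂ f₄) (z.2, z.2 - lam • Q z.1)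
      + twist lam (a f₂ f₃) (a f₁ f₄) (z.2 - lam • Q z.1, z.2) := fun z => by
    simp only [hpt]
    have c1 : Cb fun y : PP => a f₃ f₄ (y.2 - lam • Q y.1) :=
      (hcb f₃ f₄).comp_clm (ContinuousLinearMap.snd ℝ Plane Plane -
        lam • Qc.comp (ContinuousLinearMap.fst ℝ Plane Plane))
    have c1' : Cb fun y : PP => a f₁ f₂ (lam • Q z.1) * a f₃ f₄ (y.2 - lam • Q y.1) :=
      (Cb.const _).mul c1
    have c2 := (cb_twist_integrand lam (hcb f₁ f₃) (hcb f₂ f₄)).slice_right (z.2, z.2 - lam • Q z.1)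
    have c3 := (cb_twist_integrand lam (hcb f₂ f₃) (hcb f₁ f₄)).slice_right (z.2 - lam • Q z.1, z.2)
    refine (J_add (c1'.sub c2) c3).trans ?_
    refine congrArg₂ (· + ·) ((J_sub c1' c2).trans (congrArg₂ (· - ·) ?_ rfl)) rfl
    rw [J_const_mul _ c1, J_snd_sub lam (hcb f₃ f₄)]
  simp only [hinner]
  have d1 : Cb fun z : PP => a f₁ f₂ (lam • Q z.1) :=
    (hcb f₁ f₂).comp_clm (lam • Qc.comp (ContinuousLinearMap.fst ℝ Plane Plane))
  have d1' : Cb fun z : PP => a f₁ f₂ (lam • Q z.1) * a f₃ f₄ 0 := d1.mul (Cb.const _)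
  have d2 : Cb fun z : PP => twist lam (a f₁ f₃) (a f₂ f₄) (z.2, z.2 - lam • Q z.1) :=
    (cb_twist lam (hcb f₁ f₃) (hcb f₂ f₄)).comp_clm
      ((ContinuousLinearMap.snd ℝ Plane Plane).prod (ContinuousLinearMap.snd ℝ Plane Plane -
        lam • Qc.comp (ContinuousLinearMap.fst ℝ Plane Plane)))
  have d3 : Cb fun z : PP => twist lam (a f₂ f₃) (a f₁ f₄) (z.2 - lam • Q z.1, z.2) :=
    (cb_twist lam (hcb f₂ f₃) (hcb f₁ f₄)).comp_clm
      ((ContinuousLinearMap.snd ℝ Plane Plane - lam • Qc.comp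
        (ContinuousLinearMap.fst ℝ Plane Plane)).prod (ContinuousLinearMap.snd ℝ Plane Plane))
  have e1 : J (fun z : PP => a f₁ f₂ (lam • Q z.1) * a f₃ f₄ 0) = a f₁ f₂ 0 * a f₃ f₄ 0 := by
    rw [J_mul_const _ d1, J_fst ((hcb f₁ f₂).comp_Q lam)]
    have h0 : lam • Q 0 = 0 := by rw [← Qc_apply, map_zero, smul_zero]
    rw [h0]
  have key := J_add (d1'.sub d2) d3
  rw [J_sub d1' d2, e1, J_twist_crossed (hcb f₁ f₃) (hcb f₂ f₄) lam,
    J_twist_nested (hcb f₂ f₃) (hcb f₁ f₄) lam] at key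
  rw [hzero f₁ f₂, hzero f₃ f₄, hzero f₁ f₄, hzero f₂ f₃]
  refine key.trans ?_
  rw [mul_comm (a f₂ f₃ 0), add_comm_sub, sub_eq_add_neg, sub_eq_add_neg]
  abel

end Warped

end WarpedDirac

namespace WarpedDirac

/-! ## The field operators in the GNS representation -/

section Wick

theorem wick_eq_zero_of_odd {V : Type*} (w₂ : V → V → ℂ) :
    ∀ (n : ℕ) (l : List V), l.length = n → Odd n → wick w₂ l = 0 := by
  intro n
  induction n using Nat.strong_induction_on with
  | _ n ih =>
    intro l hl hn
    cases l with
    | nil => simp [← hl] at hn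
    | cons f l =>
      rw [wick]
      refine Finset.sum_eq_zero fun j _ => ?_
      have h1 := List.length_eraseIdx_of_lt j.2
      have h2 : l.length + 1 = n := by simpa using hl
      have h3 := j.2
      rw [ih (n - 2) (by omega) _ (by omega) (by obtain ⟨k, hk⟩ := hn; exact ⟨k - 1, by omega⟩),
        mul_zero]

theorem wick_two {V : Type*} (w₂ : V → V → ℂ) (a b : V) : wick w₂ [a, b] = w₂ a b := by
  rw [wick]
  simp [wick]

theorem wick_four {V : Type*} (w₂ : V → V → ℂ) (a b c d : V) :
    wick w₂ [a, b, c, d] = w₂ a b * w₂ c d - w₂ a c * w₂ b d + w₂ a d * w₂ b c := by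
  rw [wick]
  simp only [List.length_cons, List.length_nil, Fin.sum_univ_succ, Fin.sum_univ_zero]
  simp [wick_two]
  ring

end Wick

section GNS

variable {M : Type*} [TopologicalSpace M] [ChartedSpace R4 M] [IsManifold (𝓡 4) ∞ M]
  [MeasurableSpace M] {X : SpinSpacetime M} {μ : Measure M} {m : ℝ}
  {G : FundamentalSolutions X m} {A : Type*} [CStarAlgebra A] {B : G.K →ₗ[ℂ] A}
  {H : Type*} [NormedAddCommGroup H] [InnerProductSpace ℂ H] [CompleteSpace H]
  {π : A →⋆ₐ[ℂ] (H →L[ℂ] H)} {Ω : H} {w : A →ₗ[ℂ] ℂ}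

/-- The field operators in a representation. -/
noncomputable def fieldOp (G : FundamentalSolutions X m) (B : G.K →ₗ[ℂ] A)
    (π : A →⋆ₐ[ℂ] (H →L[ℂ] H)) : Test M →ₗ[ℂ] (H →L[ℂ] H) :=
  π.toAlgHom.toLinearMap ∘ₗ B ∘ₗ Submodule.mkQ _

theorem fieldOp_apply (f : Test M) : fieldOp G B π f = π (B (G.cls f)) := rfl

theorem map_monomial_cons (f : Test M) (l : List (Test M)) (ψ : H) :
    π (monomial G B (f :: l)) ψ = fieldOp G B π f (π (monomial G B l) ψ) := by
  simp [monomial, fieldOp_apply]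

theorem map_monomial_nil (ψ : H) : π (monomial G B []) ψ = ψ := by
  simp [monomial]

theorem inner_monomial (hπ : IsGNS w π Ω) (l : List (Test M)) :
    inner ℂ Ω (π (monomial G B l) Ω) = npt G B w l := hπ.vacuum _

theorem npt_two (hπ : IsGNS w π Ω) (f g : Test M) :
    npt G B w [f, g] = inner ℂ Ω (fieldOp G B π f (fieldOp G B π g Ω)) := by
  rw [← inner_monomial hπ, map_monomial_cons, map_monomial_cons, map_monomial_nil]

/-- Since `B(f)^* = B(Γf)`, the range of `B` is closed under the involution. The generated star
algebra is thus the generated algebra, spanned by words in the fields. -/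
theorem mem_span_monomial (hB : IsCAR G μ B) {a : A}
    (ha : a ∈ StarAlgebra.adjoin ℂ (Set.range B)) :
    a ∈ Submodule.span ℂ (Set.range (monomial G B)) := by
  have hstar : star (Set.range B) ⊆ Set.range B := by
    rintro _ ⟨k, hk⟩
    obtain ⟨f, rfl⟩ := Submodule.Quotient.mk_surjective _ k
    refine ⟨G.cls (conj f), ?_⟩
    rw [← hB.star_field]
    exact star_eq_iff_star_eq.1 hk.symm
  have h1 : a ∈ Algebra.adjoin ℂ (Set.range B) := by
    have h2 : a ∈ Algebra.adjoin ℂ (Set.range B ∪ star (Set.range B)) := ha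
    rwa [Set.union_eq_self_of_subset_right hstar] at h2
  rw [← Subalgebra.mem_toSubmodule, Algebra.adjoin_eq_span] at h1
  refine Submodule.span_mono ?_ h1
  intro x hx
  induction hx using Submonoid.closure_induction with
  | mem x hx =>
    obtain ⟨k, rfl⟩ := hx
    obtain ⟨f, rfl⟩ := Submodule.Quotient.mk_surjective _ k
    exact ⟨[f], by simp [monomial]; rfl⟩
  | one => exact ⟨[], rfl⟩
  | mul x y _ _ hx hy =>
    obtain ⟨l, rfl⟩ := hx
    obtain ⟨l', rfl⟩ := hy
    exact ⟨l ++ l', by simp [monomial]⟩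

theorem dense_span_monomial (hB : IsCAR G μ B) (hπ : IsGNS w π Ω) :
    Dense (Submodule.span ℂ (Set.range fun l => π (monomial G B l) Ω) : Set H) := by
  set K := Submodule.span ℂ (Set.range fun l => π (monomial G B l) Ω)
  have hcont : Continuous fun a => π a Ω :=
    (ContinuousLinearMap.apply ℂ H Ω).continuous.comp
      (AddMonoidHomClass.continuous_of_bound π 1 fun a => by
        simpa using NonUnitalStarAlgHom.norm_apply_le π a)
  have h1 : ∀ a, π a Ω ∈ closure (K : Set H) := fun a => by
    have ha : a ∈ closure (StarAlgebra.adjoin ℂ (Set.range B) : Set A) := by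
      rw [hB.generates]; trivial
    refine map_mem_closure (f := fun a => π a Ω) hcont ha fun x hx => ?_
    have h2 := mem_span_monomial hB hx
    clear hx
    induction h2 using Submodule.span_induction with
    | mem x hx =>
      obtain ⟨l, rfl⟩ := hx
      exact Submodule.subset_span ⟨l, rfl⟩
    | zero => simp
    | add x y _ _ hx hy =>
      simp only [map_add, add_apply]
      exact K.add_mem hx hy
    | smul c x _ hx =>
      simp only [map_smul, smul_apply]
      exact K.smul_mem c hx
  rw [dense_iff_closure_eq, ← closure_closure]
  exact (hπ.cyclic.mono (by rintro _ ⟨a, rfl⟩; exact h1 a)).closure_eq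

theorem IsImplementation.fieldOp_covariant (hB : IsCAR G μ B) (hπ : IsGNS w π Ω)
    {U : SpinIsometry X → H ≃ₗᵢ[ℂ] H} (hU : IsImplementation G B π Ω U) (k : SpinIsometry X)
    (f : Test M) (ψ : H) : U k (fieldOp G B π f ψ) = fieldOp G B π (k.u f) (U k ψ) := by
  have h : (U k : H →L[ℂ] H) ∘L fieldOp G B π f = fieldOp G B π (k.u f) ∘L (U k : H →L[ℂ] H) := by
    refine ContinuousLinearMap.ext_on (dense_span_monomial hB hπ) ?_
    rintro _ ⟨l, rfl⟩
    change U k (fieldOp G B π f (π (monomial G B l) Ω)) =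
      fieldOp G B π (k.u f) (U k (π (monomial G B l) Ω))
    rw [← map_monomial_cons, hU, hU, List.map_cons, map_monomial_cons]
  exact congrArg (fun A : H →L[ℂ] H => A ψ) h

theorem IsImplementation.vacuum {U : SpinIsometry X → H ≃ₗᵢ[ℂ] H}
    (hU : IsImplementation G B π Ω U) (k : SpinIsometry X) : U k Ω = Ω := by
  simpa only [map_monomial_nil, List.map_nil] using hU k []

/-- `U` is not assumed to be a homomorphism. Composition laws are read off from the action on test
sections, because words in the fields applied to `Ω` span a dense subspace. -/
theorem IsImplementation.ext_of_u (hB : IsCAR G μ B) (hπ : IsGNS w π Ω)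
    {U : SpinIsometry X → H ≃ₗᵢ[ℂ] H} (hU : IsImplementation G B π Ω U) {k k' k'' : SpinIsometry X}
    (h : ∀ f, k.u f = k'.u (k''.u f)) (ψ : H) : U k ψ = U k' (U k'' ψ) := by
  have h1 : (U k : H →L[ℂ] H) = (U k' : H →L[ℂ] H) ∘L (U k'' : H →L[ℂ] H) := by
    refine ContinuousLinearMap.ext_on (dense_span_monomial hB hπ) ?_
    rintro _ ⟨l, rfl⟩
    change U k (π (monomial G B l) Ω) = U k' (U k'' (π (monomial G B l) Ω))
    rw [hU, hU, hU, List.map_map, List.map_congr_left fun f _ => h f]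
    rfl
  exact congrArg (fun A : H →L[ℂ] H => A ψ) h1

theorem SpinFlow.isCovariant {ξ : KillingPair X} (φ : SpinFlow ξ) (hB : IsCAR G μ B)
    (hπ : IsGNS w π Ω) {U : SpinIsometry X → H ≃ₗᵢ[ℂ] H} (hU : IsImplementation G B π Ω U) :
    IsCovariant (fieldOp G B π) (fun s => (φ.lift s).u) (fun s => U (φ.lift s)) where
  add s t ψ := hU.ext_of_u hB hπ (φ.u_add s t) ψ
  zero ψ := by
    -- The operator at `s = 0` is idempotent, and an injective idempotent is the identity.
    have h := hU.ext_of_u hB hπ (k := φ.lift 0) (k' := φ.lift 0) (k'' := φ.lift 0)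
      (fun f => by rw [φ.u_zero, φ.u_zero]) ψ
    exact ((U (φ.lift 0)).injective h).symm
  cov s f ψ := hU.fieldOp_covariant hB hπ _ f ψ
  action_add := φ.u_add

theorem SpinFlow.isDifferentiableCAR [T2Space M] [SecondCountableTopology M] [BorelSpace M]
    [IsFiniteMeasureOnCompacts μ] {ξ : KillingPair X} (φ : SpinFlow ξ) (hB : IsCAR G μ B) :
    IsDifferentiableCAR (fieldOp G B π) (fun s => (φ.lift s).u) (G.form μ) φ.lie where
  anticomm f h := by
    -- Since `Γ` is an involution, inserting `conj f` turns the relation into the one between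
    -- `B(f)^*` and `B(h)`.
    have h1 := hB.anticomm (conj f) h
    rw [conj_conj, ← hB.star_field] at h1
    have h2 := congrArg π h1
    rw [AlgHomClass.commutes, Algebra.algebraMap_eq_smul_one] at h2
    simpa only [fieldOp_apply, map_add, map_mul, map_star] using h2
  hasDerivAt i f h t := φ.hasDerivAt_form G i f h t

/-- The closed span of the vectors which are generated from `Ω` by a number of fields of the parity
of `n`. -/
noncomputable def paritySpace (G : FundamentalSolutions X m) (B : G.K →ₗ[ℂ] A)
    (π : A →⋆ₐ[ℂ] (H →L[ℂ] H)) (Ω : H) (n : ℕ) : Submodule ℂ H :=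
  (Submodule.span ℂ {ψ | ∃ l : List (Test M), Even (l.length + n) ∧
    ψ = π (monomial G B l) Ω}).topologicalClosure

theorem map_mem_paritySpace {n n' : ℕ} (L : H →L[ℂ] H)
    (h : ∀ l : List (Test M), Even (l.length + n) →
      L (π (monomial G B l) Ω) ∈ paritySpace G B π Ω n') {ψ : H}
    (hψ : ψ ∈ paritySpace G B π Ω n) : L ψ ∈ paritySpace G B π Ω n' := by
  have h1 : paritySpace G B π Ω n ≤ (paritySpace G B π Ω n').comap (L : H →ₗ[ℂ] H) := by
    refine Submodule.topologicalClosure_minimal _ (Submodule.span_le.2 ?_)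
      ((Submodule.isClosed_topologicalClosure _).preimage L.continuous)
    rintro _ ⟨l, hl, rfl⟩
    exact h l hl
  exact h1 hψ

theorem monomial_mem_paritySpace {n : ℕ} {l : List (Test M)} (h : Even (l.length + n)) :
    π (monomial G B l) Ω ∈ paritySpace G B π Ω n :=
  Submodule.le_topologicalClosure _ (Submodule.subset_span ⟨l, h, rfl⟩)

theorem inner_paritySpace (hπ : IsGNS w π Ω) (hquasi : Quasifree G B w) {n : ℕ} (hn : Odd n)
    {ψ : H} (hψ : ψ ∈ paritySpace G B π Ω n) : inner ℂ Ω ψ = 0 := by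
  have h1 : paritySpace G B π Ω n ≤ LinearMap.ker (innerSL ℂ Ω : H →L[ℂ] ℂ).toLinearMap := by
    refine Submodule.topologicalClosure_minimal _ (Submodule.span_le.2 ?_)
      (ContinuousLinearMap.isClosed_ker (innerSL ℂ Ω))
    rintro _ ⟨l, hl, rfl⟩
    change inner ℂ Ω (π (monomial G B l) Ω) = 0
    rw [inner_monomial hπ, hquasi]
    refine wick_eq_zero_of_odd _ _ l rfl ?_
    rcases Nat.even_or_odd l.length with h | h
    · exact absurd hl (Nat.not_even_iff_odd.2 (h.add_odd hn))
    · exact h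
  exact h1 hψ

end GNS

end WarpedDirac

theorem proposition3p5
    {M : Type*} [TopologicalSpace M] [ChartedSpace WarpedDirac.R4 M] [IsManifold (𝓡 4) ∞ M]
    [T2Space M] [SecondCountableTopology M] [ConnectedSpace M]
    [MeasurableSpace M] [BorelSpace M]
    (X : WarpedDirac.SpinSpacetime M) (_hX : X.GloballyHyperbolic)
    (μ : Measure M) (hμ : X.IsVolume μ)
    (ξ : WarpedDirac.KillingPair X) (φ : WarpedDirac.SpinFlow ξ)
    (m : ℝ) (_hm : 0 ≤ m) (G : WarpedDirac.FundamentalSolutions X m)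
    {A : Type*} [CStarAlgebra A] (B : G.K →ₗ[ℂ] A) (hB : WarpedDirac.IsCAR G μ B)
    (w : A →ₗ[ℂ] ℂ) (hw : WarpedDirac.IsState w)
    (hquasi : WarpedDirac.Quasifree G B w) (hinv : WarpedDirac.IsoInvariant G B w)
    {H : Type*} [NormedAddCommGroup H] [InnerProductSpace ℂ H] [CompleteSpace H]
    (π : A →⋆ₐ[ℂ] (H →L[ℂ] H)) (Ω : H) (hπ : WarpedDirac.IsGNS w π Ω)
    (U : WarpedDirac.SpinIsometry X → H ≃ₗᵢ[ℂ] H)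
    (hU : WarpedDirac.IsImplementation G B π Ω U)
    (lam : ℝ) :
    -- the warped fields are defined, by convergent oscillatory integrals, on the smooth vectors
    -- obtained by applying warped fields to the vacuum vector
    (∀ (f : WarpedDirac.Test M) (l : List (WarpedDirac.Test M)),
      WarpedDirac.SmoothVector (fun s => U (φ.lift s))
        (WarpedDirac.deformedVector G B π Ω (fun s => U (φ.lift s)) lam l) ∧
      WarpedDirac.HasOscInt
        (WarpedDirac.warpIntegrand (fun s => U (φ.lift s)) lam (π (B (G.cls f)))
          (WarpedDirac.deformedVector G B π Ω (fun s => U (φ.lift s)) lam l))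
        (WarpedDirac.deformedVector G B π Ω (fun s => U (φ.lift s)) lam (f :: l))) ∧
    -- the odd functions
    (∀ l : List (WarpedDirac.Test M), Odd l.length →
      WarpedDirac.deformedNpt G B π Ω (fun s => U (φ.lift s)) lam l = 0) ∧
    -- the two-point function
    (∀ f₁ f₂ : WarpedDirac.Test M,
      WarpedDirac.deformedNpt G B π Ω (fun s => U (φ.lift s)) lam [f₁, f₂] =
        WarpedDirac.npt G B w [f₁, f₂]) ∧
    -- the four-point function
    (∀ f₁ f₂ f₃ f₄ : WarpedDirac.Test M, ∃ J : ℂ,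
      WarpedDirac.HasOscInt
        (fun s s' => WarpedDirac.npt G B w [f₁, (φ.lift s).u f₃] *
          WarpedDirac.npt G B w [f₂, (φ.lift (-((2 * lam) • WarpedDirac.Q s'))).u f₄]) J ∧
      WarpedDirac.deformedNpt G B π Ω (fun s => U (φ.lift s)) lam [f₁, f₂, f₃, f₄] =
        WarpedDirac.npt G B w [f₁, f₂] * WarpedDirac.npt G B w [f₃, f₄]
        + WarpedDirac.npt G B w [f₁, f₄] * WarpedDirac.npt G B w [f₂, f₃]
        - J) := by
  have : IsLocallyFiniteMeasure μ := hμ.isLocallyFiniteMeasure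
  have hnorm : inner ℂ Ω Ω = (1 : ℂ) := by
    have h := hπ.vacuum 1
    rwa [map_one, one_apply_eq_self, hw.1] at h
  -- Needed to read scalars off multiples of the identity operator in the norm estimates.
  have : Nontrivial H := ⟨Ω, 0, fun h => by simp [h] at hnorm⟩
  have hc := φ.isCovariant hB hπ hU
  have hb : ∀ f, WarpedDirac.Cb fun s => WarpedDirac.fieldOp G B π ((φ.lift s).u f) := fun f =>
    (φ.isDifferentiableCAR (π := π) hB).cb_orbit hc f
  have hΩ : ∀ s, U (φ.lift s) Ω = Ω := fun s => hU.vacuum _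
  have hsmooth : ∀ l, WarpedDirac.SmoothVector (fun s => U (φ.lift s))
      (WarpedDirac.deformedVector G B π Ω (fun s => U (φ.lift s)) lam l) := by
    intro l
    induction l with
    | nil => exact WarpedDirac.smoothVector_of_invariant hΩ
    | cons f l ih => exact hc.smoothVector_warp hb lam f ih
  refine ⟨fun f l => ⟨hsmooth l, ?_⟩, fun l hl => ?_, fun f₁ f₂ => ?_, fun f₁ f₂ f₃ f₄ => ?_⟩
  · have h := hc.hasOscInt_warp hb lam f (hsmooth l)
    rwa [← hc.warp_eq hb lam f (hsmooth l)] at h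
  -- A deformed vector with `n` fields lies in the closed span of the words of the parity of `n`;
  -- for odd `n`, quasifreeness makes that space orthogonal to `Ω`.
  · refine WarpedDirac.inner_paritySpace hπ hquasi hl ?_
    clear hl
    induction l with
    | nil =>
      have h := WarpedDirac.monomial_mem_paritySpace (G := G) (B := B) (π := π) (Ω := Ω) (n := 0)
        (l := []) (by simp)
      rwa [WarpedDirac.map_monomial_nil] at h
    | cons f l ih =>
      refine hc.warp_mem hb lam (Submodule.isClosed_topologicalClosure _) (fun s ψ hψ => ?_)
        (fun f ψ hψ => ?_) f (hsmooth l) ih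
      · refine WarpedDirac.map_mem_paritySpace (U (φ.lift s) : H →L[ℂ] H) (fun l' hl' => ?_) hψ
        change U (φ.lift s) _ ∈ _
        rw [hU]
        exact WarpedDirac.monomial_mem_paritySpace (by simpa using hl')
      · refine WarpedDirac.map_mem_paritySpace _ (fun l' hl' => ?_) hψ
        rw [← WarpedDirac.map_monomial_cons]
        refine WarpedDirac.monomial_mem_paritySpace ?_
        -- A field lengthens both the word and the list by one, so the sum of the lengths stays
        -- even.
        rw [List.length_cons, List.length_cons, add_add_add_comm]
        exact hl'.add even_two
  · rw [WarpedDirac.npt_two hπ]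
    refine (hc.inner_warp hb hΩ lam f₁ (hsmooth [f₂])).trans ?_
    exact congrArg (fun ψ => inner ℂ Ω (WarpedDirac.fieldOp G B π f₁ ψ))
      (hc.warp_vacuum hb hΩ lam f₂)
  · have hwick : ∀ f₁ f₂ f₃ f₄ : WarpedDirac.Test M,
        (inner ℂ Ω (WarpedDirac.fieldOp G B π f₁ (WarpedDirac.fieldOp G B π f₂
          (WarpedDirac.fieldOp G B π f₃ (WarpedDirac.fieldOp G B π f₄ Ω)))) : ℂ) =
        inner ℂ Ω (WarpedDirac.fieldOp G B π f₁ (WarpedDirac.fieldOp G B π f₂ Ω)) *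
          inner ℂ Ω (WarpedDirac.fieldOp G B π f₃ (WarpedDirac.fieldOp G B π f₄ Ω))
        - inner ℂ Ω (WarpedDirac.fieldOp G B π f₁ (WarpedDirac.fieldOp G B π f₃ Ω)) *
          inner ℂ Ω (WarpedDirac.fieldOp G B π f₂ (WarpedDirac.fieldOp G B π f₄ Ω))
        + inner ℂ Ω (WarpedDirac.fieldOp G B π f₁ (WarpedDirac.fieldOp G B π f₄ Ω)) *
          inner ℂ Ω (WarpedDirac.fieldOp G B π f₂ (WarpedDirac.fieldOp G B π f₃ Ω)) := by
      intro f₁ f₂ f₃ f₄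
      have h := hquasi [f₁, f₂, f₃, f₄]
      rw [WarpedDirac.wick_four, ← WarpedDirac.inner_monomial hπ] at h
      simpa only [WarpedDirac.npt_two hπ, WarpedDirac.map_monomial_cons,
        WarpedDirac.map_monomial_nil] using h
    simp only [WarpedDirac.npt_two hπ]
    refine ⟨_, WarpedDirac.hasOscInt_J (G := fun z : WarpedDirac.Plane × WarpedDirac.Plane =>
      inner ℂ Ω (WarpedDirac.fieldOp G B π f₁ (WarpedDirac.fieldOp G B π
        ((φ.lift z.1).u f₃) Ω)) *
      inner ℂ Ω (WarpedDirac.fieldOp G B π f₂ (WarpedDirac.fieldOp G B π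
        ((φ.lift (-((2 * lam) • WarpedDirac.Q z.2))).u f₄) Ω))) ?_,
      hc.inner_warp_four hb hΩ lam f₁ f₂ f₃ f₄ hwick⟩
    exact ((WarpedDirac.cb_twoPoint hb hΩ f₁ f₃).comp_clm
      (ContinuousLinearMap.fst ℝ WarpedDirac.Plane WarpedDirac.Plane)).mul
      ((WarpedDirac.cb_twoPoint hb hΩ f₂ f₄).comp_clm (-((2 * lam) • WarpedDirac.Qc.comp
        (ContinuousLinearMap.snd ℝ WarpedDirac.Plane WarpedDirac.Plane))))
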